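/- Let $(\mathcal X,\mathcal F)$ be a measurable space, $K$ a Markov transition kernel on it, with $m$-step kernels $K^m$, and $\Pi$ a probability measure on $\mathcal X$. Let $(X_i)_{i\ge 1}$ be a Markov chain with transition kernel $K$ which is - stationary: $\Pi$ is invariant for $K$ and $X_1\sim\Pi$; - reversible: $\int_A K(x,B)\,\Pi(dx)=\int_B K(x,A)\,\Pi(dx)$ for all measurable $A,B\subseteq\mathcal X$; - geometrically ergodic: there are a constant $\kappa\in[0,1)$ and a function $Q:\mathcal X\to[0,\infty)$ such that $\sup_{A}|K^m(x,A)-\Pi(A)|\le Q(x)\,\kappa^m$ for all $x\in\mathcal X$ and all $m\ge 1$, the supremum being over measurable sets $A$. Let $f:\mathcal X\to\mathbb R$ be measurable with $E_\Pi(f^8)<\infty$. Then the series in the MCMC variance $$\sigma_f^2=\operatorname{Var} f(X_1)+2\sum_{i=2}^{\infty}\operatorname{Cov}\bigl(f(X_1),f(X_i)\bigr)$$ converges absolutely. Let $(a_n)$ and $(b_n)$ be sequences of natural numbers with $a_n\to\infty$, $b_n\to\infty$ and $\sqrt{a_n}/b_n\to 0$ as $n\to\infty$. The non-overlapping batch means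 estimator with $a_n$ batches of length $b_n$, computed from $X_1,\dots,X_{a_nb_n}$, is $$\hat\sigma^2_{BM,f}=\frac{b_n}{a_n-1}\sum_{k=1}^{a_n}\bigl(\bar Z_k-\bar Z\bigr)^2,\qquad \bar Z_k=\frac1{b_n}\sum_{i=1}^{b_n}f\bigl(X_{(k-1)b_n+i}\bigr),\qquad \bar Z=\frac1{a_n}\sum_{k=1}^{a_n}\bar Z_k .$$ Then, as $n\to\infty$, $$\sqrt{a_n}\,\bigl(\hat\sigma^2_{BM,f}-\sigma_f^2\bigr)\xrightarrow{d}N(0,2\sigma_f^4),$$ where $N(0,0)$ denotes the point mass at $0$. -/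

import Mathlib

open MeasureTheory ProbabilityTheory Filter Topology

noncomputable section

namespace BatchMeans

/-- The distance `sup_A |μ(A) - ν(A)|` over measurable sets `A` (the supremum is over a set bounded
by `1` when `μ` and `ν` are probability measures). -/
def tvDist {S : Type*} [MeasurableSpace S] (μ ν : Measure S) : ℝ :=
  ⨆ A : {A : Set S // MeasurableSet A}, |μ.real A - ν.real A|

/-- Geometric ergodicity of the transition kernel `K` with limit `π`. The power `K ^ m` is the
`m`-step transition kernel. The function `Q` need not be bounded, integrable or measurable. -/
def GeometricallyErgodic {S : Type*} [MeasurableSpace S] (K : Kernel S S) (π : Measure S) : Prop :=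
  ∃ κ : ℝ, 0 ≤ κ ∧ κ < 1 ∧ ∃ Q : S → ℝ, (∀ x, 0 ≤ Q x) ∧
    ∀ (x : S) (m : ℕ), 1 ≤ m → tvDist ((K ^ m) x) π ≤ Q x * κ ^ m

/-- `X 0, X 1, …` is, under `P`, a Markov chain with transition kernel `K` and initial law `π`: the
conditional law of `X (n + 1)` given the whole past `(X 0, …, X n)` is `K (X n, ·)`.
The chain is stationary when `π` is invariant for `K`. -/
structure IsMarkovChain {S Ω : Type*} [MeasurableSpace S] [MeasurableSpace Ω]
    (K : Kernel S S) (π : Measure S) (P : Measure Ω) (X : ℕ → Ω → S) : Prop where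
  measurable : ∀ n, Measurable (X n)
  initial : HasLaw (X 0) π P
  markov : ∀ n : ℕ,
    HasCondDistrib (X (n + 1)) (fun ω (i : Finset.Iic n) ↦ X i ω)
      (K.comap (fun h : Finset.Iic n → S ↦ h ⟨n, Finset.mem_Iic.2 le_rfl⟩)
        (measurable_pi_apply _)) P

/-- The lag `i` autocovariance `Cov (f (X 0), f (X i))`. -/
def autocov {S Ω : Type*} [MeasurableSpace Ω]
    (P : Measure Ω) (X : ℕ → Ω → S) (f : S → ℝ) (i : ℕ) : ℝ :=
  cov[fun ω ↦ f (X 0 ω), fun ω ↦ f (X i ω); P]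

/-- The MCMC variance `Var (f (X 0)) + 2 ∑_{i ≥ 1} Cov (f (X 0), f (X i))`. -/
def mcmcVariance {S Ω : Type*} [MeasurableSpace Ω]
    (P : Measure Ω) (X : ℕ → Ω → S) (f : S → ℝ) : ℝ :=
  Var[fun ω ↦ f (X 0 ω); P] + 2 * ∑' i : ℕ, autocov P X f (i + 1)

/-- The mean of the `k`-th batch of length `b` of the sequence `z`; here `k` and the positions in
the batch are counted from `0`. -/
def batchMean (z : ℕ → ℝ) (b k : ℕ) : ℝ :=
  (1 / (b : ℝ)) * ∑ i ∈ Finset.range b, z (k * b + i)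

/-- The mean of the first `a` batch means. -/
def overallMean (z : ℕ → ℝ) (a b : ℕ) : ℝ :=
  (1 / (a : ℝ)) * ∑ k ∈ Finset.range a, batchMean z b k

/-- The non-overlapping batch means estimator computed from the first `a * b` terms of `z`, with
`a` batches of length `b`. -/
def bmEstimator (z : ℕ → ℝ) (a b : ℕ) : ℝ :=
  ((b : ℝ) / ((a : ℝ) - 1)) *
    ∑ k ∈ Finset.range a, (batchMean z b k - overallMean z a b) ^ 2

end BatchMeans

end

/-! Write T for the operator `kernelOp K`, h = f - ∫ f dπ and v for the limiting variance.

Reversibility makes T self-adjoint on L²(π). For centered u the sequence ‖T^m u‖² is therefore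
log-convex, and geometric ergodicity makes it geometrically small for a dense class of u, with a
constant depending on u but a rate κ that does not. Log-convexity removes the constant: ‖Tu‖ ≤ κ‖u‖
(`exists_spectral_gap`). Jensen's inequality lifts geometric decay from L² to L⁴ and then to L⁸
(`exists_geometricDecay_double`), so the Neumann series solves the Poisson equation g - Tg = h with
g in L⁸ (`exists_poisson_solution`).

A block sum W of h of length n is then a martingale plus the boundary term g(X_s) - g(X_{s+n}).
Tested against bounded functions of the past, W² behaves like n v up to O(1) and W⁴ like 3 n² v² up
to O(n^{3/2}). Hence Y = W²/n - v has conditional mean O(1/n), conditional second moment 2v² +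
O(n^{-1/2}), and bounded L⁴ norm (`exists_blockDev_bounds`).

The central limit theorem for the Y's follows by adding one block at a time: each block multiplies E
cos(τ ∑ Y) by 1 - τ²v² up to a small error (`abs_integral_trig_sum_le`). With τ = t/√a the product
tends to exp(-v²t²), and the accumulated error is of order a^{-1/2} + b^{-1/2} + √a/b. The last term
comes from the O(1/b) bias of each block and is the reason for the hypothesis √a/b → 0. Positivity
of v plays no role, so the degenerate case is included.

Two identifications remain: v is the MCMC variance, by telescoping the autocovariances through g
(`tsum_integral_mul_iterate`, `martVar_eq`), and the estimator differs from the normalized sum of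
the Y's by O(a^{-1/2}) in L⁴ (`tendstoInMeasure_sub_devSum`). -/

noncomputable section

namespace BatchMeans

open scoped ENNReal

/-! ### Real-valued Lᵖ norms: Hölder, monotonicity, centering. -/

section LpNorm

variable {α : Type*} {mα : MeasurableSpace α} {μ : Measure α} {f g : α → ℝ} {p q r : ℝ≥0∞}

instance holderTriple_four_four_two : ENNReal.HolderTriple 4 4 2 where
  inv_add_inv_eq_inv := by
    rw [← ENNReal.toReal_eq_toReal_iff' (by simp) (by simp), ENNReal.toReal_add (by simp) (by simp)]
    norm_num

instance holderTriple_eight_eight_four : ENNReal.HolderTriple 8 8 4 where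
  inv_add_inv_eq_inv := by
    rw [← ENNReal.toReal_eq_toReal_iff' (by simp) (by simp), ENNReal.toReal_add (by simp) (by simp)]
    norm_num

lemma lpNorm_mul_le (hf : MemLp f p μ) (hg : MemLp g q μ) [ENNReal.HolderTriple p q r] :
    lpNorm (fun x ↦ f x * g x) r μ ≤ lpNorm f p μ * lpNorm g q μ := by
  have h := eLpNorm_smul_le_mul_eLpNorm (p := p) (q := q) (r := r) hg.1 hf.1
  rw [← toReal_eLpNorm (f := fun x ↦ f x * g x) (hf.1.mul hg.1), ← toReal_eLpNorm hf.1,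
    ← toReal_eLpNorm hg.1, ← ENNReal.toReal_mul]
  exact ENNReal.toReal_mono (ENNReal.mul_ne_top hf.eLpNorm_ne_top hg.eLpNorm_ne_top) h

lemma memLp_mul (hf : MemLp f p μ) (hg : MemLp g q μ) [ENNReal.HolderTriple p q r] :
    MemLp (fun x ↦ f x * g x) r μ := hg.mul' hf

lemma integrable_mul_of_memLp_two (hf : MemLp f 2 μ) (hg : MemLp g 2 μ) :
    Integrable (fun x ↦ f x * g x) μ := hf.integrable_mul hg

lemma lpNorm_mono_ae (hg : MemLp g p μ) (hf : AEStronglyMeasurable f μ)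
    (h : ∀ᵐ x ∂μ, |f x| ≤ |g x|) : lpNorm f p μ ≤ lpNorm g p μ := by
  rw [← toReal_eLpNorm hf, ← toReal_eLpNorm hg.1]
  exact ENNReal.toReal_mono hg.eLpNorm_ne_top (eLpNorm_mono_ae h)

lemma lpNorm_congr_ae (h : f =ᵐ[μ] g) : lpNorm f p μ = lpNorm g p μ := by
  by_cases hf : AEStronglyMeasurable f μ
  · rw [← toReal_eLpNorm hf, ← toReal_eLpNorm (hf.congr h), eLpNorm_congr_ae h]
  · rw [lpNorm_of_not_aestronglyMeasurable hf,
      lpNorm_of_not_aestronglyMeasurable fun hg ↦ hf (hg.congr h.symm)]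

lemma lpNorm_two_sq (hf : MemLp f 2 μ) : lpNorm f 2 μ ^ 2 = ∫ x, f x ^ 2 ∂μ := by
  rw [lpNorm_eq_integral_norm_rpow_toReal (by simp) (by simp) hf.1]
  have h0 : 0 ≤ ∫ x, f x ^ 2 ∂μ := integral_nonneg fun x ↦ sq_nonneg _
  simp only [ENNReal.toReal_ofNat, Real.rpow_ofNat, Real.norm_eq_abs, sq_abs]
  rw [← Real.rpow_natCast, ← Real.rpow_mul h0]
  norm_num

lemma lpNorm_sq (hp : p ≠ 0) (hp' : p ≠ ∞) (hf : AEStronglyMeasurable f μ) :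
    lpNorm (fun x ↦ f x ^ 2) p μ = lpNorm f (2 * p) μ ^ 2 := by
  rw [lpNorm_eq_integral_norm_rpow_toReal (f := fun x ↦ f x ^ 2) hp hp' (hf.pow 2),
    lpNorm_eq_integral_norm_rpow_toReal (by simp [hp]) (ENNReal.mul_ne_top (by simp) hp') hf]
  have h0 : 0 ≤ ∫ x, ‖f x‖ ^ (2 * p).toReal ∂μ := integral_nonneg fun x ↦ by positivity
  have hp0 : 0 < p.toReal := ENNReal.toReal_pos hp hp'
  rw [← Real.rpow_natCast, ← Real.rpow_mul h0]
  congr 1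
  · refine integral_congr_ae (ae_of_all _ fun x ↦ ?_)
    simp only [norm_pow, ENNReal.toReal_mul, ENNReal.toReal_ofNat]
    rw [Real.rpow_mul (norm_nonneg _)]
    norm_num
  · simp only [ENNReal.toReal_mul, ENNReal.toReal_ofNat]
    field_simp
    norm_num

lemma abs_integral_le_lpNorm_one (hf : AEStronglyMeasurable f μ) :
    |∫ x, f x ∂μ| ≤ lpNorm f 1 μ := by
  rw [lpNorm_one_eq_integral_norm hf]
  exact norm_integral_le_integral_norm f

lemma abs_integral_mul_le (hf : MemLp f 2 μ) (hg : MemLp g 2 μ) :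
    |∫ x, f x * g x ∂μ| ≤ lpNorm f 2 μ * lpNorm g 2 μ :=
  (abs_integral_le_lpNorm_one (hf.1.mul hg.1)).trans (lpNorm_mul_le hf hg)

lemma lpNorm_mono_exponent [IsProbabilityMeasure μ] (hpq : p ≤ q) (hf : MemLp f q μ) :
    lpNorm f p μ ≤ lpNorm f q μ := by
  rw [← toReal_eLpNorm hf.1, ← toReal_eLpNorm hf.1]
  exact ENNReal.toReal_mono hf.eLpNorm_ne_top (eLpNorm_le_eLpNorm_of_exponent_le hpq hf.1)

lemma abs_integral_le_lpNorm_two [IsProbabilityMeasure μ] (hf : MemLp f 2 μ) :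
    |∫ x, f x ∂μ| ≤ lpNorm f 2 μ :=
  (abs_integral_le_lpNorm_one hf.1).trans (lpNorm_mono_exponent (by norm_num) hf)

lemma lpNorm_const_eq [IsProbabilityMeasure μ] (hp : p ≠ 0) (c : ℝ) :
    lpNorm (fun _ ↦ c) p μ = |c| := by
  rw [lpNorm_const hp (IsProbabilityMeasure.ne_zero μ)]
  simp

lemma lpNorm_const_mul (c : ℝ) (f : α → ℝ) :
    lpNorm (fun x ↦ c * f x) p μ = |c| * lpNorm f p μ := by
  have := lpNorm_const_smul (p := p) c f μ
  exact this

lemma lpNorm_bounded_mul_le {A : α → ℝ} (hA : AEStronglyMeasurable A μ) (hA1 : ∀ x, |A x| ≤ 1)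
    (hf : MemLp f p μ) : lpNorm (fun x ↦ A x * f x) p μ ≤ lpNorm f p μ := by
  refine lpNorm_mono_ae hf (hA.mul hf.1) (ae_of_all _ fun x ↦ ?_)
  rw [abs_mul]
  exact mul_le_of_le_one_left (abs_nonneg _) (hA1 x)

lemma memLp_bounded_mul {A : α → ℝ} (hA : AEStronglyMeasurable A μ) (hA1 : ∀ x, |A x| ≤ 1)
    (hf : MemLp f p μ) : MemLp (fun x ↦ A x * f x) p μ := by
  refine hf.mono (hA.mul hf.1) (ae_of_all _ fun x ↦ ?_)
  simp only [norm_mul, Real.norm_eq_abs]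
  exact mul_le_of_le_one_left (abs_nonneg _) (hA1 x)

/-- Centering does not increase the `L²` norm. -/
lemma lpNorm_two_sub_integral_le [IsProbabilityMeasure μ] (hf : MemLp f 2 μ) :
    lpNorm (fun x ↦ f x - ∫ y, f y ∂μ) 2 μ ≤ lpNorm f 2 μ := by
  have hf1 : Integrable f μ := hf.integrable (by norm_num)
  have hm : MemLp (fun x ↦ f x - ∫ y, f y ∂μ) 2 μ := hf.sub (memLp_const _)
  refine le_of_sq_le_sq ?_ lpNorm_nonneg
  rw [lpNorm_two_sq hm, lpNorm_two_sq hf]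
  have : ∫ x, (f x - ∫ y, f y ∂μ) ^ 2 ∂μ = ∫ x, f x ^ 2 ∂μ - (∫ y, f y ∂μ) ^ 2 := by
    have : ∀ x, (f x - ∫ y, f y ∂μ) ^ 2
        = f x ^ 2 - (2 * (∫ y, f y ∂μ) * f x - (∫ y, f y ∂μ) ^ 2) := fun x ↦ by ring
    simp_rw [this]
    rw [integral_sub hf.integrable_sq (by fun_prop), integral_sub (by fun_prop) (by fun_prop),
      integral_const_mul]
    simp
    ring
  rw [this]
  nlinarith [sq_nonneg (∫ y, f y ∂μ)]

end LpNorm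

/-! ### The transition operator on Lᵖ of its invariant law. -/

section KernelOp

variable {S : Type*} [MeasurableSpace S]

/-- The action `u ↦ ∫ u dK(x, ·)` of a kernel on functions. -/
def kernelOp (K : Kernel S S) (u : S → ℝ) (x : S) : ℝ := ∫ y, u y ∂(K x)

variable {K : Kernel S S} {π : Measure S} {u w : S → ℝ} {p : ℝ≥0∞}

lemma measurable_kernelOp (hu : Measurable u) : Measurable (kernelOp K u) :=
  (hu.stronglyMeasurable.integral_kernel (κ := K)).measurable

lemma measurable_kernelOp_iterate (hu : Measurable u) (m : ℕ) :
    Measurable ((kernelOp K)^[m] u) := by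
  induction m with
  | zero => exact hu
  | succ m ih => rw [Function.iterate_succ_apply']; exact measurable_kernelOp ih

section Invariant

/-- Invariance turns a π-null set into a K(x, ·)-null set for π-almost every x. This is what lets
the operator act on almost-everywhere classes. -/
lemma ae_ae_of_invariant (hinv : Kernel.Invariant K π) {q : S → Prop} (h : ∀ᵐ x ∂π, q x) :
    ∀ᵐ x ∂π, ∀ᵐ y ∂(K x), q y := by
  rw [← hinv.def] at h
  exact Measure.ae_ae_of_ae_comp h

lemma kernelOp_congr_ae (hinv : Kernel.Invariant K π) (h : u =ᵐ[π] w) :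
    kernelOp K u =ᵐ[π] kernelOp K w := by
  filter_upwards [ae_ae_of_invariant hinv h] with x hx using integral_congr_ae hx

lemma kernelOp_iterate_congr_ae (hinv : Kernel.Invariant K π) (h : u =ᵐ[π] w) (m : ℕ) :
    (kernelOp K)^[m] u =ᵐ[π] (kernelOp K)^[m] w := by
  induction m with
  | zero => exact h
  | succ m ih => simp_rw [Function.iterate_succ_apply']; exact kernelOp_congr_ae hinv ih

lemma ae_integrable_kernel (hinv : Kernel.Invariant K π) (hu : Integrable u π) :
    ∀ᵐ x ∂π, Integrable u (K x) := by
  rw [← hinv.def] at hu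
  exact Measure.ae_integrable_of_integrable_comp hu

lemma kernelOp_add (hinv : Kernel.Invariant K π) (hu : Integrable u π) (hw : Integrable w π) :
    kernelOp K (fun x ↦ u x + w x) =ᵐ[π] fun x ↦ kernelOp K u x + kernelOp K w x := by
  filter_upwards [ae_integrable_kernel hinv hu, ae_integrable_kernel hinv hw] with x h1 h2
  exact integral_add h1 h2

lemma kernelOp_sub (hinv : Kernel.Invariant K π) (hu : Integrable u π) (hw : Integrable w π) :
    kernelOp K (fun x ↦ u x - w x) =ᵐ[π] fun x ↦ kernelOp K u x - kernelOp K w x := by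
  filter_upwards [ae_integrable_kernel hinv hu, ae_integrable_kernel hinv hw] with x h1 h2
  exact integral_sub h1 h2

lemma kernelOp_mono (hinv : Kernel.Invariant K π) (hu : Integrable u π) (hw : Integrable w π)
    (h : u ≤ᵐ[π] w) :
    kernelOp K u ≤ᵐ[π] kernelOp K w := by
  filter_upwards [ae_integrable_kernel hinv hu, ae_integrable_kernel hinv hw,
    ae_ae_of_invariant hinv h] with x h1 h2 h3
  exact integral_mono_ae h1 h2 h3

lemma integral_kernelOp (hinv : Kernel.Invariant K π) (hu : Integrable u π) :
    ∫ x, kernelOp K u x ∂π = ∫ x, u x ∂π := by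
  have h : (K ∘ₖ Kernel.const Unit π) () = π := by
    rw [← Measure.comp_eq_comp_const_apply]; exact hinv.def
  have := Kernel.integral_comp (η := K) (κ := Kernel.const Unit π) (a := ()) (f := u)
    (by rwa [h])
  rw [h] at this
  simpa [kernelOp] using this.symm

variable [IsMarkovKernel K]

/-- The L¹ norm is at most the Lᵖ norm under each probability measure K(x, ·); integrating the p-th
powers over x and using invariance gives the contraction. -/
lemma eLpNorm_kernelOp_le (hinv : Kernel.Invariant K π) (hp : 1 ≤ p) (hp' : p ≠ ∞)
    (hu : Measurable u) :
    eLpNorm (kernelOp K u) p π ≤ eLpNorm u p π := by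
  have hp0 : p ≠ 0 := (zero_lt_one.trans_le hp).ne'
  have hpos : 0 < p.toReal := ENNReal.toReal_pos hp0 hp'
  rw [eLpNorm_eq_lintegral_rpow_enorm_toReal hp0 hp',
    eLpNorm_eq_lintegral_rpow_enorm_toReal hp0 hp']
  refine ENNReal.rpow_le_rpow ?_ (by positivity)
  calc ∫⁻ x, ‖kernelOp K u x‖ₑ ^ p.toReal ∂π
      ≤ ∫⁻ x, ∫⁻ y, ‖u y‖ₑ ^ p.toReal ∂(K x) ∂π := by
        refine lintegral_mono fun x ↦ ?_
        have h1 : ‖kernelOp K u x‖ₑ ≤ eLpNorm u p (K x) := by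
          refine (enorm_integral_le_lintegral_enorm _).trans ?_
          rw [← eLpNorm_one_eq_lintegral_enorm]
          exact eLpNorm_le_eLpNorm_of_exponent_le hp hu.aestronglyMeasurable
        refine (ENNReal.rpow_le_rpow h1 hpos.le).trans ?_
        rw [eLpNorm_eq_lintegral_rpow_enorm_toReal hp0 hp', ← ENNReal.rpow_mul,
          one_div_mul_cancel hpos.ne', ENNReal.rpow_one]
    _ = ∫⁻ y, ‖u y‖ₑ ^ p.toReal ∂π := by
        conv_rhs => rw [← hinv.def]
        rw [Measure.lintegral_bind (Kernel.aemeasurable K)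
          (hu.enorm.pow_const _).aemeasurable]

lemma memLp_kernelOp (hinv : Kernel.Invariant K π) (hp : 1 ≤ p) (hp' : p ≠ ∞) (hm : Measurable u)
    (hu : MemLp u p π) :
    MemLp (kernelOp K u) p π :=
  ⟨(measurable_kernelOp hm).aestronglyMeasurable,
    (eLpNorm_kernelOp_le hinv hp hp' hm).trans_lt hu.eLpNorm_lt_top⟩

lemma lpNorm_kernelOp_le (hinv : Kernel.Invariant K π) (hp : 1 ≤ p) (hp' : p ≠ ∞)
    (hm : Measurable u) (hu : MemLp u p π) :
    lpNorm (kernelOp K u) p π ≤ lpNorm u p π := by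
  rw [← toReal_eLpNorm (measurable_kernelOp hm).aestronglyMeasurable, ← toReal_eLpNorm hu.1]
  exact ENNReal.toReal_mono hu.eLpNorm_ne_top (eLpNorm_kernelOp_le hinv hp hp' hm)

lemma memLp_kernelOp_iterate (hinv : Kernel.Invariant K π) (hp : 1 ≤ p) (hp' : p ≠ ∞)
    (hm : Measurable u) (hu : MemLp u p π)
    (m : ℕ) : MemLp ((kernelOp K)^[m] u) p π := by
  induction m with
  | zero => exact hu
  | succ m ih =>
    rw [Function.iterate_succ_apply']
    exact memLp_kernelOp hinv hp hp' (measurable_kernelOp_iterate hm m) ih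

lemma lpNorm_kernelOp_iterate_le (hinv : Kernel.Invariant K π) (hp : 1 ≤ p) (hp' : p ≠ ∞)
    (hm : Measurable u)
    (hu : MemLp u p π) (m : ℕ) : lpNorm ((kernelOp K)^[m] u) p π ≤ lpNorm u p π := by
  induction m with
  | zero => exact le_rfl
  | succ m ih =>
    rw [Function.iterate_succ_apply']
    exact (lpNorm_kernelOp_le hinv hp hp' (measurable_kernelOp_iterate hm m)
      (memLp_kernelOp_iterate hinv hp hp' hm hu m)).trans ih

lemma integrable_kernelOp_iterate (hinv : Kernel.Invariant K π) (hm : Measurable u)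
    (hu : Integrable u π) (m : ℕ) :
    Integrable ((kernelOp K)^[m] u) π :=
  memLp_one_iff_integrable.1
    (memLp_kernelOp_iterate hinv le_rfl (by simp) hm (memLp_one_iff_integrable.2 hu) m)

lemma kernelOp_iterate_add (hinv : Kernel.Invariant K π) (hum : Measurable u) (hwm : Measurable w)
    (hu : Integrable u π)
    (hw : Integrable w π) (m : ℕ) : (kernelOp K)^[m] (fun x ↦ u x + w x)
      =ᵐ[π] fun x ↦ (kernelOp K)^[m] u x + (kernelOp K)^[m] w x := by
  induction m with
  | zero => rfl
  | succ m ih =>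
    simp_rw [Function.iterate_succ_apply']
    exact (kernelOp_congr_ae hinv ih).trans (kernelOp_add hinv
      (integrable_kernelOp_iterate hinv hum hu m) (integrable_kernelOp_iterate hinv hwm hw m))

lemma kernelOp_iterate_sub (hinv : Kernel.Invariant K π) (hum : Measurable u) (hwm : Measurable w)
    (hu : Integrable u π)
    (hw : Integrable w π) (m : ℕ) : (kernelOp K)^[m] (fun x ↦ u x - w x)
      =ᵐ[π] fun x ↦ (kernelOp K)^[m] u x - (kernelOp K)^[m] w x := by
  induction m with
  | zero => rfl
  | succ m ih =>
    simp_rw [Function.iterate_succ_apply']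
    exact (kernelOp_congr_ae hinv ih).trans (kernelOp_sub hinv
      (integrable_kernelOp_iterate hinv hum hu m) (integrable_kernelOp_iterate hinv hwm hw m))

/-- Jensen's inequality for the action of a Markov kernel. -/
lemma sq_kernelOp_le (hinv : Kernel.Invariant K π) (hu : MemLp u 2 π) :
    ∀ᵐ x ∂π, kernelOp K u x ^ 2 ≤ kernelOp K (fun y ↦ u y ^ 2) x := by
  filter_upwards [ae_integrable_kernel hinv hu.integrable_sq,
    ae_ae_of_invariant hinv (hu.1.ae_eq_mk)] with x hx hx'
  have hm : AEStronglyMeasurable u (K x) := ⟨hu.1.mk u, hu.1.stronglyMeasurable_mk, hx'⟩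
  have h2 : MemLp u 2 (K x) := (memLp_two_iff_integrable_sq hm).2 hx
  have h3 := abs_integral_le_lpNorm_two h2
  have h4 := lpNorm_two_sq h2
  unfold kernelOp
  rw [← h4, ← sq_abs]
  exact pow_le_pow_left₀ (abs_nonneg _) h3 2

lemma sq_kernelOp_iterate_le (hinv : Kernel.Invariant K π) [IsFiniteMeasure π] (hm : Measurable u)
    (hu : MemLp u 2 π) (m : ℕ) :
    ∀ᵐ x ∂π, (kernelOp K)^[m] u x ^ 2 ≤ (kernelOp K)^[m] (fun y ↦ u y ^ 2) x := by
  induction m with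
  | zero => exact ae_of_all _ fun _ ↦ le_rfl
  | succ m ih =>
    have h1 := memLp_kernelOp_iterate hinv (by norm_num) (by simp) hm hu m
    have h2 := kernelOp_mono hinv h1.integrable_sq
      (integrable_kernelOp_iterate hinv (hm.pow_const 2) hu.integrable_sq m) ih
    simp_rw [Function.iterate_succ_apply']
    filter_upwards [h2, sq_kernelOp_le hinv h1] with x h3 h4 using h4.trans h3

lemma integral_kernelOp_iterate (hinv : Kernel.Invariant K π) (hm : Measurable u)
    (hu : Integrable u π) (m : ℕ) :
    ∫ x, (kernelOp K)^[m] u x ∂π = ∫ x, u x ∂π := by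
  induction m with
  | zero => rfl
  | succ m ih =>
    simp_rw [Function.iterate_succ_apply']
    rw [integral_kernelOp hinv (integrable_kernelOp_iterate hinv hm hu m), ih]

end Invariant

lemma kernelOp_const [IsMarkovKernel K] (c : ℝ) : kernelOp K (fun _ ↦ c) = fun _ ↦ c := by
  ext x; simp [kernelOp]

lemma kernelOp_iterate_const [IsMarkovKernel K] (c : ℝ) (m : ℕ) :
    (kernelOp K)^[m] (fun _ ↦ c) = fun _ ↦ c :=
  Function.iterate_fixed (kernelOp_const c) m

lemma kernelOp_iterate_sub_const [IsMarkovKernel K] [IsFiniteMeasure π]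
    (hinv : Kernel.Invariant K π) (hm : Measurable u) (hu : Integrable u π) (c : ℝ) (m : ℕ) :
    (kernelOp K)^[m] (fun x ↦ u x - c) =ᵐ[π] fun x ↦ (kernelOp K)^[m] u x - c := by
  have := kernelOp_iterate_sub hinv hm (measurable_const (a := c)) hu (integrable_const c) m
  rwa [kernelOp_iterate_const] at this

/-- The joint law of one transition of a reversible chain is symmetric. -/
lemma compProd_swap_of_isReversible [IsFiniteMeasure π] [IsMarkovKernel K]
    (hrev : Kernel.IsReversible K π) : (π ⊗ₘ K).map Prod.swap = π ⊗ₘ K := by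
  refine Measure.ext_prod fun {s t} hs ht ↦ ?_
  rw [Measure.map_apply measurable_swap (hs.prod ht), Set.preimage_swap_prod,
    Measure.compProd_apply_prod ht hs, Measure.compProd_apply_prod hs ht]
  exact hrev ht hs

/-- Both sides are integrals of a product of a function of the first and a function of the second
coordinate under the law of one transition, which is symmetric by reversibility. -/
lemma integral_mul_kernelOp_comm [IsProbabilityMeasure π] [IsMarkovKernel K]
    (hinv : Kernel.Invariant K π) (hrev : Kernel.IsReversible K π) (hum : Measurable u)
    (hwm : Measurable w) (hu : MemLp u 2 π) (hw : MemLp w 2 π) :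
    ∫ x, u x * kernelOp K w x ∂π = ∫ x, kernelOp K u x * w x ∂π := by
  have hsnd : (π ⊗ₘ K).snd = π := by rw [Measure.snd_compProd]; exact hinv.def
  have hfst : (π ⊗ₘ K).fst = π := Measure.fst_compProd ..
  have hmp1 : MeasurePreserving Prod.fst (π ⊗ₘ K) π := ⟨measurable_fst, hfst⟩
  have hmp2 : MeasurePreserving Prod.snd (π ⊗ₘ K) π := ⟨measurable_snd, hsnd⟩
  have key : ∀ {a c : S → ℝ}, MemLp a 2 π → MemLp c 2 π →
      ∫ z, a z.1 * c z.2 ∂(π ⊗ₘ K) = ∫ x, a x * kernelOp K c x ∂π := fun {a c} ha hc ↦ by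
    have hi : Integrable (fun z : S × S ↦ a z.1 * c z.2) (π ⊗ₘ K) :=
      (ha.comp_measurePreserving hmp1).integrable_mul (hc.comp_measurePreserving hmp2)
    rw [Measure.integral_compProd hi]
    simp_rw [integral_const_mul]
    rfl
  rw [← key hu hw]
  calc ∫ z, u z.1 * w z.2 ∂(π ⊗ₘ K) = ∫ z, u z.1 * w z.2 ∂((π ⊗ₘ K).map Prod.swap) := by
        rw [compProd_swap_of_isReversible hrev]
    _ = ∫ z : S × S, w z.1 * u z.2 ∂(π ⊗ₘ K) := by
        rw [integral_map measurable_swap.aemeasurable (by fun_prop)]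
        exact integral_congr_ae (ae_of_all _ fun z ↦ mul_comm _ _)
    _ = ∫ x, kernelOp K u x * w x ∂π := by
        rw [key hw hu]
        exact integral_congr_ae (ae_of_all _ fun z ↦ mul_comm _ _)

end KernelOp

/-! ### Spectral gap from reversibility and geometric ergodicity. -/

section SpectralGap

/-- The successive ratios of a log-convex sequence increase. A first ratio ρ above q would force
growth at least like ρ^m, against the bound C q^m. The constant C leaves no trace in the conclusion.
-/
lemma le_mul_of_logConvex_of_le_geometric {a : ℕ → ℝ} {C q : ℝ} (hq : 0 < q)
    (ha : ∀ m, 0 ≤ a m) (hconv : ∀ m, a (m + 1) ^ 2 ≤ a m * a (m + 2))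
    (hle : ∀ m, 1 ≤ m → a m ≤ C * q ^ m) : a 1 ≤ q * a 0 := by
  by_contra! hlt
  have h0 : 0 < a 0 := by
    refine lt_of_le_of_ne (ha 0) fun h ↦ ?_
    have := hconv 0
    rw [← h] at this hlt
    nlinarith
  obtain ⟨ρ, hρ⟩ : ∃ ρ, ρ = a 1 / a 0 := ⟨_, rfl⟩
  have hqρ : q < ρ := by rw [hρ, lt_div_iff₀ h0]; exact hlt
  have hρ0 : 0 < ρ := hq.trans hqρ
  have step : ∀ m, 0 < a m ∧ ρ * a m ≤ a (m + 1) := by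
    intro m
    induction m with
    | zero => exact ⟨h0, by rw [hρ, div_mul_cancel₀ _ h0.ne']⟩
    | succ m ih =>
      have hpos : 0 < a (m + 1) := lt_of_lt_of_le (mul_pos hρ0 ih.1) ih.2
      refine ⟨hpos, ?_⟩
      have h1 := hconv m
      have h2 : a m * (ρ * a (m + 1)) ≤ a m * a (m + 2) := by nlinarith [ih.2]
      exact le_of_mul_le_mul_left h2 ih.1
  have hpow : ∀ m, ρ ^ m * a 0 ≤ a m := by
    intro m
    induction m with
    | zero => simp
    | succ m ih =>
      calc ρ ^ (m + 1) * a 0 = ρ * (ρ ^ m * a 0) := by ring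
        _ ≤ ρ * a m := by gcongr
        _ ≤ a (m + 1) := (step m).2
  obtain ⟨n, hn⟩ := pow_unbounded_of_one_lt (C / a 0) ((one_lt_div hq).2 hqρ)
  have h1 := (hpow (n + 1)).trans (hle (n + 1) (by lia))
  have h2 : (ρ / q) ^ n ≤ (ρ / q) ^ (n + 1) :=
    pow_le_pow_right₀ ((one_lt_div hq).2 hqρ).le (by lia)
  have h3 : C / a 0 < (ρ / q) ^ (n + 1) := hn.trans_le h2
  rw [div_pow, div_lt_div_iff₀ h0 (by positivity)] at h3
  linarith

variable {S : Type*} [MeasurableSpace S] {K : Kernel S S} {π : Measure S}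

lemma abs_sub_le_tvDist {μ ν : Measure S} [IsProbabilityMeasure μ] [IsProbabilityMeasure ν]
    {A : Set S} (hA : MeasurableSet A) : |μ.real A - ν.real A| ≤ tvDist μ ν := by
  refine le_ciSup (f := fun A : {A : Set S // MeasurableSet A} ↦ |μ.real A - ν.real A|)
    ⟨1, ?_⟩ ⟨A, hA⟩
  rintro _ ⟨B, rfl⟩
  rw [abs_sub_le_iff]
  constructor <;> linarith [measureReal_le_one (μ := μ) (s := (B : Set S)),
    measureReal_le_one (μ := ν) (s := (B : Set S)), measureReal_nonneg (μ := μ) (s := (B : Set S)),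
    measureReal_nonneg (μ := ν) (s := (B : Set S))]

instance isMarkovKernel_pow [IsMarkovKernel K] (m : ℕ) : IsMarkovKernel (K ^ m) := by
  induction m with
  | zero => rw [pow_zero]; exact inferInstanceAs (IsMarkovKernel Kernel.id)
  | succ m ih => rw [pow_succ]; exact inferInstanceAs (IsMarkovKernel ((K ^ m) ∘ₖ K))

lemma kernelOp_iterate_indicator [IsMarkovKernel K] {A : Set S} (hA : MeasurableSet A) (m : ℕ)
    (x : S) : (kernelOp K)^[m] (A.indicator fun _ ↦ 1) x = ((K ^ m) x).real A := by
  induction m generalizing x with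
  | zero =>
    have : (K ^ 0) x = Measure.dirac x := by rw [pow_zero]; exact Kernel.id_apply x
    rw [this]
    simp [measureReal_def, Set.indicator, Measure.dirac_apply' _ hA]
    split_ifs <;> simp
  | succ m ih =>
    rw [Function.iterate_succ_apply']
    have : (K ^ (m + 1)) x A = ∫⁻ y, (K ^ m) y A ∂(K x) := by
      rw [pow_succ]; exact Kernel.comp_apply' _ _ _ hA
    simp only [kernelOp, ih, measureReal_def, this]
    rw [integral_toReal ((K ^ m).measurable_coe hA).aemeasurable
      (ae_of_all _ fun y ↦ measure_lt_top _ _)]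

/-- A weaker form of geometric ergodicity, with exceptional null sets, that suffices for the
spectral gap: the space is exhausted up to null sets by measurable sets `H n` on which the
convergence is uniformly geometric for each measurable set `A`. -/
lemma exists_uniform_sets [IsMarkovKernel K] [IsProbabilityMeasure π]
    (hgeo : GeometricallyErgodic K π) :
    ∃ κ : ℝ, 0 < κ ∧ κ < 1 ∧ ∃ H : ℕ → Set S, (∀ n, MeasurableSet (H n)) ∧
      Tendsto (fun n ↦ π.real (H n)ᶜ) atTop (𝓝 0) ∧
      ∀ (n m : ℕ) (A : Set S), 1 ≤ m → MeasurableSet A → ∀ᵐ x ∂π, x ∈ H n →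
        |(kernelOp K)^[m] (A.indicator fun _ ↦ 1) x - π.real A| ≤ n * κ ^ m := by
  obtain ⟨κ₀, hκ0, hκ1, Q, hQ, h⟩ := hgeo
  -- The maximum makes the rate strictly positive. The sublevel sets of Q need not be measurable, so
  -- they are replaced by their measurable hulls.
  refine ⟨max κ₀ (1 / 2), by positivity, max_lt hκ1 (by norm_num),
    fun n ↦ toMeasurable π {x | Q x ≤ n}, fun n ↦ measurableSet_toMeasurable _ _, ?_, ?_⟩
  · have h1 : Tendsto (fun n : ℕ ↦ π {x | Q x ≤ n}) atTop (𝓝 (π (⋃ n : ℕ, {x | Q x ≤ n}))) :=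
      tendsto_measure_iUnion_atTop fun i j hij x hx ↦
        (show Q x ≤ i from hx).trans (by exact_mod_cast hij)
    have h2 : (⋃ n : ℕ, {x | Q x ≤ n}) = Set.univ :=
      Set.eq_univ_of_forall fun x ↦ Set.mem_iUnion.2 (exists_nat_ge (Q x))
    rw [h2, measure_univ] at h1
    have h3 := (ENNReal.tendsto_toReal (by simp)).comp h1
    have h4 := h3.const_sub 1
    simp only [ENNReal.toReal_one, sub_self] at h4
    refine h4.congr fun n ↦ ?_
    rw [measureReal_compl (measurableSet_toMeasurable _ _)]
    simp [measureReal_def, measure_toMeasurable]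
  · intro n m A hm hA
    set B := {x | |(kernelOp K)^[m] (A.indicator fun _ ↦ 1) x - π.real A|
      ≤ n * max κ₀ (1 / 2) ^ m} with hB
    have hBm : MeasurableSet B := by
      refine measurableSet_le ?_ measurable_const
      exact ((measurable_kernelOp_iterate (measurable_const.indicator hA) m).sub_const _).abs
    have hsub : {x | Q x ≤ n} ⊆ B := by
      intro x (hx : Q x ≤ n)
      simp only [hB, Set.mem_ofPred_eq, kernelOp_iterate_indicator hA]
      refine (abs_sub_le_tvDist hA).trans ((h x m hm).trans ?_)
      have : κ₀ ≤ max κ₀ (1 / 2) := le_max_left _ _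
      gcongr
    -- The hull meets a measurable set in the same measure as the original set does, so the estimate
    -- valid on the sublevel set persists almost everywhere on the hull.
    have h0 : π (toMeasurable π {x | Q x ≤ n} ∩ Bᶜ) = 0 := by
      rw [Measure.measure_toMeasurable_inter hBm.compl (measure_ne_top _ _)]
      have : {x | Q x ≤ (n : ℝ)} ∩ Bᶜ = ∅ := by
        rw [← Set.sdiff_eq]; exact Set.sdiff_eq_empty.2 hsub
      rw [this, measure_empty]
    rw [← compl_mem_ae_iff] at h0
    filter_upwards [h0] with x hx hxH
    by_contra hxB
    exact hx ⟨hxH, hxB⟩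

/-- Linearity passes from indicators to simple functions. The constant depends on φ; only the rate κ
has to be common to all of them. -/
lemma simpleFunc_abs_kernelOp_iterate_sub_le [IsMarkovKernel K] [IsProbabilityMeasure π]
    (hinv : Kernel.Invariant K π) {κ c : ℝ} {H : Set S}
    (hH : ∀ (m : ℕ) (A : Set S), 1 ≤ m → MeasurableSet A → ∀ᵐ x ∂π, x ∈ H →
      |(kernelOp K)^[m] (A.indicator fun _ ↦ 1) x - π.real A| ≤ c * κ ^ m)
    (φ : SimpleFunc S ℝ) :
    ∃ C, ∀ m : ℕ, 1 ≤ m → ∀ᵐ x ∂π, x ∈ H →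
      |(kernelOp K)^[m] φ x - ∫ y, φ y ∂π| ≤ C * κ ^ m := by
  induction φ using SimpleFunc.induction with
  | @const a s hs =>
    refine ⟨|a| * c, fun m hm ↦ ?_⟩
    have hcoe : ⇑((SimpleFunc.const S a).piecewise s hs (SimpleFunc.const S 0))
        = fun x ↦ a * s.indicator (fun _ ↦ (1 : ℝ)) x := by
      ext x
      by_cases hx : x ∈ s <;> simp [SimpleFunc.coe_piecewise, hx]
    have hscale : ∀ (m : ℕ) (v : S → ℝ), (kernelOp K)^[m] (fun x ↦ a * v x)
        = fun x ↦ a * (kernelOp K)^[m] v x := by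
      intro m v
      induction m with
      | zero => rfl
      | succ m ih =>
        simp_rw [Function.iterate_succ_apply', ih]
        ext x
        exact integral_const_mul _ _
    rw [hcoe, hscale]
    filter_upwards [hH m s hm hs] with x hx hxH
    rw [integral_const_mul, ← mul_sub, abs_mul, mul_assoc]
    have : ∫ y, s.indicator (fun _ ↦ (1 : ℝ)) y ∂π = π.real s := integral_indicator_one hs
    rw [this]
    exact mul_le_mul_of_nonneg_left (hx hxH) (abs_nonneg _)
  | @add f g _ hf hg =>
    obtain ⟨C, hC⟩ := hf
    obtain ⟨D, hD⟩ := hg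
    refine ⟨C + D, fun m hm ↦ ?_⟩
    have hfi : Integrable f π := f.integrable_of_isFiniteMeasure
    have hgi : Integrable g π := g.integrable_of_isFiniteMeasure
    filter_upwards [hC m hm, hD m hm, kernelOp_iterate_add hinv f.measurable g.measurable hfi hgi m]
      with x h1 h2 h3 hxH
    have : ⇑(f + g) = fun x ↦ f x + g x := rfl
    rw [this, h3, integral_add hfi hgi]
    calc _ = |((kernelOp K)^[m] f x - ∫ y, f y ∂π) + ((kernelOp K)^[m] g x - ∫ y, g y ∂π)| := by
            congr 1; ring
      _ ≤ _ := abs_add_le _ _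
      _ ≤ C * κ ^ m + D * κ ^ m := add_le_add (h1 hxH) (h2 hxH)
      _ = _ := by ring

lemma integral_kernelOp_iterate_mul [IsMarkovKernel K] [IsProbabilityMeasure π]
    (hinv : Kernel.Invariant K π) (hrev : Kernel.IsReversible K π) {u : S → ℝ}
    (hm : Measurable u) (hu : MemLp u 2 π) (i j : ℕ) :
    ∫ x, (kernelOp K)^[i] u x * (kernelOp K)^[j] u x ∂π
      = ∫ x, u x * (kernelOp K)^[i + j] u x ∂π := by
  induction i generalizing j with
  | zero => simp
  | succ i ih =>
    rw [show i + 1 + j = i + (j + 1) by ring, ← ih (j + 1)]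
    simp_rw [Function.iterate_succ_apply']
    rw [integral_mul_kernelOp_comm hinv hrev (measurable_kernelOp_iterate hm i)
      (measurable_kernelOp_iterate hm j)
      (memLp_kernelOp_iterate hinv (by norm_num) (by simp) hm hu i)
      (memLp_kernelOp_iterate hinv (by norm_num) (by simp) hm hu j)]

/-- By self-adjointness ‖T^m u‖² = ⟨u, T^{2m} u⟩ ≤ C κ^{2m}, and Cauchy–Schwarz applied to ‖T^{m+1}
u‖² = ⟨T^m u, T^{m+2} u⟩ gives log-convexity. The previous lemma on log-convex sequences then
compares the first two terms. -/
lemma lpNorm_two_kernelOp_le_of_geometric [IsMarkovKernel K] [IsProbabilityMeasure π]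
    (hinv : Kernel.Invariant K π) (hrev : Kernel.IsReversible K π) {κ C : ℝ} (hκ : 0 < κ)
    {u : S → ℝ} (hm : Measurable u) (hu : MemLp u 2 π)
    (h : ∀ m : ℕ, 1 ≤ m → ∫ x, u x * (kernelOp K)^[m] u x ∂π ≤ C * κ ^ m) :
    lpNorm (kernelOp K u) 2 π ≤ κ * lpNorm u 2 π := by
  have hL : ∀ m, MemLp ((kernelOp K)^[m] u) 2 π :=
    memLp_kernelOp_iterate hinv (by norm_num) (by simp) hm hu
  set a : ℕ → ℝ := fun m ↦ lpNorm ((kernelOp K)^[m] u) 2 π ^ 2 with ha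
  have haeq : ∀ m, a m = ∫ x, u x * (kernelOp K)^[2 * m] u x ∂π := fun m ↦ by
    rw [ha, two_mul, ← integral_kernelOp_iterate_mul hinv hrev hm hu]
    simp only [lpNorm_two_sq (hL m), sq]
  have key : a 1 ≤ κ ^ 2 * a 0 := by
    refine le_mul_of_logConvex_of_le_geometric (C := C) (by positivity) (fun m ↦ by positivity)
      (fun m ↦ ?_) fun m hm1 ↦ ?_
    · have h1 : a (m + 1) = ∫ x, (kernelOp K)^[m] u x * (kernelOp K)^[m + 2] u x ∂π := by
        rw [haeq, integral_kernelOp_iterate_mul hinv hrev hm hu,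
          show 2 * (m + 1) = m + (m + 2) by ring]
      have h2 := abs_integral_mul_le (hL m) (hL (m + 2))
      rw [← h1] at h2
      calc a (m + 1) ^ 2 = |a (m + 1)| ^ 2 := (sq_abs _).symm
        _ ≤ _ := pow_le_pow_left₀ (abs_nonneg _) h2 2
        _ = a m * a (m + 2) := by rw [ha, mul_pow]
    · rw [haeq, ← pow_mul]
      exact h (2 * m) (by lia)
  have : (lpNorm (kernelOp K u) 2 π) ^ 2 ≤ (κ * lpNorm u 2 π) ^ 2 := by
    rw [mul_pow]; exact key
  exact le_of_sq_le_sq this (mul_nonneg hκ.le lpNorm_nonneg)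

/-- A reversible geometrically ergodic kernel is a strict contraction on centered square integrable
functions. -/
theorem exists_spectral_gap [IsMarkovKernel K] [IsProbabilityMeasure π]
    (hinv : Kernel.Invariant K π) (hrev : Kernel.IsReversible K π)
    (hgeo : GeometricallyErgodic K π) :
    ∃ κ : ℝ, 0 < κ ∧ κ < 1 ∧ ∀ u : S → ℝ, Measurable u → MemLp u 2 π → ∫ x, u x ∂π = 0 →
      lpNorm (kernelOp K u) 2 π ≤ κ * lpNorm u 2 π := by
  obtain ⟨κ, hκ0, hκ1, H, hHm, hHlim, hH⟩ := exists_uniform_sets hgeo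
  refine ⟨κ, hκ0, hκ1, fun u hum hu hu0 ↦ ?_⟩
  -- Convergence is uniform only on H n, so the contraction is first proved for centered simple
  -- functions supported, before centering, in some H n.
  have hsimple : ∀ (φ : SimpleFunc S ℝ) (n : ℕ), (∀ x ∉ H n, φ x = 0) →
      lpNorm (kernelOp K fun x ↦ φ x - ∫ y, φ y ∂π) 2 π
        ≤ κ * lpNorm (fun x ↦ φ x - ∫ y, φ y ∂π) 2 π := by
    intro φ n hφ
    obtain ⟨C, hC⟩ := simpleFunc_abs_kernelOp_iterate_sub_le hinv (hH n) φ
    have hφi : Integrable φ π := φ.integrable_of_isFiniteMeasure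
    have hφ2 : MemLp φ 2 π := φ.memLp_of_isFiniteMeasure 2 π
    have hφm : Measurable fun x ↦ φ x - ∫ y, φ y ∂π := φ.measurable.sub_const _
    refine lpNorm_two_kernelOp_le_of_geometric (C := (∫ x, |φ x| ∂π) * C) hinv hrev hκ0 hφm
      (hφ2.sub (memLp_const _)) fun m hm ↦ ?_
    have hTi : Integrable (fun x ↦ (kernelOp K)^[m] φ x - ∫ y, φ y ∂π) π :=
      (integrable_kernelOp_iterate hinv φ.measurable hφi m).sub (integrable_const _)
    have hT2 : MemLp (fun x ↦ (kernelOp K)^[m] φ x - ∫ y, φ y ∂π) 2 π :=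
      (memLp_kernelOp_iterate hinv (by norm_num) (by simp) φ.measurable hφ2 m).sub (memLp_const _)
    -- Only one factor is uncentered: what remains contains φ itself, which vanishes where the
    -- uniform estimate is unavailable.
    have h1 : ∫ x, (φ x - ∫ y, φ y ∂π) * (kernelOp K)^[m] (fun x ↦ φ x - ∫ y, φ y ∂π) x ∂π
        = ∫ x, φ x * ((kernelOp K)^[m] φ x - ∫ y, φ y ∂π) ∂π
          - (∫ y, φ y ∂π) * ∫ x, ((kernelOp K)^[m] φ x - ∫ y, φ y ∂π) ∂π := by
      rw [← integral_const_mul,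
        ← integral_sub (integrable_mul_of_memLp_two hφ2 hT2) (hTi.const_mul _)]
      refine integral_congr_ae ?_
      filter_upwards [kernelOp_iterate_sub_const hinv φ.measurable hφi (∫ y, φ y ∂π) m] with x hx
      rw [hx]; ring
    have h2 : ∫ x, ((kernelOp K)^[m] φ x - ∫ y, φ y ∂π) ∂π = 0 := by
      rw [integral_sub (integrable_kernelOp_iterate hinv φ.measurable hφi m) (integrable_const _),
        integral_kernelOp_iterate hinv φ.measurable hφi]
      simp
    rw [h1, h2, mul_zero, sub_zero, mul_assoc, ← integral_mul_const]
    refine integral_mono_ae (integrable_mul_of_memLp_two hφ2 hT2) (hφi.abs.mul_const _) ?_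
    filter_upwards [hC m hm] with x hx
    by_cases hxH : x ∈ H n
    · refine (le_abs_self _).trans ?_
      rw [abs_mul]
      exact mul_le_mul_of_nonneg_left (hx hxH) (abs_nonneg _)
    · simp [hφ x hxH]
  -- Density: u is within ε/4 of a simple φ, and φ within ε/4 of its restriction to H n for n large.
  -- Centering does not increase the error ε/2, which enters once multiplied by κ < 1 and once
  -- directly.
  refine le_of_forall_pos_le_add fun ε hε ↦ ?_
  obtain ⟨φ, hφu, hφ2⟩ := hu.exists_simpleFunc_eLpNorm_sub_lt (by simp)
    (ε := ENNReal.ofReal (ε / 4)) (by simpa using hε)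
  have hφu' : lpNorm (u - ⇑φ) 2 π ≤ ε / 4 := by
    rw [← toReal_eLpNorm (hu.sub hφ2).1]
    exact ENNReal.toReal_le_of_le_ofReal (by positivity) hφu.le
  obtain ⟨M, hM⟩ := φ.exists_forall_norm_le
  have hlim : Tendsto (fun n ↦ M ^ 2 * π.real (H n)ᶜ) atTop (𝓝 0) := by
    simpa using hHlim.const_mul (M ^ 2)
  obtain ⟨n, hn⟩ := (hlim.eventually (gt_mem_nhds (show 0 < (ε / 4) ^ 2 by positivity))).exists
  have hψ2 : MemLp (φ.restrict (H n)) 2 π := (φ.restrict (H n)).memLp_of_isFiniteMeasure 2 π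
  have hψφ : lpNorm (⇑φ - ⇑(φ.restrict (H n))) 2 π ≤ ε / 4 := by
    refine le_of_sq_le_sq (le_trans ?_ hn.le) (by positivity)
    rw [lpNorm_two_sq (hφ2.sub hψ2)]
    calc ∫ x, (⇑φ - ⇑(φ.restrict (H n))) x ^ 2 ∂π
        ≤ ∫ x, (H n)ᶜ.indicator (fun _ ↦ M ^ 2) x ∂π := by
          refine integral_mono (hφ2.sub hψ2).integrable_sq
            ((integrable_const _).indicator (hHm n).compl) fun x ↦ ?_
          by_cases hx : x ∈ H n
          · simp [hHm n, hx]
          · simp only [Pi.sub_apply, SimpleFunc.restrict_apply φ (hHm n),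
              Set.indicator_of_notMem hx,
              sub_zero, Set.indicator_of_mem (Set.mem_compl hx)]
            rw [← sq_abs]
            exact pow_le_pow_left₀ (abs_nonneg _) (hM x) 2
      _ = M ^ 2 * π.real (H n)ᶜ := by
          rw [integral_indicator_const _ (hHm n).compl]
          simp [mul_comm]
  set ψ := φ.restrict (H n) with hψ
  have hψi : Integrable ψ π := ψ.integrable_of_isFiniteMeasure
  have hui : Integrable u π := hu.integrable (by norm_num)
  have hψ0m : Measurable fun x ↦ ψ x - ∫ y, ψ y ∂π := ψ.measurable.sub_const _
  have hψ02 : MemLp (fun x ↦ ψ x - ∫ y, ψ y ∂π) 2 π := hψ2.sub (memLp_const _)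
  have hd2 : MemLp (fun x ↦ u x - (ψ x - ∫ y, ψ y ∂π)) 2 π := hu.sub hψ02
  have hdm : Measurable fun x ↦ u x - (ψ x - ∫ y, ψ y ∂π) := hum.sub hψ0m
  have hd : lpNorm (fun x ↦ u x - (ψ x - ∫ y, ψ y ∂π)) 2 π ≤ ε / 2 := by
    have h1 := lpNorm_two_sub_integral_le (hu.sub hψ2)
    have h2 : (fun x ↦ (u - ⇑ψ) x - ∫ y, (u - ⇑ψ) y ∂π) = fun x ↦ u x - (ψ x - ∫ y, ψ y ∂π) := by
      simp only [Pi.sub_apply]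
      rw [integral_sub hui hψi, hu0]
      ext x; ring
    rw [h2] at h1
    have h3 : lpNorm (u - ⇑ψ) 2 π ≤ lpNorm (u - ⇑φ) 2 π + lpNorm (⇑φ - ⇑ψ) 2 π :=
      lpNorm_sub_le_lpNorm_sub_add_lpNorm_sub hu hφ2 (by norm_num)
    linarith
  have hTd := (lpNorm_kernelOp_le hinv (by norm_num) (by simp) hdm hd2).trans hd
  have hTψ := hsimple ψ n fun x hx ↦ by simp [hψ, SimpleFunc.restrict_apply, hHm n, hx]
  have hsplit : lpNorm (kernelOp K u) 2 π ≤ lpNorm (kernelOp K fun x ↦ ψ x - ∫ y, ψ y ∂π) 2 π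
      + lpNorm (kernelOp K fun x ↦ u x - (ψ x - ∫ y, ψ y ∂π)) 2 π := by
    have h1 := kernelOp_sub hinv hui (hψ02.integrable (by norm_num))
    have h2 := lpNorm_le_lpNorm_add_lpNorm_sub' (f := kernelOp K u)
      (memLp_kernelOp hinv (by norm_num) (by simp) hψ0m hψ02) (by norm_num)
    rwa [← lpNorm_congr_ae (g := kernelOp K u - kernelOp K fun x ↦ ψ x - ∫ y, ψ y ∂π) h1] at h2
  have hψu : lpNorm (fun x ↦ ψ x - ∫ y, ψ y ∂π) 2 π ≤ lpNorm u 2 π + ε / 2 := by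
    have h2 := lpNorm_le_lpNorm_add_lpNorm_sub (f := fun x ↦ ψ x - ∫ y, ψ y ∂π) hu (by norm_num)
    exact h2.trans (add_le_add le_rfl hd)
  nlinarith

end SpectralGap

/-! ### Geometric decay in higher Lᵖ and the Poisson equation. -/

section Poisson

variable {S : Type*} [MeasurableSpace S] {K : Kernel S S} {π : Measure S}

lemma kernelOp_sum_iterate [IsMarkovKernel K] (hinv : Kernel.Invariant K π) {h : S → ℝ}
    (hm : Measurable h)
    (hi : Integrable h π) (N : ℕ) :
    kernelOp K (fun x ↦ ∑ i ∈ Finset.range N, (kernelOp K)^[i] h x)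
      =ᵐ[π] fun x ↦ (∑ i ∈ Finset.range (N + 1), (kernelOp K)^[i] h x) - h x := by
  filter_upwards [ae_all_iff.2 fun i ↦
    ae_integrable_kernel hinv (integrable_kernelOp_iterate hinv hm hi i)] with x hx
  rw [Finset.sum_range_succ', Function.iterate_zero, id, add_sub_cancel_right]
  simp_rw [Function.iterate_succ_apply']
  exact integral_finsetSum _ fun i _ ↦ hx i

/-- Geometric decay, at rate `r`, of the iterates of `K` on centered functions of `L^p(π)`. -/
def GeometricDecay (K : Kernel S S) (π : Measure S) (p : ℝ≥0∞) (C r : ℝ) : Prop :=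
  ∀ u : S → ℝ, Measurable u → MemLp u p π → ∫ x, u x ∂π = 0 → ∀ m : ℕ,
    lpNorm ((kernelOp K)^[m] u) p π ≤ C * r ^ m * lpNorm u p π

variable [IsMarkovKernel K] [IsProbabilityMeasure π]

lemma geometricDecay_two_of_gap (hinv : Kernel.Invariant K π) {κ : ℝ} (hκ : 0 < κ)
    (h : ∀ u : S → ℝ, Measurable u → MemLp u 2 π → ∫ x, u x ∂π = 0 →
      lpNorm (kernelOp K u) 2 π ≤ κ * lpNorm u 2 π) : GeometricDecay K π 2 1 κ := by
  intro u hm hu hu0 m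
  induction m with
  | zero => simp
  | succ m ih =>
    rw [Function.iterate_succ_apply']
    have := h _ (measurable_kernelOp_iterate hm m)
      (memLp_kernelOp_iterate hinv (by norm_num) (by simp) hm hu m)
      (by rw [integral_kernelOp_iterate hinv hm (hu.integrable (by norm_num)), hu0])
    calc _ ≤ κ * lpNorm ((kernelOp K)^[m] u) 2 π := this
      _ ≤ κ * (1 * κ ^ m * lpNorm u 2 π) := by gcongr
      _ = _ := by ring

/-- With v = T^m u, Jensen bounds (T^m v)² by T^m(v²), and the L^p norm of a square is the squared
L^{2p} norm. Split v² into its mean e and a centered part: the centered part decays by the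
hypothesis in L^p, and e = ‖T^m u‖₂² decays by the hypothesis in L². -/
lemma lpNorm_sq_kernelOp_iterate_le (hinv : Kernel.Invariant K π) {κ C r : ℝ} {p : ℝ≥0∞}
    (hκ : 0 < κ) (hκ1 : κ < 1) (hC : 0 ≤ C) (hr : 0 < r) (hp : 2 ≤ p) (hp' : p ≠ ∞)
    (h2 : GeometricDecay K π 2 1 κ) (h : GeometricDecay K π p C r) {u : S → ℝ} (hm : Measurable u)
    (hu : MemLp u (2 * p) π) (hu0 : ∫ x, u x ∂π = 0) (m : ℕ) :
    lpNorm ((kernelOp K)^[2 * m] u) (2 * p) π ^ 2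
      ≤ (2 * C + 1) * max r κ ^ m * lpNorm u (2 * p) π ^ 2 := by
  have hp0 : p ≠ 0 := (zero_lt_two.trans_le hp).ne'
  have hp1 : 1 ≤ p := one_le_two.trans hp
  have h2p : 2 ≤ 2 * p := by simpa using mul_le_mul_right hp1 2
  have h2p1 : 1 ≤ 2 * p := one_le_two.trans h2p
  have h2p' : 2 * p ≠ ∞ := ENNReal.mul_ne_top (by simp) hp'
  have hu2 : MemLp u 2 π := hu.mono_exponent h2p
  set v := (kernelOp K)^[m] u with hv
  have hvm : Measurable v := measurable_kernelOp_iterate hm m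
  have hv2p : MemLp v (2 * p) π := memLp_kernelOp_iterate hinv h2p1 h2p' hm hu m
  have hv2 : MemLp v 2 π := hv2p.mono_exponent h2p
  have hvle : lpNorm v (2 * p) π ≤ lpNorm u (2 * p) π :=
    lpNorm_kernelOp_iterate_le hinv h2p1 h2p' hm hu m
  have hqm : Measurable fun x ↦ v x ^ 2 := hvm.pow_const 2
  have hqp : MemLp (fun x ↦ v x ^ 2) p π := by
    have : ENNReal.HolderTriple (2 * p) (2 * p) p := ⟨by
      rw [ENNReal.mul_inv (by simp) (by simp), ← add_mul, ENNReal.inv_two_add_inv_two, one_mul]⟩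
    simp_rw [sq]
    exact memLp_mul hv2p hv2p
  have hqi : Integrable (fun x ↦ v x ^ 2) π := hqp.integrable hp1
  set e := ∫ x, v x ^ 2 ∂π with he
  have hqnorm : lpNorm (fun x ↦ v x ^ 2) p π = lpNorm v (2 * p) π ^ 2 :=
    lpNorm_sq hp0 hp' hv2p.1
  have he0 : 0 ≤ e := integral_nonneg fun x ↦ sq_nonneg _
  have he1 : e ≤ κ ^ m * lpNorm u (2 * p) π ^ 2 := by
    rw [he, ← lpNorm_two_sq hv2]
    have h3 := h2 u hm hu2 hu0 m
    have h4 : lpNorm u 2 π ≤ lpNorm u (2 * p) π := lpNorm_mono_exponent h2p hu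
    have h5 : κ ^ m ≤ 1 := pow_le_one₀ hκ.le hκ1.le
    calc lpNorm v 2 π ^ 2 ≤ (κ ^ m * lpNorm u (2 * p) π) ^ 2 := by
          refine pow_le_pow_left₀ lpNorm_nonneg (h3.trans ?_) 2
          rw [one_mul]; gcongr
      _ = κ ^ m * (κ ^ m * lpNorm u (2 * p) π ^ 2) := by ring
      _ ≤ κ ^ m * (1 * lpNorm u (2 * p) π ^ 2) := by gcongr
      _ = _ := by ring
  have he2 : e ≤ lpNorm v (2 * p) π ^ 2 := by
    rw [he, ← lpNorm_two_sq hv2]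
    exact pow_le_pow_left₀ lpNorm_nonneg (lpNorm_mono_exponent h2p hv2p) 2
  have hcm : Measurable fun x ↦ v x ^ 2 - e := hqm.sub_const _
  have hcp : MemLp (fun x ↦ v x ^ 2 - e) p π := hqp.sub (memLp_const _)
  have hc0 : ∫ x, (v x ^ 2 - e) ∂π = 0 := by
    rw [integral_sub hqi (integrable_const _)]; simp [he]
  have hcle : lpNorm (fun x ↦ v x ^ 2 - e) p π ≤ 2 * lpNorm u (2 * p) π ^ 2 := by
    have h3 := lpNorm_sub_le (g := fun _ ↦ e) hqp hp1
    rw [lpNorm_const_eq hp0, hqnorm, abs_of_nonneg he0] at h3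
    have h4 : lpNorm v (2 * p) π ^ 2 ≤ lpNorm u (2 * p) π ^ 2 :=
      pow_le_pow_left₀ lpNorm_nonneg hvle 2
    exact h3.trans (by linarith)
  have hdec := h _ hcm hcp hc0 m
  have hTc := memLp_kernelOp_iterate hinv hp1 hp' hcm hcp m
  calc lpNorm ((kernelOp K)^[2 * m] u) (2 * p) π ^ 2
      = lpNorm (fun x ↦ (kernelOp K)^[m] v x ^ 2) p π := by
        rw [lpNorm_sq hp0 hp' (measurable_kernelOp_iterate hvm m).aestronglyMeasurable, hv,
          ← Function.iterate_add_apply, two_mul]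
    _ ≤ lpNorm ((kernelOp K)^[m] fun x ↦ v x ^ 2) p π := by
        refine lpNorm_mono_ae (memLp_kernelOp_iterate hinv hp1 hp' hqm hqp m)
          ((measurable_kernelOp_iterate hvm m).pow_const 2).aestronglyMeasurable ?_
        filter_upwards [sq_kernelOp_iterate_le hinv hvm hv2 m] with x hx
        rw [abs_of_nonneg (sq_nonneg _)]
        exact hx.trans (le_abs_self _)
    _ = lpNorm ((kernelOp K)^[m] (fun x ↦ v x ^ 2 - e) + fun _ ↦ e) p π := by
        refine lpNorm_congr_ae ?_
        filter_upwards [kernelOp_iterate_sub_const hinv hqm hqi e m] with x hx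
        simp [hx]
    _ ≤ lpNorm ((kernelOp K)^[m] (fun x ↦ v x ^ 2 - e)) p π + e := by
        refine (lpNorm_add_le hTc hp1).trans_eq ?_
        rw [lpNorm_const_eq hp0, abs_of_nonneg he0]
    _ ≤ C * r ^ m * (2 * lpNorm u (2 * p) π ^ 2) + κ ^ m * lpNorm u (2 * p) π ^ 2 := by
        refine add_le_add (hdec.trans ?_) he1
        gcongr
    _ ≤ C * max r κ ^ m * (2 * lpNorm u (2 * p) π ^ 2) + max r κ ^ m * lpNorm u (2 * p) π ^ 2 := by
        have h3 : r ≤ max r κ := le_max_left _ _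
        have h4 : κ ≤ max r κ := le_max_right _ _
        gcongr
    _ = _ := by ring

/-- Geometric decay in `L²` and `L^p` implies geometric decay in `L^{2 * p}`. -/
lemma exists_geometricDecay_double (hinv : Kernel.Invariant K π) {κ C r : ℝ} {p : ℝ≥0∞}
    (hκ : 0 < κ) (hκ1 : κ < 1) (hC : 0 ≤ C) (hr : 0 < r) (hr1 : r < 1) (hp : 2 ≤ p) (hp' : p ≠ ∞)
    (h2 : GeometricDecay K π 2 1 κ) (h : GeometricDecay K π p C r) :
    ∃ C' r', 0 ≤ C' ∧ 0 < r' ∧ r' < 1 ∧ GeometricDecay K π (2 * p) C' r' := by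
  have h2p1 : 1 ≤ 2 * p :=
    one_le_two.trans (by simpa using mul_le_mul_right (one_le_two.trans hp) 2)
  have h2p' : 2 * p ≠ ∞ := ENNReal.mul_ne_top (by simp) hp'
  obtain ⟨s, hs⟩ : ∃ s, s = max r κ := ⟨_, rfl⟩
  have hs0 : 0 < s := by rw [hs]; exact lt_max_of_lt_left hr
  have hs1 : s < 1 := by rw [hs]; exact max_lt hr1 hκ1
  -- The squared norm after 2m steps is of order s^m, so the norm decays like s^{1/4} per step.
  obtain ⟨t, ht⟩ : ∃ t, t = √(√s) := ⟨_, rfl⟩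
  have ht0 : 0 < t := by rw [ht]; positivity
  have ht1 : t < 1 := by
    rw [ht, Real.sqrt_lt' one_pos, one_pow, Real.sqrt_lt' one_pos]; simpa
  have ht4 : t ^ 4 = s := by
    rw [show t ^ 4 = (t ^ 2) ^ 2 by ring, ht, Real.sq_sqrt (by positivity), Real.sq_sqrt hs0.le]
  have heven : ∀ u : S → ℝ, Measurable u → MemLp u (2 * p) π → ∫ x, u x ∂π = 0 → ∀ m : ℕ,
      lpNorm ((kernelOp K)^[2 * m] u) (2 * p) π
        ≤ √(2 * C + 1) * t ^ (2 * m) * lpNorm u (2 * p) π := by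
    intro u hm hu hu0 m
    have h3 := lpNorm_sq_kernelOp_iterate_le hinv hκ hκ1 hC hr hp hp' h2 h hm hu hu0 m
    refine le_of_sq_le_sq (h3.trans_eq ?_) (by have := lpNorm_nonneg (f := u) (p := 2 * p) (μ := π);
                                               positivity)
    rw [mul_pow, mul_pow, Real.sq_sqrt (by positivity), ← hs, ← ht4, ← pow_mul, ← pow_mul]
    ring_nf
  refine ⟨√(2 * C + 1) / t, t, by positivity, ht0, ht1, fun u hm hu hu0 n ↦ ?_⟩
  have hn0 : 0 ≤ lpNorm u (2 * p) π := lpNorm_nonneg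
  rcases Nat.even_or_odd' n with ⟨m, rfl | rfl⟩
  · refine (heven u hm hu hu0 m).trans ?_
    have : √(2 * C + 1) ≤ √(2 * C + 1) / t := le_div_self (by positivity) ht0 ht1.le
    gcongr
  -- The last step of an odd number uses only contractivity; dividing the constant by t pays for the
  -- missing factor.
  · rw [Function.iterate_succ_apply']
    refine (lpNorm_kernelOp_le hinv h2p1 h2p' (measurable_kernelOp_iterate hm _)
      (memLp_kernelOp_iterate hinv h2p1 h2p' hm hu _)).trans ((heven u hm hu hu0 m).trans_eq ?_)
    rw [pow_succ]
    field_simp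

/-- Solvability of the Poisson equation in `L^p`. -/
lemma exists_poisson_solution (hinv : Kernel.Invariant K π) {p : ℝ≥0∞} {C r : ℝ} (hr : 0 < r)
    (hr1 : r < 1) (hp : 1 ≤ p) (hp' : p ≠ ∞) (hdec : GeometricDecay K π p C r) {h : S → ℝ}
    (hm : Measurable h) (hh : MemLp h p π) (hh0 : ∫ x, h x ∂π = 0) :
    ∃ g : S → ℝ, Measurable g ∧ MemLp g p π ∧ ∫ x, g x ∂π = 0 ∧
      ∀ᵐ x ∂π, g x - kernelOp K g x = h x := by
  have : Fact (1 ≤ p) := ⟨hp⟩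
  have hp0 : p ≠ 0 := (zero_lt_one.trans_le hp).ne'
  have hL : ∀ i, MemLp ((kernelOp K)^[i] h) p π := memLp_kernelOp_iterate hinv hp hp' hm hh
  have hM : ∀ i, Measurable ((kernelOp K)^[i] h) := measurable_kernelOp_iterate hm
  have hhi : Integrable h π := hh.integrable hp
  have hsum : Summable fun i ↦ (hL i).toLp ((kernelOp K)^[i] h) := by
    refine Summable.of_norm_bounded (g := fun i ↦ C * lpNorm h p π * r ^ i)
      ((summable_geometric_of_lt_one hr.le hr1).mul_left _) fun i ↦ ?_
    rw [Lp.norm_toLp, toReal_eLpNorm (hL i).1]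
    exact (hdec h hm hh hh0 i).trans_eq (by ring)
  set G := ∑' i, (hL i).toLp ((kernelOp K)^[i] h) with hG
  set s : ℕ → S → ℝ := fun N x ↦ ∑ i ∈ Finset.range N, (kernelOp K)^[i] h x with hs
  have hsL : ∀ N, MemLp (s N) p π := fun N ↦ memLp_finsetSum _ fun i _ ↦ hL i
  have hsM : ∀ N, Measurable (s N) := fun N ↦ Finset.measurable_fun_sum _ fun i _ ↦ hM i
  have hgM : Measurable (G : S → ℝ) := (Lp.stronglyMeasurable G).measurable
  have hgL : MemLp (G : S → ℝ) p π := Lp.memLp G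
  have hlim : Tendsto (fun N ↦ lpNorm (fun x ↦ G x - s N x) p π) atTop (𝓝 0) := by
    have h1 := (hsum.hasSum.tendsto_sum_nat).const_sub G
    rw [sub_self] at h1
    have h2 := h1.norm
    rw [norm_zero] at h2
    refine h2.congr fun N ↦ ?_
    have h3 : ∑ i ∈ Finset.range N, (hL i).toLp ((kernelOp K)^[i] h) = (hsL N).toLp (s N) := by
      clear h1 h2
      induction N with
      | zero =>
        rw [Finset.sum_range_zero]
        symm
        rw [Lp.ext_iff]
        filter_upwards [(hsL 0).coeFn_toLp, Lp.coeFn_zero ℝ p π] with x h4 h5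
        rw [h4, h5]; simp [hs]
      | succ N ih =>
        rw [Finset.sum_range_succ, ih, ← MemLp.toLp_add]
        exact MemLp.toLp_congr _ _ (ae_of_all _ fun x ↦ by simp [hs, Finset.sum_range_succ])
    rw [h3, Lp.norm_def, toReal_eLpNorm (Lp.aestronglyMeasurable _)]
    refine lpNorm_congr_ae ?_
    filter_upwards [Lp.coeFn_sub G ((hsL N).toLp (s N)), (hsL N).coeFn_toLp] with x h4 h5
    rw [h4, Pi.sub_apply, h5]
  have hpois : ∀ᵐ x ∂π, G x - kernelOp K G x - h x = 0 := by
    have hmem : MemLp (fun x ↦ G x - kernelOp K G x - h x) p π :=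
      (hgL.sub (memLp_kernelOp hinv hp hp' hgM hgL)).sub hh
    refine (lpNorm_eq_zero hmem hp0).1 (le_antisymm ?_ lpNorm_nonneg)
    have hlim2 := (hlim.comp (tendsto_add_atTop_nat 1)).add hlim
    rw [add_zero] at hlim2
    refine ge_of_tendsto' hlim2 fun N ↦ ?_
    have hd : MemLp (fun x ↦ G x - s N x) p π := hgL.sub (hsL N)
    have hd1 : MemLp (fun x ↦ G x - s (N + 1) x) p π := hgL.sub (hsL (N + 1))
    have hdM : Measurable fun x ↦ G x - s N x := hgM.sub (hsM N)
    -- The partial sums of the Neumann series satisfy T s_N = s_{N+1} - h, so the defect of G is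
    -- expressed by two tails of the series.
    have heq : (fun x ↦ G x - kernelOp K G x - h x) =ᵐ[π]
        (fun x ↦ G x - s (N + 1) x) - kernelOp K (fun x ↦ G x - s N x) := by
      filter_upwards [kernelOp_sub hinv (hgL.integrable hp) ((hsL N).integrable hp),
        kernelOp_sum_iterate hinv hm hhi N] with x h1 h2
      rw [Pi.sub_apply, h1, h2]
      ring
    rw [lpNorm_congr_ae heq]
    refine (lpNorm_sub_le hd1 hp).trans ?_
    exact add_le_add le_rfl (lpNorm_kernelOp_le hinv hp hp' hdM hd)
  -- Subtracting a constant preserves the equation and makes the solution centered.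
  refine ⟨fun x ↦ G x - ∫ y, G y ∂π, hgM.sub_const _, hgL.sub (memLp_const _), ?_, ?_⟩
  · rw [integral_sub (hgL.integrable hp) (integrable_const _)]; simp
  · filter_upwards [hpois, kernelOp_iterate_sub_const hinv hgM (hgL.integrable hp)
      (∫ y, G y ∂π) 1] with x h1 h2
    simp only [Function.iterate_one] at h2
    rw [h2]; linarith

/-- Reversible geometrically ergodic kernels: geometric decay in `L²` and solvability of the
Poisson equation in `L⁸`. -/
theorem exists_decay_and_poisson (hinv : Kernel.Invariant K π) (hrev : Kernel.IsReversible K π)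
    (hgeo : GeometricallyErgodic K π) :
    ∃ κ : ℝ, 0 < κ ∧ κ < 1 ∧ GeometricDecay K π 2 1 κ ∧
      ∀ h : S → ℝ, Measurable h → MemLp h 8 π → ∫ x, h x ∂π = 0 →
        ∃ g : S → ℝ, Measurable g ∧ MemLp g 8 π ∧ ∫ x, g x ∂π = 0 ∧
          ∀ᵐ x ∂π, g x - kernelOp K g x = h x := by
  obtain ⟨κ, hκ0, hκ1, hgap⟩ := exists_spectral_gap hinv hrev hgeo
  have h2 := geometricDecay_two_of_gap hinv hκ0 hgap
  obtain ⟨C, r, hC, hr0, hr1, h4⟩ := exists_geometricDecay_double hinv hκ0 hκ1 zero_le_one hκ0 hκ1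
    le_rfl (by simp) h2 h2
  obtain ⟨D, q, -, hq0, hq1, h8⟩ := exists_geometricDecay_double hinv hκ0 hκ1 hC hr0 hr1
    (by norm_num) (by norm_num) h2 h4
  refine ⟨κ, hκ0, hκ1, h2, fun h hm hh hh0 ↦ ?_⟩
  have h8e : (2 : ℝ≥0∞) * (2 * 2) = 8 := by norm_num
  rw [h8e] at h8
  exact exists_poisson_solution hinv hq0 hq1 (by norm_num) (by simp) h8 hm hh hh0

end Poisson

/-! ### Consequences of the Markov property and stationarity. -/

section Markov

variable {S Ω : Type*} [MeasurableSpace S]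

/-- The σ-algebra generated by `X 0, …, X n`. -/
abbrev past (X : ℕ → Ω → S) (n : ℕ) : MeasurableSpace Ω :=
  MeasurableSpace.comap (fun ω (i : Finset.Iic n) ↦ X i ω) inferInstance

lemma measurable_past {X : ℕ → Ω → S} {i n : ℕ} (h : i ≤ n) : Measurable[past X n] (X i) := by
  have h1 : Measurable[past X n] (fun ω (i : Finset.Iic n) ↦ X i ω) := comap_measurable _
  exact (measurable_pi_apply (⟨i, Finset.mem_Iic.2 h⟩ : Finset.Iic n)).comp h1

lemma past_mono {X : ℕ → Ω → S} {m n : ℕ} (h : m ≤ n) : past X m ≤ past X n := by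
  have h1 : Measurable[past X n] (fun ω (i : Finset.Iic m) ↦ X i ω) :=
    @measurable_pi_lambda _ _ _ (past X n) _ _ fun i ↦
      measurable_past ((Finset.mem_Iic.1 i.2).trans h)
  exact h1.comap_le

variable [mΩ : MeasurableSpace Ω] {K : Kernel S S} {π : Measure S} {P : Measure Ω} {X : ℕ → Ω → S}

lemma past_le (hX : IsMarkovChain K π P X) (n : ℕ) : past X n ≤ mΩ :=
  Measurable.comap_le (measurable_pi_lambda _ fun i ↦ hX.measurable i)

variable [IsMarkovKernel K] [IsProbabilityMeasure P]

/-- The Markov property, tested against functions of the past. -/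
lemma integral_mul_comp_succ (hX : IsMarkovChain K π P X) {n : ℕ} {A : Ω → ℝ}
    (hA : Measurable[past X n] A) {u : S → ℝ} (hu : Measurable u)
    (hi : Integrable (fun ω ↦ A ω * u (X (n + 1) ω)) P) :
    ∫ ω, A ω * u (X (n + 1) ω) ∂P = ∫ ω, A ω * kernelOp K u (X n ω) ∂P := by
  -- Doob–Dynkin: a function measurable with respect to the past is a function of the path.
  obtain ⟨φ, hφ, rfl⟩ := Measurable.exists_eq_measurable_comp hA
  have hlaw := hX.markov n
  have hpath : Measurable (fun ω (i : Finset.Iic n) ↦ X i ω) :=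
    measurable_pi_lambda _ fun i ↦ hX.measurable i
  have hF : Measurable fun z : (Finset.Iic n → S) × S ↦ φ z.1 * u z.2 := by fun_prop
  have h1 := hlaw.integral_comp (f := fun z : (Finset.Iic n → S) × S ↦ φ z.1 * u z.2)
    hF.aestronglyMeasurable
  have hi2 : Integrable (fun z : (Finset.Iic n → S) × S ↦ φ z.1 * u z.2)
      (P.map (fun ω (i : Finset.Iic n) ↦ X i ω) ⊗ₘ (K.comap
        (fun h : Finset.Iic n → S ↦ h ⟨n, Finset.mem_Iic.2 le_rfl⟩) (measurable_pi_apply _))) := by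
    rw [← hlaw.map_eq, integrable_map_measure hF.aestronglyMeasurable hlaw.aemeasurable]
    exact hi
  rw [Measure.integral_compProd hi2] at h1
  simp_rw [integral_const_mul] at h1
  rw [integral_map hpath.aemeasurable ?_] at h1
  · exact h1
  · refine Measurable.aestronglyMeasurable (hφ.mul ?_)
    simp only [Kernel.comap_apply]
    exact (measurable_kernelOp (K := K) hu).comp (measurable_pi_apply _)

lemma hasLaw_of_invariant (hX : IsMarkovChain K π P X) (hinv : Kernel.Invariant K π) (n : ℕ) :
    HasLaw (X n) π P := by
  induction n with
  | zero => exact hX.initial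
  | succ n ih =>
    have h1 : HasCondDistrib (X (n + 1)) (X n) K P := (hX.markov n).comp_right
    have h2 : (P.map fun ω ↦ (X n ω, X (n + 1) ω)).snd = P.map (X (n + 1)) :=
      Measure.snd_map_prodMk (hX.measurable n)
    refine ⟨(hX.measurable _).aemeasurable, ?_⟩
    rw [← h2, h1.map_eq, Measure.snd_compProd, ih.map_eq]
    exact hinv.def

lemma measurePreserving_of_invariant (hX : IsMarkovChain K π P X) (hinv : Kernel.Invariant K π)
    (n : ℕ) : MeasurePreserving (X n) P π :=
  ⟨hX.measurable n, (hasLaw_of_invariant hX hinv n).map_eq⟩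

lemma memLp_comp (hX : IsMarkovChain K π P X) (hinv : Kernel.Invariant K π) {u : S → ℝ}
    {p : ℝ≥0∞} (hu : MemLp u p π) (n : ℕ) : MemLp (fun ω ↦ u (X n ω)) p P :=
  hu.comp_measurePreserving (measurePreserving_of_invariant hX hinv n)

lemma lpNorm_comp (hX : IsMarkovChain K π P X) (hinv : Kernel.Invariant K π) {u : S → ℝ}
    {p : ℝ≥0∞} (hu : MemLp u p π) (n : ℕ) : lpNorm (fun ω ↦ u (X n ω)) p P = lpNorm u p π := by
  rw [← toReal_eLpNorm (memLp_comp hX hinv hu n).1, ← toReal_eLpNorm hu.1,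
    ← eLpNorm_comp_measurePreserving hu.1 (measurePreserving_of_invariant hX hinv n)]
  rfl

lemma integral_mul_iterate_comp_succ (hX : IsMarkovChain K π P X) (hinv : Kernel.Invariant K π)
    {n : ℕ} {A : Ω → ℝ} (hA : Measurable[past X n] A) (hA2 : MemLp A 2 P) {u : S → ℝ}
    (hu : Measurable u) (hu2 : MemLp u 2 π) (m : ℕ) :
    ∫ ω, A ω * (kernelOp K)^[m] u (X (n + 1) ω) ∂P
      = ∫ ω, A ω * (kernelOp K)^[m + 1] u (X n ω) ∂P := by
  rw [integral_mul_comp_succ hX hA (measurable_kernelOp_iterate hu m)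
    (integrable_mul_of_memLp_two hA2 (memLp_comp hX hinv
      (memLp_kernelOp_iterate hinv (by norm_num) (by simp) hu hu2 m) _))]
  simp_rw [Function.iterate_succ_apply']

lemma integral_mul_comp_add (hX : IsMarkovChain K π P X) (hinv : Kernel.Invariant K π)
    {n : ℕ} {A : Ω → ℝ} (hA : Measurable[past X n] A) (hA2 : MemLp A 2 P) {u : S → ℝ}
    (hu : Measurable u) (hu2 : MemLp u 2 π) (i : ℕ) :
    ∫ ω, A ω * u (X (n + i) ω) ∂P = ∫ ω, A ω * (kernelOp K)^[i] u (X n ω) ∂P := by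
  have key : ∀ m, ∫ ω, A ω * (kernelOp K)^[m] u (X (n + i) ω) ∂P
      = ∫ ω, A ω * (kernelOp K)^[m + i] u (X n ω) ∂P := by
    induction i with
    | zero => intro m; rfl
    | succ i ih =>
      intro m
      have h1 := integral_mul_iterate_comp_succ hX hinv
        (hA.mono (past_mono (Nat.le_add_right n i)) le_rfl) hA2 hu hu2 m
      rw [← add_assoc, h1, ih (m + 1), add_right_comm, add_assoc]
  simpa using key 0

end Markov

/-! ### Elementary inequalities and recursions. -/

section Elementary

/-- One step of the eighth moment recursion. The linear term will integrate to zero for a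
martingale, and the weights 1/j and j³ are balanced so that the recursion produces growth j⁴. -/
lemma pow_eight_add_le : ∃ c : ℝ, 0 ≤ c ∧ ∀ x d j : ℝ, 1 ≤ j →
    (x + d) ^ 8 ≤ x ^ 8 + 8 * (x ^ 7 * d) + x ^ 8 / j + c * j ^ 3 * d ^ 8 := by
  refine ⟨56 * 250 ^ 3 + 126 * 250 ^ 2 + 60 * 250 + 5, by norm_num, fun x d j hj ↦ ?_⟩
  have hj0 : 0 < j := by linarith
  obtain ⟨p, hp⟩ : ∃ p, p = x ^ 2 := ⟨_, rfl⟩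
  obtain ⟨q, hq⟩ : ∃ q, q = d ^ 2 := ⟨_, rfl⟩
  have hp0 : 0 ≤ p := by rw [hp]; positivity
  have hq0 : 0 ≤ q := by rw [hq]; positivity
  -- The odd-order terms are absorbed in their even neighbours by 2|xd| ≤ x² + d². The resulting
  -- coefficients sum to 247, hence the threshold 250 below.
  have h1 : (x + d) ^ 8 ≤ x ^ 8 + 8 * (x ^ 7 * d)
      + (56 * (p ^ 3 * q) + 126 * (p ^ 2 * q ^ 2) + 60 * (p * q ^ 3) + 5 * q ^ 4) := by
    rw [hp, hq]
    nlinarith [sq_nonneg (x ^ 2 * d * (x - d)), sq_nonneg (x * d ^ 2 * (x - d)),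
      sq_nonneg (d ^ 3 * (x - d))]
  have h2 : 56 * (p ^ 3 * q) + 126 * (p ^ 2 * q ^ 2) + 60 * (p * q ^ 3) + 5 * q ^ 4
      ≤ p ^ 4 / j + (56 * 250 ^ 3 + 126 * 250 ^ 2 + 60 * 250 + 5) * j ^ 3 * q ^ 4 := by
    -- If d² dominates, every term is at most a multiple of j³ d⁸; otherwise every term is at most
    -- x⁶d² ≤ x⁸/(250 j).
    rcases le_total p (250 * j * q) with h | h
    · have e0 : 0 ≤ p ^ 4 / j := by positivity
      have e1 : p ^ 3 * q ≤ (250 * j * q) ^ 3 * q := by gcongr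
      have e2 : p ^ 2 * q ^ 2 ≤ (250 * j * q) ^ 2 * q ^ 2 := by gcongr
      have e3 : p * q ^ 3 ≤ (250 * j * q) * q ^ 3 := by gcongr
      have j2 : j ^ 2 ≤ j ^ 3 := pow_le_pow_right₀ hj (by norm_num)
      have j1 : j ≤ j ^ 3 := le_self_pow₀ hj (by norm_num)
      have j0 : 1 ≤ j ^ 3 := one_le_pow₀ hj
      have q4 : 0 ≤ q ^ 4 := by positivity
      have e2' : j ^ 2 * q ^ 4 ≤ j ^ 3 * q ^ 4 := by gcongr
      have e1' : j * q ^ 4 ≤ j ^ 3 * q ^ 4 := by gcongr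
      have e0' : 1 * q ^ 4 ≤ j ^ 3 * q ^ 4 := by gcongr
      nlinarith
    · have hqp : q ≤ p / (250 * j) := by rw [le_div_iff₀ (by positivity)]; linarith
      have hpj : p / (250 * j) ≤ p := div_le_self hp0 (by linarith)
      have hqp' : q ≤ p := hqp.trans hpj
      have e0 : 0 ≤ (56 * 250 ^ 3 + 126 * 250 ^ 2 + 60 * 250 + 5) * j ^ 3 * q ^ 4 := by positivity
      have e1 : p ^ 3 * q ≤ p ^ 3 * (p / (250 * j)) := by gcongr
      have e2 : p ^ 2 * q ^ 2 ≤ p ^ 3 * q := by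
        calc p ^ 2 * q ^ 2 = p ^ 2 * q * q := by ring
          _ ≤ p ^ 2 * q * p := by gcongr
          _ = _ := by ring
      have e3 : p * q ^ 3 ≤ p ^ 3 * q := by
        calc p * q ^ 3 = p * q * q ^ 2 := by ring
          _ ≤ p * q * p ^ 2 := by gcongr
          _ = _ := by ring
      have e4 : q ^ 4 ≤ p ^ 3 * q := by
        calc q ^ 4 = q ^ 3 * q := by ring
          _ ≤ p ^ 3 * q := by gcongr
      have e5 : p ^ 3 * (p / (250 * j)) = p ^ 4 / j / 250 := by field_simp
      have e6 : 0 ≤ p ^ 4 / j := by positivity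
      rw [e5] at e1
      linarith
  have h3 : p ^ 4 = x ^ 8 := by rw [hp]; ring
  have h4 : q ^ 4 = d ^ 8 := by rw [hq]; ring
  rw [h3, h4] at h2
  linarith

/-- Growth of a sequence satisfying the recursion of eighth moments of martingales. -/
lemma le_pow_four_of_recursion {E : ℕ → ℝ} {c e : ℝ} (hc : 0 ≤ c) (he : 0 ≤ e) (h0 : E 0 = 0)
    (h1 : E 1 ≤ e)
    (hstep : ∀ j : ℕ, 1 ≤ j → E (j + 1) ≤ E j + E j / j + c * (j : ℝ) ^ 3 * e) (j : ℕ) :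
    E j ≤ (c + 1) * e * (j : ℝ) ^ 4 := by
  induction j with
  | zero => simp [h0]
  | succ j ih =>
    rcases Nat.eq_zero_or_pos j with rfl | hj
    · simp only [zero_add, Nat.cast_one, one_pow, mul_one]
      nlinarith
    · have hj' : (1 : ℝ) ≤ j := by exact_mod_cast hj
      have h2 : E j / j ≤ (c + 1) * e * (j : ℝ) ^ 3 := by
        rw [div_le_iff₀ (by linarith)]
        exact ih.trans_eq (by ring)
      have h3 := hstep j hj
      push_cast
      have h4 : 0 ≤ (c + 1) * e := by positivity
      have h5 : c * (j : ℝ) ^ 3 * e ≤ (c + 1) * e * (j : ℝ) ^ 3 := by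
        have : 0 ≤ e * (j : ℝ) ^ 3 := by positivity
        nlinarith
      -- The two extra terms of the recursion each cost at most one multiple of j³, and the
      -- increment of j⁴ is larger.
      have h6 : (j : ℝ) ^ 4 + 2 * (j : ℝ) ^ 3 ≤ ((j : ℝ) + 1) ^ 4 := by
        have : (0 : ℝ) ≤ j := by linarith
        nlinarith [pow_nonneg this 3, pow_nonneg this 2]
      have h7 := mul_le_mul_of_nonneg_left h6 h4
      linarith

/-- A bound for a two-parameter array whose rows are tied by a shift up to geometric errors. -/
lemma abs_le_geometric_of_shift {F : ℕ → ℕ → ℝ} {c κ : ℝ} {n : ℕ} (hκ : 0 < κ) (hκ1 : κ < 1)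
    (hc : 0 ≤ c) (h0 : ∀ m, F 0 m = 0)
    (h : ∀ j < n, ∀ m, |F (j + 1) m| ≤ |F j (m + 1)| + c * κ ^ m) :
    ∀ j ≤ n, ∀ m, |F j m| ≤ c * κ ^ m / (1 - κ) := by
  have hκ' : 0 < 1 - κ := by linarith
  intro j
  induction j with
  | zero => intro _ m; rw [h0, abs_zero]; positivity
  | succ j ih =>
    intro hj m
    calc |F (j + 1) m| ≤ |F j (m + 1)| + c * κ ^ m := h j (by lia) m
      _ ≤ c * κ ^ (m + 1) / (1 - κ) + c * κ ^ m := by gcongr; exact ih (by lia) _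
      _ = c * κ ^ m / (1 - κ) := by field_simp; ring

lemma sum_range_pow_le {κ : ℝ} (hκ : 0 < κ) (hκ1 : κ < 1) (n : ℕ) :
    ∑ i ∈ Finset.range n, κ ^ i ≤ 1 / (1 - κ) := by
  rw [one_div, ← tsum_geometric_of_lt_one hκ.le hκ1]
  exact (summable_geometric_of_lt_one hκ.le hκ1).sum_le_tsum _ fun i _ ↦ by positivity

end Elementary

/-! ### Eighth moments and the integrability they give. -/

section Moments

variable {α : Type*} {mα : MeasurableSpace α} {μ : Measure α} {f g : α → ℝ}

lemma lpNorm_eight_pow (hf : MemLp f 8 μ) : lpNorm f 8 μ ^ 8 = ∫ x, f x ^ 8 ∂μ := by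
  have h4 : MemLp (fun x ↦ f x ^ 2) 4 μ := by simp_rw [sq]; exact memLp_mul hf hf
  have h2 : MemLp (fun x ↦ (f x ^ 2) ^ 2) 2 μ := by
    have : MemLp (fun x ↦ f x ^ 2 * f x ^ 2) 2 μ := memLp_mul h4 h4
    simpa only [sq] using this
  have e1 := lpNorm_sq (p := 4) (by simp) (by simp) hf.1
  have e2 := lpNorm_sq (p := 2) (by simp) (by simp) h4.1
  rw [show (2 : ℝ≥0∞) * 4 = 8 by norm_num] at e1
  rw [show (2 : ℝ≥0∞) * 2 = 4 by norm_num] at e2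
  have e3 := lpNorm_two_sq h2
  calc lpNorm f 8 μ ^ 8 = ((lpNorm f 8 μ ^ 2) ^ 2) ^ 2 := by ring
    _ = ∫ x, ((f x ^ 2) ^ 2) ^ 2 ∂μ := by rw [← e1, ← e2, e3]
    _ = _ := by congr 1; ext x; ring

lemma integrable_pow_eight (hf : MemLp f 8 μ) : Integrable (fun x ↦ f x ^ 8) μ := by
  have := hf.integrable_norm_pow (p := 8) (by norm_num)
  refine this.congr (ae_of_all _ fun x ↦ ?_)
  simp only [Real.norm_eq_abs]
  exact (by decide : Even 8).pow_abs _

lemma integrable_pow_seven_mul (hf : MemLp f 8 μ) (hg : MemLp g 8 μ) :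
    Integrable (fun x ↦ f x ^ 7 * g x) μ := by
  refine ((integrable_pow_eight hf).add (integrable_pow_eight hg)).mono
    ((hf.1.pow 7).mul hg.1) (ae_of_all _ fun x ↦ ?_)
  simp only [Pi.add_apply, norm_mul, norm_pow, Real.norm_eq_abs]
  have h1 : |f x ^ 8 + g x ^ 8| = |f x| ^ 8 + |g x| ^ 8 := by
    rw [abs_of_nonneg (by positivity), (by decide : Even 8).pow_abs, (by decide : Even 8).pow_abs]
  rw [h1]
  rcases le_total |f x| |g x| with h | h
  · calc |f x| ^ 7 * |g x| ≤ |g x| ^ 7 * |g x| := by gcongr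
      _ = |g x| ^ 8 := by ring
      _ ≤ _ := by linarith [pow_nonneg (abs_nonneg (f x)) 8]
  · calc |f x| ^ 7 * |g x| ≤ |f x| ^ 7 * |f x| := by gcongr
      _ = |f x| ^ 8 := by ring
      _ ≤ _ := by linarith [pow_nonneg (abs_nonneg (g x)) 8]

end Moments

/-! ### The martingale attached to the Poisson solution, and its eighth moments. -/

section Martingale

set_option linter.unusedSectionVars false

variable {S Ω : Type*} [MeasurableSpace S]

/-- The martingale differences attached to a function `g` of the chain. -/
def mdiff (K : Kernel S S) (g : S → ℝ) (X : ℕ → Ω → S) (i : ℕ) (ω : Ω) : ℝ :=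
  g (X (i + 1) ω) - kernelOp K g (X i ω)

/-- The sum of `j` consecutive martingale differences, from time `s` on. -/
def msum (K : Kernel S S) (g : S → ℝ) (X : ℕ → Ω → S) (s j : ℕ) (ω : Ω) : ℝ :=
  ∑ i ∈ Finset.range j, mdiff K g X (s + i) ω

/-- The conditional variance of `g` after one transition. -/
def condVar (K : Kernel S S) (g : S → ℝ) (x : S) : ℝ :=
  kernelOp K (fun y ↦ g y ^ 2) x - kernelOp K g x ^ 2

/-- The stationary mean of the conditional variance of `g`. -/
def martVar (K : Kernel S S) (π : Measure S) (g : S → ℝ) : ℝ := ∫ x, condVar K g x ∂π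

variable [mΩ : MeasurableSpace Ω] (K : Kernel S S) (π : Measure S) (P : Measure Ω)
  (X : ℕ → Ω → S) (κ : ℝ) (g : S → ℝ)

/-- A stationary Markov chain with a spectral gap, and a centered function `g` in `L⁸`. -/
structure GapChain : Prop where
  chain : IsMarkovChain K π P X
  inv : Kernel.Invariant K π
  pos : 0 < κ
  lt_one : κ < 1
  decay : GeometricDecay K π 2 1 κ
  meas : Measurable g
  memLp : MemLp g 8 π
  mean_zero : ∫ x, g x ∂π = 0

variable {K π P X κ g}

lemma msum_zero (s : ℕ) (ω : Ω) : msum K g X s 0 ω = 0 := by simp [msum]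

lemma msum_succ (s j : ℕ) (ω : Ω) :
    msum K g X s (j + 1) ω = msum K g X s j ω + mdiff K g X (s + j) ω := by
  simp [msum, Finset.sum_range_succ]

variable [IsMarkovKernel K] [IsProbabilityMeasure π] [IsProbabilityMeasure P]

lemma measurable_mdiff (hg : Measurable g) (i : ℕ) :
    Measurable[past X (i + 1)] (mdiff K g X i) := by
  have h1 : Measurable[past X (i + 1)] fun ω ↦ g (X (i + 1) ω) := hg.comp (measurable_past le_rfl)
  have h2 : Measurable[past X (i + 1)] fun ω ↦ kernelOp K g (X i ω) :=
    (measurable_kernelOp hg).comp (measurable_past (Nat.le_succ i))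
  exact Measurable.sub h1 h2

lemma measurable_msum (hg : Measurable g) (s j : ℕ) :
    Measurable[past X (s + j)] (msum K g X s j) := by
  unfold msum
  refine Finset.measurable_fun_sum _ fun i hi ↦ (measurable_mdiff hg (s + i)).mono
    (past_mono ?_) le_rfl
  have := Finset.mem_range.1 hi
  lia

namespace GapChain

lemma memLp_kernelOp (H : GapChain K π P X κ g) : MemLp (kernelOp K g) 8 π :=
  BatchMeans.memLp_kernelOp H.inv (by norm_num) (by simp) H.meas H.memLp

lemma memLp_mdiff (H : GapChain K π P X κ g) (i : ℕ) : MemLp (mdiff K g X i) 8 P :=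
  (memLp_comp H.chain H.inv H.memLp (i + 1)).sub (memLp_comp H.chain H.inv H.memLp_kernelOp i)

lemma lpNorm_mdiff_le (H : GapChain K π P X κ g) (i : ℕ) :
    lpNorm (mdiff K g X i) 8 P ≤ 2 * lpNorm g 8 π := by
  have h := lpNorm_sub_le (g := fun ω ↦ kernelOp K g (X i ω))
    (memLp_comp H.chain H.inv H.memLp (i + 1)) (by norm_num)
  rw [lpNorm_comp H.chain H.inv H.memLp, lpNorm_comp H.chain H.inv H.memLp_kernelOp] at h
  have h2 := lpNorm_kernelOp_le H.inv (by norm_num) (by simp) H.meas H.memLp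
  exact h.trans (by linarith)

lemma memLp_msum (H : GapChain K π P X κ g) (s j : ℕ) : MemLp (msum K g X s j) 8 P :=
  memLp_finsetSum _ fun i _ ↦ H.memLp_mdiff (s + i)

/-- The products are assumed integrable, instead of A square integrable, because A will be the
seventh power of a function known only to lie in L⁸. -/
lemma integral_mul_mdiff (H : GapChain K π P X κ g) {n : ℕ} {A : Ω → ℝ}
    (hA : Measurable[past X n] A) (h1 : Integrable (fun ω ↦ A ω * g (X (n + 1) ω)) P)
    (h2 : Integrable (fun ω ↦ A ω * kernelOp K g (X n ω)) P) :
    ∫ ω, A ω * mdiff K g X n ω ∂P = 0 := by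
  simp_rw [mdiff, mul_sub]
  rw [integral_sub h1 h2, integral_mul_comp_succ H.chain hA H.meas h1, sub_self]

lemma integral_mul_mdiff_of_memLp (H : GapChain K π P X κ g) {n : ℕ} {A : Ω → ℝ}
    (hA : Measurable[past X n] A) (hA2 : MemLp A 2 P) :
    ∫ ω, A ω * mdiff K g X n ω ∂P = 0 :=
  H.integral_mul_mdiff hA
    (integrable_mul_of_memLp_two hA2
      ((memLp_comp H.chain H.inv H.memLp (n + 1)).mono_exponent (by norm_num)))
    (integrable_mul_of_memLp_two hA2
      ((memLp_comp H.chain H.inv H.memLp_kernelOp n).mono_exponent (by norm_num)))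

lemma measurable_condVar (hg : Measurable g) : Measurable (condVar K g) :=
  (measurable_kernelOp (hg.pow_const 2)).sub ((measurable_kernelOp hg).pow_const 2)

lemma memLp_sq (H : GapChain K π P X κ g) : MemLp (fun x ↦ g x ^ 2) 4 π := by
  simp_rw [sq]; exact memLp_mul H.memLp H.memLp

lemma memLp_condVar (H : GapChain K π P X κ g) : MemLp (condVar K g) 2 π := by
  have h1 : MemLp (BatchMeans.kernelOp K fun x ↦ g x ^ 2) 4 π :=
    BatchMeans.memLp_kernelOp H.inv (by norm_num) (by simp) (H.meas.pow_const 2) H.memLp_sq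
  have h2 : MemLp (fun x ↦ BatchMeans.kernelOp K g x ^ 2) 4 π := by
    simp_rw [sq]; exact memLp_mul H.memLp_kernelOp H.memLp_kernelOp
  exact (h1.sub h2).mono_exponent (by norm_num)

/-- Expanding the square, the cross term and the squared predictor combine by the Markov property,
leaving E[g(X_{n+1})² | past] - (Tg(X_n))². -/
lemma integral_mul_mdiff_sq (H : GapChain K π P X κ g) {n : ℕ} {A : Ω → ℝ}
    (hA : Measurable[past X n] A) (hA4 : MemLp A 4 P) :
    ∫ ω, A ω * mdiff K g X n ω ^ 2 ∂P = ∫ ω, A ω * condVar K g (X n ω) ∂P := by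
  have hT8 := memLp_comp H.chain H.inv H.memLp_kernelOp n
  have hT4 : MemLp (fun ω ↦ kernelOp K g (X n ω)) 4 P := hT8.mono_exponent (by norm_num)
  have hg2 : MemLp (fun ω ↦ g (X (n + 1) ω)) 2 P :=
    (memLp_comp H.chain H.inv H.memLp (n + 1)).mono_exponent (by norm_num)
  have hA2 : MemLp A 2 P := hA4.mono_exponent (by norm_num)
  have hB2 : MemLp (fun ω ↦ A ω * kernelOp K g (X n ω)) 2 P := memLp_mul hA4 hT4
  have hBm : Measurable[past X n] fun ω ↦ A ω * kernelOp K g (X n ω) :=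
    Measurable.mul hA ((measurable_kernelOp H.meas).comp (measurable_past le_rfl))
  have i1 : Integrable (fun ω ↦ A ω * g (X (n + 1) ω) ^ 2) P :=
    integrable_mul_of_memLp_two hA2
      ((memLp_comp H.chain H.inv H.memLp_sq (n + 1)).mono_exponent (by norm_num))
  have i2 : Integrable (fun ω ↦ A ω * kernelOp K g (X n ω) * g (X (n + 1) ω)) P :=
    integrable_mul_of_memLp_two hB2 hg2
  have i3 : Integrable (fun ω ↦ A ω * kernelOp K g (X n ω) * kernelOp K g (X n ω)) P :=
    integrable_mul_of_memLp_two hB2 (hT4.mono_exponent (by norm_num))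
  have i4 : Integrable (fun ω ↦ A ω * kernelOp K (fun x ↦ g x ^ 2) (X n ω)) P :=
    integrable_mul_of_memLp_two hA2 ((memLp_comp H.chain H.inv (BatchMeans.memLp_kernelOp H.inv
      (by norm_num) (by simp) (H.meas.pow_const 2) H.memLp_sq) n).mono_exponent (by norm_num))
  have e1 := integral_mul_comp_succ H.chain hA (H.meas.pow_const 2) i1
  have e2 := integral_mul_comp_succ H.chain hBm H.meas i2
  calc ∫ ω, A ω * mdiff K g X n ω ^ 2 ∂P
      = ∫ ω, ((A ω * g (X (n + 1) ω) ^ 2 - 2 * (A ω * kernelOp K g (X n ω) * g (X (n + 1) ω)))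
        + A ω * kernelOp K g (X n ω) * kernelOp K g (X n ω)) ∂P := by
        congr 1; ext ω; rw [mdiff]; ring
    _ = ∫ ω, A ω * kernelOp K (fun x ↦ g x ^ 2) (X n ω) ∂P
        - ∫ ω, A ω * kernelOp K g (X n ω) * kernelOp K g (X n ω) ∂P := by
        rw [integral_add (by fun_prop) i3, integral_sub i1 (by fun_prop),
          integral_const_mul, e1, e2]
        ring
    _ = _ := by
        rw [← integral_sub i4 i3]
        congr 1; ext ω; rw [condVar]; ring

/-- The eighth moments of the martingale grow like the fourth power of the length. -/
lemma exists_lpNorm_msum_le (H : GapChain K π P X κ g) :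
    ∃ B : ℝ, 0 ≤ B ∧ ∀ s j : ℕ, lpNorm (msum K g X s j) 8 P ≤ B * √(j : ℝ) := by
  obtain ⟨c, hc0, hc⟩ := pow_eight_add_le
  set d := 2 * lpNorm g 8 π with hd
  have hd0 : 0 ≤ d := by have := lpNorm_nonneg (f := g) (p := 8) (μ := π); positivity
  have hD : ∀ i, ∫ ω, mdiff K g X i ω ^ 8 ∂P ≤ d ^ 8 := fun i ↦ by
    rw [← lpNorm_eight_pow (H.memLp_mdiff i)]
    exact pow_le_pow_left₀ lpNorm_nonneg (H.lpNorm_mdiff_le i) 8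
  have hE : ∀ s j : ℕ, ∫ ω, msum K g X s j ω ^ 8 ∂P ≤ (c + 1) * d ^ 8 * (j : ℝ) ^ 4 := by
    intro s
    refine le_pow_four_of_recursion hc0 (by positivity) (by simp [msum_zero]) ?_ fun j hj ↦ ?_
    · simpa [msum_succ, msum_zero] using hD s
    · have hM := H.memLp_msum s j
      have hDj := H.memLp_mdiff (s + j)
      have hMm := (measurable_msum (K := K) (X := X) H.meas s j)
      have i0 := integrable_pow_eight hM
      have i1 := integrable_pow_seven_mul hM hDj
      have i2 := integrable_pow_eight hDj
      have e0 : ∫ ω, msum K g X s j ω ^ 7 * mdiff K g X (s + j) ω ∂P = 0 :=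
        H.integral_mul_mdiff (hMm.pow_const 7)
          (integrable_pow_seven_mul hM (memLp_comp H.chain H.inv H.memLp _))
          (integrable_pow_seven_mul hM (memLp_comp H.chain H.inv H.memLp_kernelOp _))
      calc ∫ ω, msum K g X s (j + 1) ω ^ 8 ∂P
          ≤ ∫ ω, (msum K g X s j ω ^ 8 + 8 * (msum K g X s j ω ^ 7 * mdiff K g X (s + j) ω)
            + msum K g X s j ω ^ 8 / j + c * (j : ℝ) ^ 3 * mdiff K g X (s + j) ω ^ 8) ∂P := by
            refine integral_mono (integrable_pow_eight (H.memLp_msum s (j + 1))) (by fun_prop)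
              fun ω ↦ ?_
            simp only [msum_succ]
            exact hc _ _ _ (by exact_mod_cast hj)
        _ = ∫ ω, msum K g X s j ω ^ 8 ∂P + (∫ ω, msum K g X s j ω ^ 8 ∂P) / j
            + c * (j : ℝ) ^ 3 * ∫ ω, mdiff K g X (s + j) ω ^ 8 ∂P := by
            rw [integral_add (by fun_prop) (by fun_prop), integral_add (by fun_prop) (by fun_prop),
              integral_add (by fun_prop) (by fun_prop), integral_const_mul, integral_const_mul,
              integral_div, e0]
            ring
        _ ≤ _ := by gcongr; exact hD _
  -- The eighth root is taken crudely: c + 1 ≤ (c + 1)⁸.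
  refine ⟨(c + 1) * d, by positivity, fun s j ↦ ?_⟩
  refine le_of_pow_le_pow_left₀ (n := 8) (by norm_num) (by positivity) ?_
  rw [lpNorm_eight_pow (H.memLp_msum s j)]
  refine (hE s j).trans ?_
  have h1 : √(j : ℝ) ^ 8 = (j : ℝ) ^ 4 := by
    rw [show √(j : ℝ) ^ 8 = (√(j : ℝ) ^ 2) ^ 4 by ring, Real.sq_sqrt (by positivity)]
  rw [mul_pow ((c + 1) * d), mul_pow (c + 1) d, h1]
  have h2 : c + 1 ≤ (c + 1) ^ 8 := le_self_pow₀ (by linarith) (by norm_num)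
  gcongr

end GapChain

end Martingale

/-! ### Hölder bounds for products of up to four L⁸ functions with a bounded weight. -/

section Products

variable {α : Type*} {mα : MeasurableSpace α} {μ : Measure α} [IsProbabilityMeasure μ]
  {A f₁ f₂ f₃ f₄ u : α → ℝ} {c₁ c₂ c₃ c₄ c : ℝ}

lemma memLp_two_mul (h₁ : MemLp f₁ 8 μ) (h₂ : MemLp f₂ 8 μ) :
    MemLp (fun x ↦ f₁ x * f₂ x) 2 μ :=
  (memLp_mul h₁ h₂ : MemLp _ 4 μ).mono_exponent (by norm_num)

lemma lpNorm_two_mul_le (h₁ : MemLp f₁ 8 μ) (h₂ : MemLp f₂ 8 μ) (b₁ : lpNorm f₁ 8 μ ≤ c₁)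
    (b₂ : lpNorm f₂ 8 μ ≤ c₂) : lpNorm (fun x ↦ f₁ x * f₂ x) 2 μ ≤ c₁ * c₂ :=
  ((lpNorm_mono_exponent (by norm_num) (memLp_mul h₁ h₂ : MemLp _ 4 μ)).trans
    (lpNorm_mul_le h₁ h₂)).trans (mul_le_mul b₁ b₂ lpNorm_nonneg (lpNorm_nonneg.trans b₁))

lemma integrable_mul_four (hA : AEStronglyMeasurable A μ) (hA1 : ∀ x, |A x| ≤ 1)
    (h₁ : MemLp f₁ 8 μ) (h₂ : MemLp f₂ 8 μ) (h₃ : MemLp f₃ 8 μ) (h₄ : MemLp f₄ 8 μ) :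
    Integrable (fun x ↦ A x * (f₁ x * f₂ x * (f₃ x * f₄ x))) μ :=
  memLp_one_iff_integrable.1 (memLp_bounded_mul hA hA1 (memLp_one_iff_integrable.2
    (integrable_mul_of_memLp_two (memLp_two_mul h₁ h₂) (memLp_two_mul h₃ h₄))))

lemma abs_integral_mul_four_le (hA : AEStronglyMeasurable A μ) (hA1 : ∀ x, |A x| ≤ 1)
    (h₁ : MemLp f₁ 8 μ) (h₂ : MemLp f₂ 8 μ) (h₃ : MemLp f₃ 8 μ) (h₄ : MemLp f₄ 8 μ)
    (b₁ : lpNorm f₁ 8 μ ≤ c₁) (b₂ : lpNorm f₂ 8 μ ≤ c₂) (b₃ : lpNorm f₃ 8 μ ≤ c₃)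
    (b₄ : lpNorm f₄ 8 μ ≤ c₄) :
    |∫ x, A x * (f₁ x * f₂ x * (f₃ x * f₄ x)) ∂μ| ≤ c₁ * c₂ * (c₃ * c₄) := by
  have h12 := memLp_two_mul h₁ h₂
  have h34 := memLp_two_mul h₃ h₄
  refine (abs_integral_le_lpNorm_one (hA.mul (h12.1.mul h34.1))).trans ?_
  refine (lpNorm_bounded_mul_le hA hA1 (memLp_mul h12 h34)).trans ?_
  refine (lpNorm_mul_le h12 h34).trans ?_
  exact mul_le_mul (lpNorm_two_mul_le h₁ h₂ b₁ b₂) (lpNorm_two_mul_le h₃ h₄ b₃ b₄) lpNorm_nonneg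
    (mul_nonneg (lpNorm_nonneg.trans b₁) (lpNorm_nonneg.trans b₂))

lemma integrable_mul_two (hA : AEStronglyMeasurable A μ) (hA1 : ∀ x, |A x| ≤ 1)
    (h₁ : MemLp f₁ 8 μ) (h₂ : MemLp f₂ 8 μ) : Integrable (fun x ↦ A x * (f₁ x * f₂ x)) μ :=
  (memLp_bounded_mul hA hA1 (memLp_two_mul h₁ h₂)).integrable (by norm_num)

lemma abs_integral_mul_two_le (hA : AEStronglyMeasurable A μ) (hA1 : ∀ x, |A x| ≤ 1)
    (h₁ : MemLp f₁ 8 μ) (h₂ : MemLp f₂ 8 μ) (b₁ : lpNorm f₁ 8 μ ≤ c₁) (b₂ : lpNorm f₂ 8 μ ≤ c₂) :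
    |∫ x, A x * (f₁ x * f₂ x) ∂μ| ≤ c₁ * c₂ := by
  have h12 := memLp_two_mul h₁ h₂
  refine (abs_integral_le_lpNorm_two (memLp_bounded_mul hA hA1 h12)).trans ?_
  exact (lpNorm_bounded_mul_le hA hA1 h12).trans (lpNorm_two_mul_le h₁ h₂ b₁ b₂)

lemma integrable_mul_three (hA : AEStronglyMeasurable A μ) (hA1 : ∀ x, |A x| ≤ 1)
    (h₁ : MemLp f₁ 8 μ) (h₂ : MemLp f₂ 8 μ) (hu : MemLp u 2 μ) :
    Integrable (fun x ↦ A x * (f₁ x * f₂ x) * u x) μ :=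
  integrable_mul_of_memLp_two (memLp_bounded_mul hA hA1 (memLp_two_mul h₁ h₂)) hu

lemma abs_integral_mul_three_le (hA : AEStronglyMeasurable A μ) (hA1 : ∀ x, |A x| ≤ 1)
    (h₁ : MemLp f₁ 8 μ) (h₂ : MemLp f₂ 8 μ) (hu : MemLp u 2 μ)
    (b₁ : lpNorm f₁ 8 μ ≤ c₁) (b₂ : lpNorm f₂ 8 μ ≤ c₂) (b : lpNorm u 2 μ ≤ c) :
    |∫ x, A x * (f₁ x * f₂ x) * u x ∂μ| ≤ c₁ * c₂ * c := by
  have h12 := memLp_two_mul h₁ h₂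
  refine (abs_integral_mul_le (memLp_bounded_mul hA hA1 h12) hu).trans ?_
  refine mul_le_mul ?_ b lpNorm_nonneg
    (mul_nonneg (lpNorm_nonneg.trans b₁) (lpNorm_nonneg.trans b₂))
  exact (lpNorm_bounded_mul_le hA hA1 h12).trans (lpNorm_two_mul_le h₁ h₂ b₁ b₂)

end Products

/-! ### Second and fourth moments of the martingale given the past. -/

section Mixing

set_option linter.unusedSectionVars false

variable {S Ω : Type*} [MeasurableSpace S] [mΩ : MeasurableSpace Ω] {K : Kernel S S}
  {π : Measure S} {P : Measure Ω} {X : ℕ → Ω → S} {κ : ℝ} {g : S → ℝ}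
  [IsMarkovKernel K] [IsProbabilityMeasure π] [IsProbabilityMeasure P]

namespace GapChain

lemma lpNorm_iterate_comp_le (H : GapChain K π P X κ g) {u : S → ℝ} (hum : Measurable u)
    (hu : MemLp u 2 π) (hu0 : ∫ x, u x ∂π = 0) (m n : ℕ) :
    lpNorm (fun ω ↦ (kernelOp K)^[m] u (X n ω)) 2 P ≤ κ ^ m * lpNorm u 2 π := by
  rw [lpNorm_comp H.chain H.inv (memLp_kernelOp_iterate H.inv (by norm_num) (by simp) hum hu m)]
  simpa using H.decay u hum hu hu0 m

lemma memLp_iterate_comp (H : GapChain K π P X κ g) {u : S → ℝ} (hum : Measurable u)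
    (hu : MemLp u 2 π) (m n : ℕ) : MemLp (fun ω ↦ (kernelOp K)^[m] u (X n ω)) 2 P :=
  memLp_comp H.chain H.inv (memLp_kernelOp_iterate H.inv (by norm_num) (by simp) hum hu m) n

lemma abs_integral_mul_comp_le (H : GapChain K π P X κ g) {s : ℕ} {A : Ω → ℝ}
    (hA : Measurable[past X s] A) (hA1 : ∀ ω, |A ω| ≤ 1) {u : S → ℝ} (hum : Measurable u)
    (hu : MemLp u 2 π) (hu0 : ∫ x, u x ∂π = 0) (i : ℕ) :
    |∫ ω, A ω * u (X (s + i) ω) ∂P| ≤ κ ^ i * lpNorm u 2 π := by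
  have hA' : AEStronglyMeasurable A P := (hA.mono (past_le H.chain s) le_rfl).aestronglyMeasurable
  have hA2 : MemLp A 2 P := MemLp.of_bound hA' 1 (ae_of_all _ hA1)
  rw [integral_mul_comp_add H.chain H.inv hA hA2 hum hu]
  have hm := H.memLp_iterate_comp hum hu i s
  refine (abs_integral_le_lpNorm_two (memLp_bounded_mul hA' hA1 hm)).trans ?_
  exact (lpNorm_bounded_mul_le hA' hA1 hm).trans (H.lpNorm_iterate_comp_le hum hu hu0 i s)

/-- The bound is uniform in n although the martingale sum M_n is of size √n. Replace u by T^m u and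
peel off the last increment D: in the term with M_j the Markov property turns T^m u into T^{m+1} u,
while the term with D costs O(κ^m). Iterating down to j = 0 sums a geometric series. -/
lemma abs_integral_mul_msum_mul_le (H : GapChain K π P X κ g) {s : ℕ} {A : Ω → ℝ}
    (hA : Measurable[past X s] A) (hA1 : ∀ ω, |A ω| ≤ 1) {u : S → ℝ} (hum : Measurable u)
    (hu : MemLp u 2 π) (hu0 : ∫ x, u x ∂π = 0) (n : ℕ) :
    |∫ ω, A ω * msum K g X s n ω * u (X (s + n) ω) ∂P|
      ≤ 2 * lpNorm g 8 π * lpNorm u 2 π / (1 - κ) := by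
  have hA' : AEStronglyMeasurable A P := (hA.mono (past_le H.chain s) le_rfl).aestronglyMeasurable
  have hgn : 0 ≤ lpNorm g 8 π := lpNorm_nonneg
  have hun : 0 ≤ lpNorm u 2 π := lpNorm_nonneg
  have key := abs_le_geometric_of_shift (n := n) (c := 2 * lpNorm g 8 π * lpNorm u 2 π)
    (F := fun j m ↦ ∫ ω, A ω * msum K g X s j ω * (kernelOp K)^[m] u (X (s + j) ω) ∂P)
    H.pos H.lt_one (by positivity) (by simp [msum_zero]) fun j _ m ↦ ?_
  · simpa using key n le_rfl 0
  have hM2 : MemLp (msum K g X s j) 2 P := (H.memLp_msum s j).mono_exponent (by norm_num)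
  have hD2 : MemLp (mdiff K g X (s + j)) 2 P := (H.memLp_mdiff _).mono_exponent (by norm_num)
  have hAM := memLp_bounded_mul hA' hA1 hM2
  have hAD := memLp_bounded_mul hA' hA1 hD2
  have hT := H.memLp_iterate_comp hum hu m (s + j + 1)
  have hAMm : Measurable[past X (s + j)] fun ω ↦ A ω * msum K g X s j ω :=
    Measurable.mul (hA.mono (past_mono (by lia)) le_rfl) (measurable_msum H.meas s j)
  have e1 := integral_mul_iterate_comp_succ H.chain H.inv hAMm hAM hum hu m
  have e2 : ∫ ω, A ω * msum K g X s (j + 1) ω * (kernelOp K)^[m] u (X (s + (j + 1)) ω) ∂P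
      = ∫ ω, A ω * msum K g X s j ω * (kernelOp K)^[m + 1] u (X (s + j) ω) ∂P
        + ∫ ω, A ω * mdiff K g X (s + j) ω * (kernelOp K)^[m] u (X (s + j + 1) ω) ∂P := by
    rw [← e1, ← integral_add (integrable_mul_of_memLp_two hAM hT)
      (integrable_mul_of_memLp_two hAD hT)]
    congr 1; ext ω; rw [msum_succ, ← add_assoc s j 1]; ring
  have e3 : |∫ ω, A ω * mdiff K g X (s + j) ω * (kernelOp K)^[m] u (X (s + j + 1) ω) ∂P|
      ≤ 2 * lpNorm g 8 π * lpNorm u 2 π * κ ^ m := by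
    refine (BatchMeans.abs_integral_mul_le hAD hT).trans ?_
    calc _ ≤ (2 * lpNorm g 8 π) * (κ ^ m * lpNorm u 2 π) := by
          refine mul_le_mul ?_ (H.lpNorm_iterate_comp_le hum hu hu0 m _) lpNorm_nonneg
            (by positivity)
          refine (lpNorm_bounded_mul_le hA' hA1 hD2).trans ?_
          exact (lpNorm_mono_exponent (by norm_num) (H.memLp_mdiff _)).trans (H.lpNorm_mdiff_le _)
      _ = _ := by ring
  simp only [e2]
  exact (abs_add_le _ _).trans (by gcongr)

/-- The same peeling for M_j². The cross term M_j D has size √n, so the total is O(√n), whereas a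
direct Hölder bound would give O(n). -/
lemma abs_integral_mul_msum_sq_mul_le (H : GapChain K π P X κ g) {B : ℝ} (hB : 0 ≤ B)
    (hMB : ∀ s j : ℕ, lpNorm (msum K g X s j) 8 P ≤ B * √(j : ℝ)) {s : ℕ} {A : Ω → ℝ}
    (hA : Measurable[past X s] A) (hA1 : ∀ ω, |A ω| ≤ 1) {u : S → ℝ} (hum : Measurable u)
    (hu : MemLp u 2 π) (hu0 : ∫ x, u x ∂π = 0) {j n : ℕ} (hjn : j ≤ n) :
    |∫ ω, A ω * (msum K g X s j ω * msum K g X s j ω) * u (X (s + j) ω) ∂P|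
      ≤ (2 * (B * √(n : ℝ) * (2 * lpNorm g 8 π)) + (2 * lpNorm g 8 π) * (2 * lpNorm g 8 π))
        * lpNorm u 2 π / (1 - κ) := by
  have hA' : AEStronglyMeasurable A P := (hA.mono (past_le H.chain s) le_rfl).aestronglyMeasurable
  obtain ⟨d, hd⟩ : ∃ d, d = 2 * lpNorm g 8 π := ⟨_, rfl⟩
  have hd0 : 0 ≤ d := by have := lpNorm_nonneg (f := g) (p := 8) (μ := π); rw [hd]; positivity
  rw [← hd]
  have hun : 0 ≤ lpNorm u 2 π := lpNorm_nonneg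
  have key := abs_le_geometric_of_shift (n := n)
    (c := (2 * (B * √(n : ℝ) * d) + d * d) * lpNorm u 2 π)
    (F := fun j m ↦ ∫ ω, A ω * (msum K g X s j ω * msum K g X s j ω)
      * (kernelOp K)^[m] u (X (s + j) ω) ∂P)
    H.pos H.lt_one (by positivity) (by simp [msum_zero]) fun j hj m ↦ ?_
  · simpa using key j hjn 0
  have hM := H.memLp_msum s j
  have hD := H.memLp_mdiff (s + j)
  have hT := H.memLp_iterate_comp hum hu m (s + j + 1)
  have hMn : lpNorm (msum K g X s j) 8 P ≤ B * √(n : ℝ) := by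
    refine (hMB s j).trans ?_
    have : (j : ℝ) ≤ n := by exact_mod_cast hj.le
    gcongr
  have hDn : lpNorm (mdiff K g X (s + j)) 8 P ≤ d := by rw [hd]; exact H.lpNorm_mdiff_le _
  have hTn := H.lpNorm_iterate_comp_le hum hu hu0 m (s + j + 1)
  have hAMm : Measurable[past X (s + j)] fun ω ↦ A ω * (msum K g X s j ω * msum K g X s j ω) :=
    Measurable.mul (hA.mono (past_mono (by lia)) le_rfl)
      (Measurable.mul (measurable_msum H.meas s j) (measurable_msum H.meas s j))
  have e1 := integral_mul_iterate_comp_succ H.chain H.inv hAMm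
    (memLp_bounded_mul hA' hA1 (memLp_two_mul hM hM)) hum hu m
  have i1 := integrable_mul_three hA' hA1 hM hM hT
  have i2 := integrable_mul_three hA' hA1 hM hD hT
  have i3 := integrable_mul_three hA' hA1 hD hD hT
  have e2 : ∫ ω, A ω * (msum K g X s (j + 1) ω * msum K g X s (j + 1) ω)
        * (kernelOp K)^[m] u (X (s + (j + 1)) ω) ∂P
      = ∫ ω, A ω * (msum K g X s j ω * msum K g X s j ω)
          * (kernelOp K)^[m + 1] u (X (s + j) ω) ∂P
        + 2 * ∫ ω, A ω * (msum K g X s j ω * mdiff K g X (s + j) ω)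
          * (kernelOp K)^[m] u (X (s + j + 1) ω) ∂P
        + ∫ ω, A ω * (mdiff K g X (s + j) ω * mdiff K g X (s + j) ω)
          * (kernelOp K)^[m] u (X (s + j + 1) ω) ∂P := by
    rw [← e1, ← integral_const_mul, ← integral_add i1 (i2.const_mul 2),
      ← integral_add (by fun_prop) i3]
    congr 1; ext ω; rw [msum_succ, ← add_assoc s j 1]; ring
  have b2 : |∫ ω, A ω * (msum K g X s j ω * mdiff K g X (s + j) ω)
          * (kernelOp K)^[m] u (X (s + j + 1) ω) ∂P|
      ≤ B * √(n : ℝ) * d * (κ ^ m * lpNorm u 2 π) :=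
    abs_integral_mul_three_le hA' hA1 hM hD hT hMn hDn hTn
  have b3 : |∫ ω, A ω * (mdiff K g X (s + j) ω * mdiff K g X (s + j) ω)
          * (kernelOp K)^[m] u (X (s + j + 1) ω) ∂P|
      ≤ d * d * (κ ^ m * lpNorm u 2 π) :=
    abs_integral_mul_three_le hA' hA1 hD hD hT hDn hDn hTn
  simp only [e2]
  refine (abs_add_le _ _).trans ?_
  refine (add_le_add (abs_add_le _ _) le_rfl).trans ?_
  rw [abs_mul, abs_two]
  linarith

lemma measurable_centered (hg : Measurable g) :
    Measurable fun x ↦ condVar K g x - martVar K π g :=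
  (measurable_condVar hg).sub_const _

lemma memLp_centered (H : GapChain K π P X κ g) :
    MemLp (fun x ↦ condVar K g x - martVar K π g) 2 π := H.memLp_condVar.sub (memLp_const _)

lemma integral_centered (H : GapChain K π P X κ g) :
    ∫ x, (condVar K g x - martVar K π g) ∂π = 0 := by
  rw [integral_sub (H.memLp_condVar.integrable (by norm_num)) (integrable_const _)]
  simp [martVar]

/-- Second moments of the martingale, conditionally on the past. -/
lemma exists_abs_integral_mul_msum_sq_le (H : GapChain K π P X κ g) :
    ∃ C : ℝ, 0 ≤ C ∧ ∀ (s : ℕ) (A : Ω → ℝ), Measurable[past X s] A → (∀ ω, |A ω| ≤ 1) → ∀ n : ℕ,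
      |∫ ω, A ω * (msum K g X s n ω * msum K g X s n ω) ∂P
        - n * martVar K π g * ∫ ω, A ω ∂P| ≤ C := by
  set w : S → ℝ := fun x ↦ condVar K g x - martVar K π g with hw
  have hwn : 0 ≤ lpNorm w 2 π := lpNorm_nonneg
  have hκ : 0 < 1 - κ := by linarith [H.lt_one]
  refine ⟨lpNorm w 2 π * (1 / (1 - κ)), by positivity, fun s A hA hA1 n ↦ ?_⟩
  have hA' : AEStronglyMeasurable A P := (hA.mono (past_le H.chain s) le_rfl).aestronglyMeasurable
  have hA2 : MemLp A 2 P := MemLp.of_bound hA' 1 (ae_of_all _ hA1)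
  have hA4 : MemLp A 4 P := MemLp.of_bound hA' 1 (ae_of_all _ hA1)
  -- The cross term vanishes by the martingale property, and the squared increment contributes its
  -- conditional variance, split into its mean and the centered part w. The w-terms are summable by
  -- the spectral gap.
  have hstep : ∀ j, ∫ ω, A ω * (msum K g X s (j + 1) ω * msum K g X s (j + 1) ω) ∂P
      = ∫ ω, A ω * (msum K g X s j ω * msum K g X s j ω) ∂P + martVar K π g * ∫ ω, A ω ∂P
        + ∫ ω, A ω * w (X (s + j) ω) ∂P := by
    intro j
    have hM := H.memLp_msum s j
    have hD := H.memLp_mdiff (s + j)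
    have hAj : Measurable[past X (s + j)] A := hA.mono (past_mono (by lia)) le_rfl
    have hAMm : Measurable[past X (s + j)] fun ω ↦ A ω * msum K g X s j ω :=
      Measurable.mul hAj (measurable_msum H.meas s j)
    have hAM : MemLp (fun ω ↦ A ω * msum K g X s j ω) 2 P :=
      memLp_bounded_mul hA' hA1 (hM.mono_exponent (by norm_num))
    have i1 := integrable_mul_two hA' hA1 hM hM
    have i2 : Integrable (fun ω ↦ A ω * msum K g X s j ω * mdiff K g X (s + j) ω) P :=
      integrable_mul_of_memLp_two hAM (hD.mono_exponent (by norm_num))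
    have i3 : Integrable (fun ω ↦ A ω * mdiff K g X (s + j) ω ^ 2) P := by
      simp_rw [sq]; exact integrable_mul_two hA' hA1 hD hD
    have i4 : Integrable (fun ω ↦ A ω * w (X (s + j) ω)) P :=
      integrable_mul_of_memLp_two hA2 (memLp_comp H.chain H.inv H.memLp_centered _)
    have i5 : Integrable A P := hA2.integrable (by norm_num)
    have e2 := H.integral_mul_mdiff_of_memLp hAMm hAM
    have e3 := H.integral_mul_mdiff_sq hAj hA4
    have e4 : ∫ ω, A ω * condVar K g (X (s + j) ω) ∂P
        = martVar K π g * ∫ ω, A ω ∂P + ∫ ω, A ω * w (X (s + j) ω) ∂P := by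
      rw [← integral_const_mul, ← integral_add (i5.const_mul _) i4]
      congr 1; ext ω; simp only [hw]; ring
    calc ∫ ω, A ω * (msum K g X s (j + 1) ω * msum K g X s (j + 1) ω) ∂P
        = ∫ ω, (A ω * (msum K g X s j ω * msum K g X s j ω)
            + 2 * (A ω * msum K g X s j ω * mdiff K g X (s + j) ω)
            + A ω * mdiff K g X (s + j) ω ^ 2) ∂P := by
          congr 1; ext ω; rw [msum_succ]; ring
      _ = _ := by
          rw [integral_add (by fun_prop) i3, integral_add i1 (by fun_prop), integral_const_mul,
            e2, e3, e4]
          ring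
  have hsum : ∫ ω, A ω * (msum K g X s n ω * msum K g X s n ω) ∂P
      - n * martVar K π g * ∫ ω, A ω ∂P
      = ∑ j ∈ Finset.range n, ∫ ω, A ω * w (X (s + j) ω) ∂P := by
    induction n with
    | zero => simp [msum_zero]
    | succ n ih => rw [Finset.sum_range_succ, ← ih, hstep]; push_cast; ring
  rw [hsum]
  refine (Finset.abs_sum_le_sum_abs _ _).trans ?_
  calc _ ≤ ∑ j ∈ Finset.range n, κ ^ j * lpNorm w 2 π :=
        Finset.sum_le_sum fun j _ ↦ H.abs_integral_mul_comp_le hA hA1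
          (measurable_centered H.meas) H.memLp_centered H.integral_centered j
    _ = lpNorm w 2 π * ∑ j ∈ Finset.range n, κ ^ j := by rw [← Finset.sum_mul, mul_comm]
    _ ≤ _ := by gcongr; exact sum_range_pow_le H.pos H.lt_one n

/-- Fourth moments of the martingale, conditionally on the past. -/
lemma exists_abs_integral_mul_msum_four_le (H : GapChain K π P X κ g) :
    ∃ C : ℝ, 0 ≤ C ∧ ∀ (s : ℕ) (A : Ω → ℝ), Measurable[past X s] A → (∀ ω, |A ω| ≤ 1) →
      ∀ n : ℕ, 1 ≤ n →
      |∫ ω, A ω * (msum K g X s n ω * msum K g X s n ω * (msum K g X s n ω * msum K g X s n ω)) ∂P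
        - 3 * (n : ℝ) ^ 2 * martVar K π g ^ 2 * ∫ ω, A ω ∂P| ≤ C * (n * √(n : ℝ)) := by
  obtain ⟨B, hB, hMB⟩ := H.exists_lpNorm_msum_le
  obtain ⟨C₁, hC₁, hM2⟩ := H.exists_abs_integral_mul_msum_sq_le
  set w : S → ℝ := fun x ↦ condVar K g x - martVar K π g with hw
  have hwn : 0 ≤ lpNorm w 2 π := lpNorm_nonneg
  have hκ : 0 < 1 - κ := by linarith [H.lt_one]
  obtain ⟨d, hd⟩ : ∃ d, d = 2 * lpNorm g 8 π := ⟨_, rfl⟩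
  have hd0 : 0 ≤ d := by have := lpNorm_nonneg (f := g) (p := 8) (μ := π); rw [hd]; positivity
  obtain ⟨v, hv⟩ : ∃ v, v = martVar K π g := ⟨_, rfl⟩
  obtain ⟨Γ, hΓ⟩ : ∃ Γ, Γ = 6 * |v| * C₁ + 6 * ((2 * (B * d) + d * d) * lpNorm w 2 π / (1 - κ))
    + 4 * (B * d * (d * d)) + d * d * (d * d) := ⟨_, rfl⟩
  have hΓ0 : 0 ≤ Γ := by rw [hΓ]; positivity
  refine ⟨Γ + 3 * v ^ 2, by positivity, fun s A hA hA1 n hn ↦ ?_⟩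
  rw [← hv]
  have hA' : AEStronglyMeasurable A P := (hA.mono (past_le H.chain s) le_rfl).aestronglyMeasurable
  have hAint : |∫ ω, A ω ∂P| ≤ 1 := by
    have := norm_integral_le_of_norm_le_const (μ := P) (f := A) (ae_of_all _ hA1)
    simpa using this
  have hsn : 1 ≤ √(n : ℝ) := Real.one_le_sqrt.2 (by exact_mod_cast hn)
  -- Expand (M + D)⁴. The term M³D vanishes, 6M²D² yields 6 j v² through the second moment bound
  -- with an error O(√n) from w, and MD³ and D⁴ are O(√n) by Hölder.
  have hstep : ∀ j < n,
      |∫ ω, A ω * (msum K g X s (j + 1) ω * msum K g X s (j + 1) ω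
          * (msum K g X s (j + 1) ω * msum K g X s (j + 1) ω)) ∂P
        - ∫ ω, A ω * (msum K g X s j ω * msum K g X s j ω
          * (msum K g X s j ω * msum K g X s j ω)) ∂P
        - 6 * j * v ^ 2 * ∫ ω, A ω ∂P| ≤ Γ * √(n : ℝ) := by
    intro j hj
    have hM := H.memLp_msum s j
    have hD := H.memLp_mdiff (s + j)
    have hMn : lpNorm (msum K g X s j) 8 P ≤ B * √(n : ℝ) := by
      refine (hMB s j).trans ?_
      have : (j : ℝ) ≤ n := by exact_mod_cast hj.le
      gcongr
    have hDn : lpNorm (mdiff K g X (s + j)) 8 P ≤ d := by rw [hd]; exact H.lpNorm_mdiff_le _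
    have hAj : Measurable[past X (s + j)] A := hA.mono (past_mono (by lia)) le_rfl
    have hMm := measurable_msum (K := K) (X := X) H.meas s j
    have hW := memLp_comp H.chain H.inv H.memLp_centered (s + j)
    have i1 := integrable_mul_four hA' hA1 hM hM hM hM
    have i2 := integrable_mul_four hA' hA1 hM hM hM hD
    have i3 := integrable_mul_four hA' hA1 hM hM hD hD
    have i4 := integrable_mul_four hA' hA1 hM hD hD hD
    have i5 := integrable_mul_four hA' hA1 hD hD hD hD
    have i6 := integrable_mul_two hA' hA1 hM hM
    have i7 := integrable_mul_three hA' hA1 hM hM hW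
    have e2 : ∫ ω, A ω * (msum K g X s j ω * msum K g X s j ω
        * (msum K g X s j ω * mdiff K g X (s + j) ω)) ∂P = 0 := by
      have hm3 : Measurable[past X (s + j)]
          fun ω ↦ A ω * (msum K g X s j ω * msum K g X s j ω * msum K g X s j ω) :=
        Measurable.mul hAj (Measurable.mul (Measurable.mul hMm hMm) hMm)
      have h4 : MemLp (fun ω ↦ msum K g X s j ω * msum K g X s j ω) 4 P := memLp_mul hM hM
      have h2 : MemLp (fun ω ↦ msum K g X s j ω * msum K g X s j ω * msum K g X s j ω) 2 P :=
        memLp_mul h4 (hM.mono_exponent (by norm_num) : MemLp _ 4 P)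
      rw [← H.integral_mul_mdiff_of_memLp hm3 (memLp_bounded_mul hA' hA1 h2)]
      congr 1; ext ω; ring
    have e3 : ∫ ω, A ω * (msum K g X s j ω * msum K g X s j ω
          * (mdiff K g X (s + j) ω * mdiff K g X (s + j) ω)) ∂P
        = v * ∫ ω, A ω * (msum K g X s j ω * msum K g X s j ω) ∂P
          + ∫ ω, A ω * (msum K g X s j ω * msum K g X s j ω) * w (X (s + j) ω) ∂P := by
      have hm2 : Measurable[past X (s + j)] fun ω ↦ A ω * (msum K g X s j ω * msum K g X s j ω) :=
        Measurable.mul hAj (Measurable.mul hMm hMm)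
      have h1 := H.integral_mul_mdiff_sq hm2 (memLp_bounded_mul hA' hA1 (memLp_mul hM hM))
      rw [← integral_const_mul, ← integral_add (i6.const_mul _) i7]
      calc _ = _ := by congr 1; ext ω; ring
        _ = _ := h1
        _ = _ := by congr 1; ext ω; simp only [hv]; ring
    have b4 := abs_integral_mul_four_le hA' hA1 hM hD hD hD hMn hDn hDn hDn
    have b5 := abs_integral_mul_four_le hA' hA1 hD hD hD hD hDn hDn hDn hDn
    have b6 := hM2 s A hA hA1 j
    rw [← hv] at b6
    have b7 := H.abs_integral_mul_msum_sq_mul_le hB hMB hA hA1 (measurable_centered H.meas)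
      H.memLp_centered H.integral_centered hj.le
    rw [← hd] at b7
    have hexp : ∫ ω, A ω * (msum K g X s (j + 1) ω * msum K g X s (j + 1) ω
          * (msum K g X s (j + 1) ω * msum K g X s (j + 1) ω)) ∂P
        = ∫ ω, A ω * (msum K g X s j ω * msum K g X s j ω
            * (msum K g X s j ω * msum K g X s j ω)) ∂P
          + 6 * (v * ∫ ω, A ω * (msum K g X s j ω * msum K g X s j ω) ∂P
            + ∫ ω, A ω * (msum K g X s j ω * msum K g X s j ω) * w (X (s + j) ω) ∂P)
          + 4 * ∫ ω, A ω * (msum K g X s j ω * mdiff K g X (s + j) ω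
            * (mdiff K g X (s + j) ω * mdiff K g X (s + j) ω)) ∂P
          + ∫ ω, A ω * (mdiff K g X (s + j) ω * mdiff K g X (s + j) ω
            * (mdiff K g X (s + j) ω * mdiff K g X (s + j) ω)) ∂P := by
      rw [← e3]
      calc _ = ∫ ω, (A ω * (msum K g X s j ω * msum K g X s j ω
              * (msum K g X s j ω * msum K g X s j ω))
            + 4 * (A ω * (msum K g X s j ω * msum K g X s j ω
              * (msum K g X s j ω * mdiff K g X (s + j) ω)))
            + 6 * (A ω * (msum K g X s j ω * msum K g X s j ω
              * (mdiff K g X (s + j) ω * mdiff K g X (s + j) ω)))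
            + 4 * (A ω * (msum K g X s j ω * mdiff K g X (s + j) ω
              * (mdiff K g X (s + j) ω * mdiff K g X (s + j) ω)))
            + A ω * (mdiff K g X (s + j) ω * mdiff K g X (s + j) ω
              * (mdiff K g X (s + j) ω * mdiff K g X (s + j) ω))) ∂P := by
            congr 1; ext ω; rw [msum_succ]; ring
        _ = _ := by
            rw [integral_add (by fun_prop) i5, integral_add (by fun_prop) (by fun_prop),
              integral_add (by fun_prop) (by fun_prop), integral_add i1 (by fun_prop),
              integral_const_mul, integral_const_mul, integral_const_mul, e2]
            ring
    rw [hexp]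
    generalize ∫ ω, A ω * (msum K g X s j ω * msum K g X s j ω) ∂P = I2 at b6 ⊢
    generalize ∫ ω, A ω * (msum K g X s j ω * msum K g X s j ω) * w (X (s + j) ω) ∂P = I3
      at b7 ⊢
    generalize ∫ ω, A ω * (msum K g X s j ω * mdiff K g X (s + j) ω
      * (mdiff K g X (s + j) ω * mdiff K g X (s + j) ω)) ∂P = I4 at b4 ⊢
    generalize ∫ ω, A ω * (mdiff K g X (s + j) ω * mdiff K g X (s + j) ω
      * (mdiff K g X (s + j) ω * mdiff K g X (s + j) ω)) ∂P = I5 at b5 ⊢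
    generalize ∫ ω, A ω * (msum K g X s j ω * msum K g X s j ω
      * (msum K g X s j ω * msum K g X s j ω)) ∂P = I1
    generalize ∫ ω, A ω ∂P = I0 at b6 ⊢
    have c7 : |I3| ≤ (2 * (B * d) + d * d) * lpNorm w 2 π / (1 - κ) * √(n : ℝ) := by
      refine b7.trans ?_
      rw [div_mul_eq_mul_div]
      refine div_le_div_of_nonneg_right ?_ hκ.le
      have : d * d * 1 ≤ d * d * √(n : ℝ) := by gcongr
      have h0 : (2 * (B * √(n : ℝ) * d) + d * d) ≤ (2 * (B * d) + d * d) * √(n : ℝ) := by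
        linarith
      calc _ ≤ (2 * (B * d) + d * d) * √(n : ℝ) * lpNorm w 2 π := by gcongr
        _ = _ := by ring
    have c6 : |v * (I2 - j * v * I0)| ≤ |v| * C₁ := by rw [abs_mul]; gcongr
    have c5' : d * d * (d * d) * 1 ≤ d * d * (d * d) * √(n : ℝ) := by gcongr
    have c6' : |v| * C₁ * 1 ≤ |v| * C₁ * √(n : ℝ) := by gcongr
    calc _ = |6 * (v * (I2 - j * v * I0)) + 6 * I3 + 4 * I4 + I5| := by congr 1; ring
      _ ≤ |6 * (v * (I2 - j * v * I0))| + |6 * I3| + |4 * I4| + |I5| :=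
          (abs_add_le _ _).trans (add_le_add ((abs_add_le _ _).trans
            (add_le_add (abs_add_le _ _) le_rfl)) le_rfl)
      _ = 6 * |v * (I2 - j * v * I0)| + 6 * |I3| + 4 * |I4| + |I5| := by
          simp only [abs_mul, Nat.abs_ofNat]
      _ ≤ Γ * √(n : ℝ) := by rw [hΓ]; linarith
  -- Summing 6 i v² over i < j gives 3 j (j - 1) v².
  have hind : ∀ j ≤ n, |∫ ω, A ω * (msum K g X s j ω * msum K g X s j ω
          * (msum K g X s j ω * msum K g X s j ω)) ∂P
        - 3 * (j * (j - 1)) * v ^ 2 * ∫ ω, A ω ∂P| ≤ j * (Γ * √(n : ℝ)) := by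
    intro j
    induction j with
    | zero => intro _; simp [msum_zero]
    | succ j ih =>
      intro hj
      have h1 := abs_le.1 (ih (by lia))
      have h2 := abs_le.1 (hstep j (by lia))
      push_cast
      rw [abs_le]
      constructor <;> nlinarith [h1.1, h1.2, h2.1, h2.2]
  have h1 := hind n le_rfl
  -- The difference between n (n - 1) and n² is absorbed in the error n √n.
  have h2 : |3 * (n : ℝ) * v ^ 2 * ∫ ω, A ω ∂P| ≤ 3 * v ^ 2 * (n * √(n : ℝ)) := by
    rw [abs_mul, abs_of_nonneg (by positivity)]
    calc _ ≤ 3 * (n : ℝ) * v ^ 2 * 1 := by gcongr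
      _ ≤ 3 * (n : ℝ) * v ^ 2 * √(n : ℝ) := by gcongr
      _ = _ := by ring
  have h3 := abs_le.1 h1
  have h4 := abs_le.1 h2
  rw [abs_le]
  constructor <;> nlinarith [h3.1, h3.2, h4.1, h4.2]

end GapChain

end Mixing

/-! ### Moments of block sums given the past. -/

section Block

set_option linter.unusedSectionVars false

variable {S Ω : Type*} [MeasurableSpace S] [mΩ : MeasurableSpace Ω] {K : Kernel S S}
  {π : Measure S} {P : Measure Ω} {X : ℕ → Ω → S} {κ : ℝ} {g h : S → ℝ}
  [IsMarkovKernel K] [IsProbabilityMeasure π] [IsProbabilityMeasure P]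

/-- The sum of `h` over a block of `n` consecutive states of the chain, from time `s` on. -/
def blockSum (h : S → ℝ) (X : ℕ → Ω → S) (s n : ℕ) (ω : Ω) : ℝ :=
  ∑ i ∈ Finset.range n, h (X (s + i) ω)

/-- The boundary term in the martingale decomposition of a block sum. -/
def boundary (g : S → ℝ) (X : ℕ → Ω → S) (s n : ℕ) (ω : Ω) : ℝ := g (X s ω) - g (X (s + n) ω)

/-- The squared block sum, normalized by the length of the block and by the variance `v`. -/
def blockDev (h : S → ℝ) (X : ℕ → Ω → S) (v : ℝ) (s n : ℕ) (ω : Ω) : ℝ :=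
  blockSum h X s n ω ^ 2 / n - v

lemma measurable_blockSum (hh : Measurable h) (s n : ℕ) :
    Measurable[past X (s + n)] (blockSum h X s n) := by
  unfold blockSum
  refine Finset.measurable_fun_sum _ fun i hi ↦ hh.comp (measurable_past ?_)
  have := Finset.mem_range.1 hi
  lia

lemma measurable_blockDev (hh : Measurable h) (v : ℝ) (s n : ℕ) :
    Measurable[past X (s + n)] (blockDev h X v s n) :=
  (((measurable_blockSum hh s n).pow_const 2).div_const _).sub_const _

namespace GapChain

/-- Write h(X_i) = g(X_i) - Tg(X_i); adding and subtracting g(X_{i+1}) gives a martingale difference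
and a telescoping term. -/
lemma blockSum_eq (H : GapChain K π P X κ g) (hpois : ∀ᵐ x ∂π, g x - kernelOp K g x = h x)
    (s n : ℕ) :
    blockSum h X s n =ᵐ[P] fun ω ↦ msum K g X s n ω + boundary g X s n ω := by
  have hall : ∀ᵐ ω ∂P, ∀ i, g (X i ω) - kernelOp K g (X i ω) = h (X i ω) :=
    ae_all_iff.2 fun i ↦
      (measurePreserving_of_invariant H.chain H.inv i).quasiMeasurePreserving.ae hpois
  filter_upwards [hall] with ω hω
  induction n with
  | zero => simp [blockSum, msum, boundary]
  | succ n ih =>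
    have : blockSum h X s (n + 1) ω = blockSum h X s n ω + h (X (s + n) ω) := by
      simp [blockSum, Finset.sum_range_succ]
    rw [this, ih, msum_succ, ← hω, mdiff, boundary, boundary, ← add_assoc s n 1]
    ring

lemma memLp_boundary (H : GapChain K π P X κ g) (s n : ℕ) : MemLp (boundary g X s n) 8 P :=
  (memLp_comp H.chain H.inv H.memLp s).sub (memLp_comp H.chain H.inv H.memLp (s + n))

lemma lpNorm_boundary_le (H : GapChain K π P X κ g) (s n : ℕ) :
    lpNorm (boundary g X s n) 8 P ≤ 2 * lpNorm g 8 π := by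
  have h := lpNorm_sub_le (g := fun ω ↦ g (X (s + n) ω))
    (memLp_comp H.chain H.inv H.memLp s) (by norm_num)
  rw [lpNorm_comp H.chain H.inv H.memLp, lpNorm_comp H.chain H.inv H.memLp] at h
  exact h.trans (by linarith)

lemma integral_mul_msum (H : GapChain K π P X κ g) {s : ℕ} {A : Ω → ℝ}
    (hA : Measurable[past X s] A) (hA2 : MemLp A 2 P) (n : ℕ) :
    ∫ ω, A ω * msum K g X s n ω ∂P = 0 := by
  simp_rw [msum, Finset.mul_sum]
  rw [integral_finsetSum _ fun i _ ↦ integrable_mul_of_memLp_two hA2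
    ((H.memLp_mdiff (s + i)).mono_exponent (by norm_num))]
  exact Finset.sum_eq_zero fun i _ ↦
    H.integral_mul_mdiff_of_memLp (hA.mono (past_mono (by lia)) le_rfl) hA2

/-- The O(1) error is essential: it becomes the bias 1/b of a block, to be compared with 1/√a.
Bounding the cross terms by Cauchy–Schwarz would only give O(√n). -/
lemma exists_abs_integral_mul_blockSum_sq_le (H : GapChain K π P X κ g) :
    ∃ C : ℝ, 0 ≤ C ∧ ∀ (s : ℕ) (A : Ω → ℝ), Measurable[past X s] A → (∀ ω, |A ω| ≤ 1) → ∀ n : ℕ,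
      |∫ ω, A ω * (msum K g X s n ω + boundary g X s n ω) ^ 2 ∂P
        - n * martVar K π g * ∫ ω, A ω ∂P| ≤ C := by
  obtain ⟨C, hC, hM2⟩ := H.exists_abs_integral_mul_msum_sq_le
  have hκ : 0 < 1 - κ := by linarith [H.lt_one]
  have hg0 : 0 ≤ lpNorm g 8 π := lpNorm_nonneg
  have hg20 : 0 ≤ lpNorm g 2 π := lpNorm_nonneg
  refine ⟨C + 2 * (2 * lpNorm g 8 π * lpNorm g 2 π / (1 - κ))
    + 2 * lpNorm g 8 π * (2 * lpNorm g 8 π), by positivity, fun s A hA hA1 n ↦ ?_⟩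
  have hA' : AEStronglyMeasurable A P := (hA.mono (past_le H.chain s) le_rfl).aestronglyMeasurable
  have hM := H.memLp_msum s n
  have hR := H.memLp_boundary s n
  have hgs := memLp_comp H.chain H.inv H.memLp s
  have hge := memLp_comp H.chain H.inv H.memLp (s + n)
  have hg2 : MemLp g 2 π := H.memLp.mono_exponent (by norm_num)
  have i1 := integrable_mul_two hA' hA1 hM hM
  have i2 : Integrable (fun ω ↦ A ω * g (X s ω) * msum K g X s n ω) P := by
    simpa only [mul_assoc] using integrable_mul_two hA' hA1 hgs hM
  have i3 : Integrable (fun ω ↦ A ω * msum K g X s n ω * g (X (s + n) ω)) P := by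
    simpa only [mul_assoc] using integrable_mul_two hA' hA1 hM hge
  have i4 := integrable_mul_two hA' hA1 hR hR
  -- The initial boundary value belongs to the past at time s, so it is orthogonal to the
  -- martingale. The final one is handled by the peeling estimate.
  have e2 : ∫ ω, A ω * g (X s ω) * msum K g X s n ω ∂P = 0 :=
    H.integral_mul_msum (Measurable.mul hA (H.meas.comp (measurable_past le_rfl)))
      (memLp_bounded_mul hA' hA1 (hgs.mono_exponent (by norm_num))) n
  have b1 := hM2 s A hA hA1 n
  have b3 := H.abs_integral_mul_msum_mul_le hA hA1 H.meas hg2 H.mean_zero n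
  have b4 := abs_integral_mul_two_le hA' hA1 hR hR (H.lpNorm_boundary_le s n)
    (H.lpNorm_boundary_le s n)
  have hexp : ∫ ω, A ω * (msum K g X s n ω + boundary g X s n ω) ^ 2 ∂P
      = ∫ ω, A ω * (msum K g X s n ω * msum K g X s n ω) ∂P
        - 2 * ∫ ω, A ω * msum K g X s n ω * g (X (s + n) ω) ∂P
        + ∫ ω, A ω * (boundary g X s n ω * boundary g X s n ω) ∂P := by
    calc _ = ∫ ω, (A ω * (msum K g X s n ω * msum K g X s n ω)
          + 2 * (A ω * g (X s ω) * msum K g X s n ω)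
          - 2 * (A ω * msum K g X s n ω * g (X (s + n) ω))
          + A ω * (boundary g X s n ω * boundary g X s n ω)) ∂P := by
          congr 1; ext ω; rw [boundary]; ring
      _ = _ := by
          rw [integral_add (by fun_prop) i4, integral_sub (by fun_prop) (by fun_prop),
            integral_add i1 (by fun_prop), integral_const_mul, integral_const_mul, e2]
          ring
  rw [hexp]
  rw [abs_le] at *
  constructor <;> linarith [b1.1, b1.2, b3.1, b3.2, b4.1, b4.2]

/-- Here Hölder suffices for all terms with a boundary factor: the largest has three martingale
factors and is of order n^{3/2}, the size of the error already present. -/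
lemma exists_abs_integral_mul_blockSum_four_le (H : GapChain K π P X κ g) :
    ∃ C : ℝ, 0 ≤ C ∧ ∀ (s : ℕ) (A : Ω → ℝ), Measurable[past X s] A → (∀ ω, |A ω| ≤ 1) →
      ∀ n : ℕ, 1 ≤ n →
      |∫ ω, A ω * (msum K g X s n ω + boundary g X s n ω) ^ 4 ∂P
        - 3 * (n : ℝ) ^ 2 * martVar K π g ^ 2 * ∫ ω, A ω ∂P| ≤ C * (n * √(n : ℝ)) := by
  obtain ⟨C, hC, hM4⟩ := H.exists_abs_integral_mul_msum_four_le
  obtain ⟨B, hB, hMB⟩ := H.exists_lpNorm_msum_le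
  obtain ⟨d, hd⟩ : ∃ d, d = 2 * lpNorm g 8 π := ⟨_, rfl⟩
  have hd0 : 0 ≤ d := by have := lpNorm_nonneg (f := g) (p := 8) (μ := π); rw [hd]; positivity
  refine ⟨C + 4 * (B * B * (B * d)) + 6 * (B * B * (d * d)) + 4 * (B * d * (d * d))
    + d * d * (d * d), by positivity, fun s A hA hA1 n hn ↦ ?_⟩
  have hA' : AEStronglyMeasurable A P := (hA.mono (past_le H.chain s) le_rfl).aestronglyMeasurable
  have hM := H.memLp_msum s n
  have hR := H.memLp_boundary s n
  have bM := hMB s n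
  have bR : lpNorm (boundary g X s n) 8 P ≤ d := by rw [hd]; exact H.lpNorm_boundary_le s n
  have i1 := integrable_mul_four hA' hA1 hM hM hM hM
  have i2 := integrable_mul_four hA' hA1 hM hM hM hR
  have i3 := integrable_mul_four hA' hA1 hM hM hR hR
  have i4 := integrable_mul_four hA' hA1 hM hR hR hR
  have i5 := integrable_mul_four hA' hA1 hR hR hR hR
  have b1 := hM4 s A hA hA1 n hn
  have b2 := abs_integral_mul_four_le hA' hA1 hM hM hM hR bM bM bM bR
  have b3 := abs_integral_mul_four_le hA' hA1 hM hM hR hR bM bM bR bR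
  have b4 := abs_integral_mul_four_le hA' hA1 hM hR hR hR bM bR bR bR
  have b5 := abs_integral_mul_four_le hA' hA1 hR hR hR hR bR bR bR bR
  have hexp : ∫ ω, A ω * (msum K g X s n ω + boundary g X s n ω) ^ 4 ∂P
      = ∫ ω, A ω * (msum K g X s n ω * msum K g X s n ω
          * (msum K g X s n ω * msum K g X s n ω)) ∂P
        + 4 * ∫ ω, A ω * (msum K g X s n ω * msum K g X s n ω
          * (msum K g X s n ω * boundary g X s n ω)) ∂P
        + 6 * ∫ ω, A ω * (msum K g X s n ω * msum K g X s n ω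
          * (boundary g X s n ω * boundary g X s n ω)) ∂P
        + 4 * ∫ ω, A ω * (msum K g X s n ω * boundary g X s n ω
          * (boundary g X s n ω * boundary g X s n ω)) ∂P
        + ∫ ω, A ω * (boundary g X s n ω * boundary g X s n ω
          * (boundary g X s n ω * boundary g X s n ω)) ∂P := by
    rw [← integral_const_mul, ← integral_const_mul, ← integral_const_mul,
      ← integral_add i1 (by fun_prop), ← integral_add (by fun_prop) (by fun_prop),
      ← integral_add (by fun_prop) (by fun_prop), ← integral_add (by fun_prop) i5]
    congr 1; ext ω; ring
  rw [hexp]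
  obtain ⟨r, hr⟩ : ∃ r, r = √(n : ℝ) := ⟨_, rfl⟩
  have hr1 : 1 ≤ r := by rw [hr]; exact Real.one_le_sqrt.2 (by exact_mod_cast hn)
  have hrn : (n : ℝ) = r ^ 2 := by rw [hr, Real.sq_sqrt (by positivity)]
  rw [← hr, hrn] at b1 ⊢
  rw [← hr] at b2 b3 b4
  have hr3 : r ^ 2 * r = r ^ 3 := by ring
  rw [hr3] at b1 ⊢
  have k3 : r ^ 2 ≤ r ^ 3 := pow_le_pow_right₀ hr1 (by norm_num)
  have k4 : r ≤ r ^ 3 := le_self_pow₀ hr1 (by norm_num)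
  have k5 : 1 ≤ r ^ 3 := one_le_pow₀ hr1
  have c2 : B * r * (B * r) * (B * r * d) = B * B * (B * d) * r ^ 3 := by ring
  have c3 : B * r * (B * r) * (d * d) ≤ B * B * (d * d) * r ^ 3 := by
    calc _ = B * B * (d * d) * r ^ 2 := by ring
      _ ≤ _ := by gcongr
  have c4 : B * r * d * (d * d) ≤ B * d * (d * d) * r ^ 3 := by
    calc _ = B * d * (d * d) * r := by ring
      _ ≤ _ := by gcongr
  have c5 : d * d * (d * d) ≤ d * d * (d * d) * r ^ 3 := le_mul_of_one_le_right (by positivity) k5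
  rw [abs_le] at *
  constructor <;> linarith [b1.1, b1.2, b2.1, b2.2, b3.1, b3.2, b4.1, b4.2, b5.1, b5.2]

/-- Moments of the normalized squared block sums, conditionally on the past. -/
theorem exists_blockDev_bounds (H : GapChain K π P X κ g)
    (hpois : ∀ᵐ x ∂π, g x - kernelOp K g x = h x) :
    ∃ C : ℝ, 0 ≤ C ∧ ∀ s n : ℕ, 1 ≤ n →
      MemLp (blockDev h X (martVar K π g) s n) 4 P ∧
      lpNorm (blockDev h X (martVar K π g) s n) 4 P ≤ C ∧
      ∀ A : Ω → ℝ, Measurable[past X s] A → (∀ ω, |A ω| ≤ 1) →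
        |∫ ω, A ω * blockDev h X (martVar K π g) s n ω ∂P| ≤ C / n ∧
        |∫ ω, A ω * blockDev h X (martVar K π g) s n ω ^ 2 ∂P
          - 2 * martVar K π g ^ 2 * ∫ ω, A ω ∂P| ≤ C / √(n : ℝ) := by
  obtain ⟨C₂, hC₂, h2⟩ := H.exists_abs_integral_mul_blockSum_sq_le
  obtain ⟨C₄, hC₄, h4⟩ := H.exists_abs_integral_mul_blockSum_four_le
  obtain ⟨B, hB, hMB⟩ := H.exists_lpNorm_msum_le
  obtain ⟨d, hd⟩ : ∃ d, d = 2 * lpNorm g 8 π := ⟨_, rfl⟩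
  have hd0 : 0 ≤ d := by have := lpNorm_nonneg (f := g) (p := 8) (μ := π); rw [hd]; positivity
  obtain ⟨v, hv⟩ : ∃ v, v = martVar K π g := ⟨_, rfl⟩
  rw [← hv] at h2 h4 ⊢
  -- One constant dominating the three needed: (B + d)² + |v| for the L⁴ norm, C₂ for the mean, C₄ +
  -- 2|v|C₂ for the second moment.
  refine ⟨(B + d) ^ 2 + |v| + C₂ + (C₄ + 2 * |v| * C₂), by positivity, fun s n hn ↦ ?_⟩
  have hn0 : (0 : ℝ) < n := by exact_mod_cast hn
  obtain ⟨r, hr⟩ : ∃ r, r = √(n : ℝ) := ⟨_, rfl⟩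
  have hr1 : 1 ≤ r := by rw [hr]; exact Real.one_le_sqrt.2 (by exact_mod_cast hn)
  have hrn : (n : ℝ) = r ^ 2 := by rw [hr, Real.sq_sqrt (by positivity)]
  set W : Ω → ℝ := fun ω ↦ msum K g X s n ω + boundary g X s n ω with hW
  have hW8 : MemLp W 8 P := (H.memLp_msum s n).add (H.memLp_boundary s n)
  have hWn : lpNorm W 8 P ≤ (B + d) * r := by
    have h1 := lpNorm_add_le (g := boundary g X s n) (H.memLp_msum s n) (by norm_num)
    have h3 := hMB s n
    have h5 := H.lpNorm_boundary_le s n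
    rw [← hd] at h5
    rw [← hr] at h3
    refine h1.trans ?_
    have : d * 1 ≤ d * r := by gcongr
    linarith
  have hY : blockDev h X v s n =ᵐ[P] fun ω ↦ W ω ^ 2 / n - v := by
    filter_upwards [H.blockSum_eq hpois s n] with ω hω
    rw [blockDev, hω]
  have hW4 : MemLp (fun ω ↦ W ω ^ 2) 4 P := by simp_rw [sq]; exact memLp_mul hW8 hW8
  have hWd4 : MemLp (fun ω ↦ W ω ^ 2 / n) 4 P := by
    simpa only [div_eq_inv_mul] using hW4.const_mul (n : ℝ)⁻¹
  have hY4 : MemLp (fun ω ↦ W ω ^ 2 / n - v) 4 P := hWd4.sub (memLp_const _)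
  have hCpos : 0 ≤ C₂ + (C₄ + 2 * |v| * C₂) := by positivity
  refine ⟨hY4.ae_eq hY.symm, ?_, fun A hA hA1 ↦ ?_⟩
  · rw [lpNorm_congr_ae hY]
    have h1 := lpNorm_sub_le (g := fun _ ↦ v) hWd4 (by norm_num)
    rw [lpNorm_const_eq (by simp)] at h1
    have h3 : lpNorm (fun ω ↦ W ω ^ 2 / n) 4 P ≤ (B + d) ^ 2 := by
      have h5 : (fun ω ↦ W ω ^ 2 / n) = fun ω ↦ (n : ℝ)⁻¹ * W ω ^ 2 := by
        ext ω; rw [div_eq_inv_mul]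
      rw [h5, lpNorm_const_mul, lpNorm_sq (by simp) (by simp) hW8.1,
        show (2 : ℝ≥0∞) * 4 = 8 by norm_num, abs_of_nonneg (by positivity), hrn]
      calc (r ^ 2)⁻¹ * lpNorm W 8 P ^ 2 ≤ (r ^ 2)⁻¹ * ((B + d) * r) ^ 2 := by
            gcongr
            exact lpNorm_nonneg
        _ = (B + d) ^ 2 := by field_simp
    refine h1.trans ?_
    linarith
  · have hA' : AEStronglyMeasurable A P :=
      (hA.mono (past_le H.chain s) le_rfl).aestronglyMeasurable
    have iA : Integrable A P := (MemLp.of_bound hA' 1 (ae_of_all _ hA1) : MemLp A 1 P).integrable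
      le_rfl
    have i2 : Integrable (fun ω ↦ A ω * W ω ^ 2) P := by
      simp_rw [sq]; exact integrable_mul_two hA' hA1 hW8 hW8
    have i4 : Integrable (fun ω ↦ A ω * W ω ^ 4) P := by
      refine (integrable_mul_four hA' hA1 hW8 hW8 hW8 hW8).congr (ae_of_all _ fun ω ↦ ?_)
      ring
    have b2 := h2 s A hA hA1 n
    have b4 := h4 s A hA hA1 n hn
    rw [← hr, hrn] at b4
    rw [hrn] at b2
    have e1 : ∫ ω, A ω * blockDev h X v s n ω ∂P
        = (r ^ 2)⁻¹ * (∫ ω, A ω * W ω ^ 2 ∂P - r ^ 2 * v * ∫ ω, A ω ∂P) := by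
      have : ∫ ω, A ω * blockDev h X v s n ω ∂P
          = ∫ ω, ((r ^ 2)⁻¹ * (A ω * W ω ^ 2) - v * A ω) ∂P := by
        refine integral_congr_ae ?_
        filter_upwards [hY] with ω hω
        rw [hω, hrn]; ring
      rw [this, integral_sub (by fun_prop) (by fun_prop), integral_const_mul, integral_const_mul]
      field_simp
    -- Expanding (W²/n - v)², the leading terms are 3v² - 2v² + v² = 2v²; the right side consists of
    -- the two moment errors.
    have e2 : ∫ ω, A ω * blockDev h X v s n ω ^ 2 ∂P - 2 * v ^ 2 * ∫ ω, A ω ∂P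
        = (r ^ 4)⁻¹ * (∫ ω, A ω * W ω ^ 4 ∂P - 3 * (r ^ 2) ^ 2 * v ^ 2 * ∫ ω, A ω ∂P)
          - 2 * v * (r ^ 2)⁻¹ * (∫ ω, A ω * W ω ^ 2 ∂P - r ^ 2 * v * ∫ ω, A ω ∂P) := by
      have : ∫ ω, A ω * blockDev h X v s n ω ^ 2 ∂P
          = ∫ ω, ((r ^ 4)⁻¹ * (A ω * W ω ^ 4) - 2 * v * (r ^ 2)⁻¹ * (A ω * W ω ^ 2)
            + v ^ 2 * A ω) ∂P := by
        refine integral_congr_ae ?_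
        filter_upwards [hY] with ω hω
        rw [hω, hrn]
        field_simp
        ring
      rw [this, integral_add (by fun_prop) (by fun_prop), integral_sub (by fun_prop) (by fun_prop),
        integral_const_mul, integral_const_mul, integral_const_mul]
      field_simp
      ring
    rw [← hr, hrn, e1, e2]
    generalize ∫ ω, A ω * W ω ^ 2 ∂P - r ^ 2 * v * ∫ ω, A ω ∂P = I2 at b2 ⊢
    generalize ∫ ω, A ω * W ω ^ 4 ∂P - 3 * (r ^ 2) ^ 2 * v ^ 2 * ∫ ω, A ω ∂P = I4 at b4 ⊢
    have hpos : 0 ≤ (B + d) ^ 2 + |v| := by positivity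
    constructor
    · rw [abs_mul, abs_of_nonneg (by positivity), ← div_eq_inv_mul]
      gcongr
      have : 0 ≤ C₄ + 2 * |v| * C₂ := by positivity
      linarith
    · calc |(r ^ 4)⁻¹ * I4 - 2 * v * (r ^ 2)⁻¹ * I2|
          ≤ |(r ^ 4)⁻¹ * I4| + |2 * v * (r ^ 2)⁻¹ * I2| := abs_sub _ _
        _ = (r ^ 4)⁻¹ * |I4| + 2 * |v| * (r ^ 2)⁻¹ * |I2| := by
            rw [abs_mul, abs_mul, abs_mul, abs_mul, abs_two, abs_of_nonneg (a := (r ^ 4)⁻¹)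
              (by positivity), abs_of_nonneg (a := (r ^ 2)⁻¹) (by positivity)]
        _ ≤ (r ^ 4)⁻¹ * (C₄ * (r ^ 2 * r)) + 2 * |v| * (r ^ 2)⁻¹ * C₂ := by gcongr
        _ = C₄ / r + 2 * |v| * C₂ / (r * r) := by field_simp
        _ ≤ C₄ / r + 2 * |v| * C₂ / (r * 1) := by gcongr
        _ = (C₄ + 2 * |v| * C₂) / r := by rw [mul_one, add_div]
        _ ≤ _ := div_le_div_of_nonneg_right (by linarith) (by positivity)

end GapChain

end Block

/-! ### Taylor bounds for sine and cosine on the whole line. -/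

section Trigonometric

/-- Near zero this is Taylor's formula; for |z| ≥ 1 the cube dominates both terms. -/
lemma abs_sin_sub_le (z : ℝ) : |Real.sin z - z| ≤ 2 * |z| ^ 3 := by
  rcases le_total |z| 1 with hz | hz
  · have h1 := Real.sin_bound hz
    have h2 : |z| ^ 5 ≤ |z| ^ 3 := pow_le_pow_of_le_one (abs_nonneg _) hz (by norm_num)
    have h3 : |z ^ 3 / 6| = |z| ^ 3 / 6 := by rw [abs_div, abs_pow]; norm_num
    calc |Real.sin z - z| = |(Real.sin z - (z - z ^ 3 / 6)) - z ^ 3 / 6| := by ring_nf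
      _ ≤ |Real.sin z - (z - z ^ 3 / 6)| + |z ^ 3 / 6| := abs_sub _ _
      _ ≤ _ := by rw [h3]; linarith [pow_nonneg (abs_nonneg z) 3]
  · have h1 : |z| ≤ |z| ^ 3 := le_self_pow₀ hz (by norm_num)
    have h2 := Real.abs_sin_le_one z
    have h3 := abs_sub (Real.sin z) z
    linarith

lemma abs_cos_sub_le (z : ℝ) : |Real.cos z - (1 - z ^ 2 / 2)| ≤ 2 * |z| ^ 3 := by
  rcases le_total |z| 1 with hz | hz
  · have h1 := Real.cos_bound hz
    have h2 : |z| ^ 4 ≤ |z| ^ 3 := pow_le_pow_of_le_one (abs_nonneg _) hz (by norm_num)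
    linarith [pow_nonneg (abs_nonneg z) 3]
  · have h1 : |z| ^ 2 ≤ |z| ^ 3 := pow_le_pow_right₀ hz (by norm_num)
    have h2 := Real.one_sub_sq_div_two_le_cos (x := z)
    have h3 := Real.cos_le_one z
    rw [sq_abs] at h1
    rw [abs_of_nonneg (by linarith)]
    linarith [sq_nonneg z]

end Trigonometric

/-! ### Trigonometric moments of sums of nearly uncorrelated variables. -/

section Array

variable {Ω : Type*} [mΩ : MeasurableSpace Ω] {P : Measure Ω} [IsProbabilityMeasure P]

lemma integrable_of_abs_le_one {A : Ω → ℝ} (hA : AEStronglyMeasurable A P)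
    (hA1 : ∀ ω, |A ω| ≤ 1) : Integrable A P :=
  memLp_one_iff_integrable.1 (MemLp.of_bound hA 1 (ae_of_all _ hA1))

lemma integrable_abs_cube {Y : Ω → ℝ} (hY : MemLp Y 4 P) : Integrable (fun ω ↦ |Y ω| ^ 3) P := by
  refine (integrable_mul_of_memLp_two (hY.mono_exponent (by norm_num)).abs
    (memLp_mul hY hY : MemLp (fun ω ↦ Y ω * Y ω) 2 P)).congr (ae_of_all _ fun ω ↦ ?_)
  change |Y ω| * (Y ω * Y ω) = |Y ω| ^ 3
  rw [← abs_mul_abs_self (Y ω)]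
  ring

lemma integral_abs_cube_le {Y : Ω → ℝ} (hY : MemLp Y 4 P) :
    ∫ ω, |Y ω| ^ 3 ∂P ≤ lpNorm Y 4 P ^ 3 := by
  have hY2 : MemLp Y 2 P := hY.mono_exponent (by norm_num)
  have h1 := abs_integral_mul_le hY2.abs (memLp_mul hY hY : MemLp (fun ω ↦ Y ω * Y ω) 2 P)
  have h2 : lpNorm (fun ω ↦ |Y ω|) 2 P ≤ lpNorm Y 4 P := by
    rw [lpNorm_fun_abs hY.1]
    exact lpNorm_mono_exponent (by norm_num) hY
  have h3 : lpNorm (fun ω ↦ Y ω * Y ω) 2 P ≤ lpNorm Y 4 P * lpNorm Y 4 P := lpNorm_mul_le hY hY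
  have h4 : ∫ ω, |Y ω| ^ 3 ∂P = ∫ ω, |Y ω| * (Y ω * Y ω) ∂P := by
    congr 1; ext ω
    rw [← abs_mul_abs_self (Y ω)]
    ring
  rw [h4]
  refine (le_abs_self _).trans (h1.trans ?_)
  calc _ ≤ lpNorm Y 4 P * (lpNorm Y 4 P * lpNorm Y 4 P) :=
        mul_le_mul h2 h3 lpNorm_nonneg lpNorm_nonneg
    _ = _ := by ring

/-- The effect on a trigonometric moment of adding a summand whose first two moments, weighted by
`A` and `B`, are nearly `0` and `2 * v ^ 2`. -/
lemma abs_integral_trig_step_le {A B Y : Ω → ℝ} {C v τ ε δ : ℝ} (hA : AEStronglyMeasurable A P)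
    (hB : AEStronglyMeasurable B P) (hA1 : ∀ ω, |A ω| ≤ 1) (hB1 : ∀ ω, |B ω| ≤ 1)
    (hY : MemLp Y 4 P) (hYC : lpNorm Y 4 P ≤ C) (h1 : |∫ ω, B ω * Y ω ∂P| ≤ ε)
    (h2 : |∫ ω, A ω * Y ω ^ 2 ∂P - 2 * v ^ 2 * ∫ ω, A ω ∂P| ≤ δ) :
    |∫ ω, (A ω * Real.cos (τ * Y ω) - B ω * Real.sin (τ * Y ω)) ∂P
      - (1 - τ ^ 2 * v ^ 2) * ∫ ω, A ω ∂P| ≤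
      4 * C ^ 3 * |τ| ^ 3 + τ ^ 2 * δ + |τ| * ε := by
  have hY2 : MemLp Y 2 P := hY.mono_exponent (by norm_num)
  have hYm := hY.1
  have iA := integrable_of_abs_le_one hA hA1
  have iY3 := integrable_abs_cube hY
  have iBY : Integrable (fun ω ↦ B ω * Y ω) P :=
    (hY2.integrable (by norm_num)).bdd_mul hB (ae_of_all _ hB1)
  have iAY : Integrable (fun ω ↦ A ω * Y ω ^ 2) P :=
    hY2.integrable_sq.bdd_mul hA (ae_of_all _ hA1)
  have mc : AEStronglyMeasurable (fun ω ↦ Real.cos (τ * Y ω)) P :=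
    Real.continuous_cos.comp_aestronglyMeasurable (hYm.const_mul τ)
  have ms : AEStronglyMeasurable (fun ω ↦ Real.sin (τ * Y ω)) P :=
    Real.continuous_sin.comp_aestronglyMeasurable (hYm.const_mul τ)
  have ic : Integrable (fun ω ↦ A ω * Real.cos (τ * Y ω)) P :=
    (integrable_of_abs_le_one mc fun ω ↦ Real.abs_cos_le_one _).bdd_mul hA (ae_of_all _ hA1)
  have is : Integrable (fun ω ↦ B ω * Real.sin (τ * Y ω)) P :=
    (integrable_of_abs_le_one ms fun ω ↦ Real.abs_sin_le_one _).bdd_mul hB (ae_of_all _ hB1)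
  -- The Taylor remainder: second order for the cosine, first order for the sine, since the sine has
  -- no quadratic term. Only third absolute moments of Y enter its bound.
  set R : Ω → ℝ := fun ω ↦ A ω * (Real.cos (τ * Y ω) - (1 - (τ * Y ω) ^ 2 / 2))
    - B ω * (Real.sin (τ * Y ω) - τ * Y ω) with hR
  have hRle : |∫ ω, R ω ∂P| ≤ 4 * C ^ 3 * |τ| ^ 3 := by
    calc |∫ ω, R ω ∂P| ≤ ∫ ω, |R ω| ∂P := abs_integral_le_integral_abs
      _ ≤ ∫ ω, 4 * |τ| ^ 3 * |Y ω| ^ 3 ∂P := by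
        refine integral_mono_of_nonneg (ae_of_all _ fun _ ↦ abs_nonneg _) (iY3.const_mul _)
          (ae_of_all _ fun ω ↦ ?_)
        have k1 := abs_cos_sub_le (τ * Y ω)
        have k2 := abs_sin_sub_le (τ * Y ω)
        have k3 : |τ * Y ω| ^ 3 = |τ| ^ 3 * |Y ω| ^ 3 := by rw [abs_mul, mul_pow]
        have k4 := mul_le_mul (hA1 ω) k1 (abs_nonneg _) zero_le_one
        have k5 := mul_le_mul (hB1 ω) k2 (abs_nonneg _) zero_le_one
        refine (abs_sub _ _).trans ?_
        rw [abs_mul, abs_mul]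
        linarith
      _ = 4 * |τ| ^ 3 * ∫ ω, |Y ω| ^ 3 ∂P := integral_const_mul _ _
      _ ≤ 4 * |τ| ^ 3 * C ^ 3 := by
        gcongr
        exact (integral_abs_cube_le hY).trans (pow_le_pow_left₀ lpNorm_nonneg hYC 3)
      _ = _ := by ring
  have hexp : ∫ ω, R ω ∂P = ∫ ω, (A ω * Real.cos (τ * Y ω) - B ω * Real.sin (τ * Y ω)) ∂P
      - ∫ ω, A ω ∂P + τ ^ 2 / 2 * ∫ ω, A ω * Y ω ^ 2 ∂P + τ * ∫ ω, B ω * Y ω ∂P := by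
    rw [← integral_const_mul, ← integral_const_mul, ← integral_sub (by fun_prop) (by fun_prop),
      ← integral_add (by fun_prop) (by fun_prop), ← integral_add (by fun_prop) (by fun_prop)]
    congr 1; ext ω
    simp only [hR]
    ring
  generalize ∫ ω, R ω ∂P = r at *
  generalize ∫ ω, (A ω * Real.cos (τ * Y ω) - B ω * Real.sin (τ * Y ω)) ∂P = c at *
  generalize ∫ ω, A ω ∂P = α at *
  generalize ∫ ω, A ω * Y ω ^ 2 ∂P = β at *
  generalize ∫ ω, B ω * Y ω ∂P = γ at *
  have e : c - (1 - τ ^ 2 * v ^ 2) * α = r - τ ^ 2 / 2 * (β - 2 * v ^ 2 * α) - τ * γ := by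
    rw [hexp]; ring
  have hδ : 0 ≤ δ := (abs_nonneg _).trans h2
  rw [e]
  calc _ ≤ |r| + |τ ^ 2 / 2 * (β - 2 * v ^ 2 * α)| + |τ * γ| :=
        (abs_sub _ _).trans (add_le_add_left (abs_sub _ _) _)
    _ = |r| + τ ^ 2 / 2 * |β - 2 * v ^ 2 * α| + |τ| * |γ| := by
        rw [abs_mul, abs_mul, abs_of_nonneg (by positivity : 0 ≤ τ ^ 2 / 2)]
    _ ≤ 4 * C ^ 3 * |τ| ^ 3 + τ ^ 2 / 2 * δ + |τ| * ε := by gcongr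
    _ ≤ _ := by nlinarith [mul_nonneg (sq_nonneg τ) hδ]

/-- Trigonometric moments of a sum of nearly uncorrelated summands with nearly constant conditional
variance. -/
lemma abs_integral_trig_sum_le {F : ℕ → MeasurableSpace Ω} (hF : Monotone F) (hle : ∀ k, F k ≤ mΩ)
    {Y : ℕ → Ω → ℝ} (hYF : ∀ k, Measurable[F (k + 1)] (Y k)) {C v τ ε δ : ℝ}
    (hY : ∀ k, MemLp (Y k) 4 P) (hYC : ∀ k, lpNorm (Y k) 4 P ≤ C)
    (h1 : ∀ k, ∀ A : Ω → ℝ, Measurable[F k] A → (∀ ω, |A ω| ≤ 1) → |∫ ω, A ω * Y k ω ∂P| ≤ ε)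
    (h2 : ∀ k, ∀ A : Ω → ℝ, Measurable[F k] A → (∀ ω, |A ω| ≤ 1) →
      |∫ ω, A ω * Y k ω ^ 2 ∂P - 2 * v ^ 2 * ∫ ω, A ω ∂P| ≤ δ)
    (hq : |1 - τ ^ 2 * v ^ 2| ≤ 1) (k : ℕ) :
    |∫ ω, Real.cos (τ * ∑ j ∈ Finset.range k, Y j ω) ∂P - (1 - τ ^ 2 * v ^ 2) ^ k| ≤
        k * (4 * C ^ 3 * |τ| ^ 3 + τ ^ 2 * δ + |τ| * ε) ∧
      |∫ ω, Real.sin (τ * ∑ j ∈ Finset.range k, Y j ω) ∂P| ≤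
        k * (4 * C ^ 3 * |τ| ^ 3 + τ ^ 2 * δ + |τ| * ε) := by
  have hS (k : ℕ) : Measurable[F k] fun ω ↦ τ * ∑ j ∈ Finset.range k, Y j ω := by
    refine Measurable.const_mul (Finset.measurable_fun_sum _ fun j hj ↦ ?_) τ
    exact (hYF j).mono (hF (Nat.succ_le_of_lt (Finset.mem_range.1 hj))) le_rfl
  set η := 4 * C ^ 3 * |τ| ^ 3 + τ ^ 2 * δ + |τ| * ε with hη
  set q := 1 - τ ^ 2 * v ^ 2 with hqdef
  induction k with
  | zero => simp
  | succ k ih =>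
    set T : Ω → ℝ := fun ω ↦ τ * ∑ j ∈ Finset.range k, Y j ω with hT
    have hTm : Measurable[F k] T := hS k
    have mcos : Measurable[F k] fun ω ↦ Real.cos (T ω) := Real.measurable_cos.comp hTm
    have msin : Measurable[F k] fun ω ↦ Real.sin (T ω) := Real.measurable_sin.comp hTm
    have mncos : Measurable[F k] fun ω ↦ -Real.cos (T ω) := mcos.neg
    have acos := (mcos.mono (hle k) le_rfl).aestronglyMeasurable (μ := P)
    have asin := (msin.mono (hle k) le_rfl).aestronglyMeasurable (μ := P)
    have ancos := (mncos.mono (hle k) le_rfl).aestronglyMeasurable (μ := P)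
    have bcos (ω : Ω) : |Real.cos (T ω)| ≤ 1 := Real.abs_cos_le_one _
    have bsin (ω : Ω) : |Real.sin (T ω)| ≤ 1 := Real.abs_sin_le_one _
    have bncos (ω : Ω) : |-Real.cos (T ω)| ≤ 1 := by rw [abs_neg]; exact bcos ω
    -- The addition formulas fit one scheme: the weights are (cos T, sin T) for the cosine and (sin
    -- T, -cos T) for the sine.
    have s1 := abs_integral_trig_step_le (τ := τ) acos asin bcos bsin (hY k) (hYC k)
      (h1 k _ msin bsin) (h2 k _ mcos bcos)
    have s2 := abs_integral_trig_step_le (τ := τ) asin ancos bsin bncos (hY k) (hYC k)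
      (h1 k _ mncos bncos) (h2 k _ msin bsin)
    have e1 : ∀ ω, Real.cos (τ * ∑ j ∈ Finset.range (k + 1), Y j ω)
        = Real.cos (T ω) * Real.cos (τ * Y k ω) - Real.sin (T ω) * Real.sin (τ * Y k ω) := by
      intro ω
      rw [Finset.sum_range_succ, mul_add, Real.cos_add]
    have e2 : ∀ ω, Real.sin (τ * ∑ j ∈ Finset.range (k + 1), Y j ω)
        = Real.sin (T ω) * Real.cos (τ * Y k ω) - -Real.cos (T ω) * Real.sin (τ * Y k ω) := by
      intro ω
      rw [Finset.sum_range_succ, mul_add, Real.sin_add]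
      ring
    simp_rw [e1, e2]
    rw [← hη, ← hqdef] at s1 s2
    -- As |q| ≤ 1, earlier errors are not amplified, so k steps accumulate at most k η.
    have key : ∀ x y z : ℝ, |x - q * y| ≤ η → |y - z| ≤ k * η →
        |x - q * z| ≤ ((k + 1 : ℕ) : ℝ) * η := by
      intro x y z hx hy
      calc |x - q * z| = |(x - q * y) + q * (y - z)| := by ring_nf
        _ ≤ |x - q * y| + |q * (y - z)| := abs_add_le _ _
        _ ≤ η + 1 * (k * η) := by
          rw [abs_mul]
          gcongr
        _ = _ := by push_cast; ring
    refine ⟨?_, ?_⟩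
    · rw [pow_succ, mul_comm]
      exact key _ _ _ s1 ih.1
    · simpa using key _ _ 0 s2 (by simpa using ih.2)

/-- Convergence to a centered Gaussian law from the convergence of the real and imaginary parts of
the characteristic functions. -/
lemma tendstoInDistribution_gaussianReal_of_trig {T : ℕ → Ω → ℝ} (hT : ∀ n, Measurable (T n))
    {w : ℝ} (hw : 0 ≤ w)
    (hcos : ∀ t : ℝ, Tendsto (fun n ↦ ∫ ω, Real.cos (t * T n ω) ∂P) atTop
      (𝓝 (Real.exp (-(w * t ^ 2 / 2)))))
    (hsin : ∀ t : ℝ, Tendsto (fun n ↦ ∫ ω, Real.sin (t * T n ω) ∂P) atTop (𝓝 0)) :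
    TendstoInDistribution T atTop id (fun _ ↦ P) (gaussianReal 0 w.toNNReal) where
  forall_aemeasurable n := (hT n).aemeasurable
  tendsto := by
    refine ProbabilityMeasure.tendsto_iff_tendsto_charFun.2 fun t ↦ ?_
    simp only [ProbabilityMeasure.coe_mk, Measure.map_id]
    have h1 (n : ℕ) : charFun (P.map (T n)) t
        = (∫ ω, Real.cos (t * T n ω) ∂P : ℝ) + (∫ ω, Real.sin (t * T n ω) ∂P : ℝ) * Complex.I := by
      have ic : Integrable (fun ω ↦ Real.cos (t * T n ω)) P :=
        integrable_of_abs_le_one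
          (Real.measurable_cos.comp ((hT n).const_mul t)).aestronglyMeasurable
          fun ω ↦ Real.abs_cos_le_one _
      have is : Integrable (fun ω ↦ Real.sin (t * T n ω)) P :=
        integrable_of_abs_le_one
          (Real.measurable_sin.comp ((hT n).const_mul t)).aestronglyMeasurable
          fun ω ↦ Real.abs_sin_le_one _
      rw [charFun_apply_real, integral_map (hT n).aemeasurable (by fun_prop),
        ← integral_complex_ofReal, ← integral_complex_ofReal, ← integral_mul_const,
        ← integral_add ic.ofReal (is.ofReal.mul_const _)]
      congr 1; ext ω
      rw [← Complex.ofReal_mul, Complex.exp_mul_I, Complex.ofReal_cos, Complex.ofReal_sin]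
    have h2 : charFun (gaussianReal 0 w.toNNReal) t
        = (Real.exp (-(w * t ^ 2 / 2)) : ℝ) + ((0 : ℝ) : ℂ) * Complex.I := by
      rw [charFun_gaussianReal, Real.coe_toNNReal _ hw]
      push_cast
      ring_nf
    rw [h2]
    simp_rw [h1]
    exact ((Complex.continuous_ofReal.tendsto _).comp (hcos t)).add
      (((Complex.continuous_ofReal.tendsto _).comp (hsin t)).mul_const _)

end Array

/-! ### Central limit theorem for the squared block sums. -/

section CLT

set_option linter.unusedSectionVars false

variable {S Ω : Type*} [MeasurableSpace S] [mΩ : MeasurableSpace Ω] {K : Kernel S S}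
  {π : Measure S} {P : Measure Ω} {X : ℕ → Ω → S} {κ : ℝ} {g h : S → ℝ}
  [IsMarkovKernel K] [IsProbabilityMeasure π] [IsProbabilityMeasure P]

/-- The normalized sum of the deviations of the squared sums over `a` consecutive blocks of length
`b`. -/
def devSum (h : S → ℝ) (X : ℕ → Ω → S) (v : ℝ) (a b : ℕ) (ω : Ω) : ℝ :=
  (√(a : ℝ))⁻¹ * ∑ k ∈ Finset.range a, blockDev h X v (k * b) b ω

lemma measurable_devSum (hX : IsMarkovChain K π P X) (hh : Measurable h) (v : ℝ) (a b : ℕ) :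
    Measurable (devSum h X v a b) :=
  (Finset.measurable_fun_sum _ fun k _ ↦
    (measurable_blockDev hh v (k * b) b).mono (past_le hX _) le_rfl).const_mul _

/-- The central limit theorem for the squared block sums. -/
theorem GapChain.tendstoInDistribution_devSum (H : GapChain K π P X κ g) (hh : Measurable h)
    (hpois : ∀ᵐ x ∂π, g x - kernelOp K g x = h x) {a b : ℕ → ℕ} (ha : Tendsto a atTop atTop)
    (hb : Tendsto b atTop atTop)
    (hab : Tendsto (fun n ↦ √(a n : ℝ) / (b n : ℝ)) atTop (𝓝 0)) :
    TendstoInDistribution (fun n ↦ devSum h X (martVar K π g) (a n) (b n)) atTop id (fun _ ↦ P)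
      (gaussianReal 0 (2 * martVar K π g ^ 2).toNNReal) := by
  obtain ⟨C, hC, hbd⟩ := H.exists_blockDev_bounds hpois
  obtain ⟨v, hv⟩ : ∃ v, v = martVar K π g := ⟨_, rfl⟩
  rw [← hv] at hbd ⊢
  have ha' : Tendsto (fun n ↦ √(a n : ℝ)) atTop atTop :=
    Real.tendsto_sqrt_atTop.comp (tendsto_natCast_atTop_atTop.comp ha)
  have hb' : Tendsto (fun n ↦ √(b n : ℝ)) atTop atTop :=
    Real.tendsto_sqrt_atTop.comp (tendsto_natCast_atTop_atTop.comp hb)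
  have main (t : ℝ) : ∀ᶠ n in atTop,
      |∫ ω, Real.cos (t * devSum h X v (a n) (b n) ω) ∂P - (1 + -(v ^ 2 * t ^ 2) / a n) ^ (a n)| ≤
        4 * C ^ 3 * |t| ^ 3 * (√(a n : ℝ))⁻¹ + t ^ 2 * C * (√(b n : ℝ))⁻¹
          + |t| * C * (√(a n : ℝ) / (b n : ℝ)) ∧
      |∫ ω, Real.sin (t * devSum h X v (a n) (b n) ω) ∂P| ≤
        4 * C ^ 3 * |t| ^ 3 * (√(a n : ℝ))⁻¹ + t ^ 2 * C * (√(b n : ℝ))⁻¹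
          + |t| * C * (√(a n : ℝ) / (b n : ℝ)) := by
    -- This makes 1 - v²t²/a lie between 0 and 1, as required for errors not to be amplified.
    have hsm : ∀ᶠ n in atTop, v ^ 2 * t ^ 2 ≤ a n :=
      (tendsto_natCast_atTop_atTop.comp ha).eventually_ge_atTop _
    filter_upwards [hsm, ha.eventually_ge_atTop 1, hb.eventually_ge_atTop 1] with n hn han hbn
    obtain ⟨r, hr⟩ : ∃ r, r = √(a n : ℝ) := ⟨_, rfl⟩
    have hr1 : 1 ≤ r := by rw [hr]; exact Real.one_le_sqrt.2 (by exact_mod_cast han)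
    have hrn : (a n : ℝ) = r ^ 2 := by rw [hr, Real.sq_sqrt (by positivity)]
    have hq : 1 - (t * r⁻¹) ^ 2 * v ^ 2 = 1 + -(v ^ 2 * t ^ 2) / a n := by
      rw [hrn]; field_simp; ring
    have hq1 : |1 - (t * r⁻¹) ^ 2 * v ^ 2| ≤ 1 := by
      have h1 : v ^ 2 * t ^ 2 / a n ≤ 1 := div_le_one_of_le₀ hn (by positivity)
      have h2 : 0 ≤ v ^ 2 * t ^ 2 / a n := by positivity
      rw [hq, neg_div, abs_le]
      constructor <;> linarith
    -- The filtration is sampled at the block starts k b. The past then contains the first state of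
    -- block k, which the block estimates allow.
    have hmain := abs_integral_trig_sum_le (P := P) (F := fun k ↦ past X (k * b n))
      (fun i j hij ↦ past_mono (Nat.mul_le_mul_right _ hij)) (fun k ↦ past_le H.chain _)
      (Y := fun k ↦ blockDev h X v (k * b n) (b n))
      (fun k ↦ by
        have := measurable_blockDev (X := X) hh v (k * b n) (b n)
        rwa [← Nat.succ_mul] at this)
      (fun k ↦ (hbd (k * b n) (b n) hbn).1) (fun k ↦ (hbd (k * b n) (b n) hbn).2.1)
      (fun k A hA hA1 ↦ ((hbd (k * b n) (b n) hbn).2.2 A hA hA1).1)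
      (fun k A hA hA1 ↦ ((hbd (k * b n) (b n) hbn).2.2 A hA hA1).2) hq1 (a n)
    have hT (ω : Ω) : t * r⁻¹ * ∑ k ∈ Finset.range (a n), blockDev h X v (k * b n) (b n) ω
        = t * devSum h X v (a n) (b n) ω := by
      rw [devSum, ← hr, mul_assoc]
    simp_rw [hT] at hmain
    rw [hq] at hmain
    -- With τ = t/√a, the cubic, variance and bias errors summed over a blocks become a^{-1/2},
    -- b^{-1/2} and √a/b.
    have hη : (a n : ℝ) * (4 * C ^ 3 * |t * r⁻¹| ^ 3 + (t * r⁻¹) ^ 2 * (C / √(b n : ℝ))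
        + |t * r⁻¹| * (C / b n)) = 4 * C ^ 3 * |t| ^ 3 * r⁻¹ + t ^ 2 * C * (√(b n : ℝ))⁻¹
          + |t| * C * (r / (b n : ℝ)) := by
      rw [abs_mul, abs_of_nonneg (a := r⁻¹) (by positivity), hrn]
      field_simp
    rw [hη] at hmain
    rw [← hr]
    exact hmain
  have hlim (t : ℝ) : Tendsto (fun n ↦ 4 * C ^ 3 * |t| ^ 3 * (√(a n : ℝ))⁻¹
      + t ^ 2 * C * (√(b n : ℝ))⁻¹ + |t| * C * (√(a n : ℝ) / (b n : ℝ))) atTop (𝓝 0) := by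
    simpa using ((ha'.inv_tendsto_atTop.const_mul (4 * C ^ 3 * |t| ^ 3)).add
      (hb'.inv_tendsto_atTop.const_mul (t ^ 2 * C))).add (hab.const_mul (|t| * C))
  refine tendstoInDistribution_gaussianReal_of_trig (fun n ↦ measurable_devSum H.chain hh v _ _)
    (by positivity) (fun t ↦ ?_) (fun t ↦ ?_)
  · have h1 := squeeze_zero_norm' (f := fun n ↦ ∫ ω, Real.cos (t * devSum h X v (a n) (b n) ω) ∂P
      - (1 + -(v ^ 2 * t ^ 2) / a n) ^ (a n)) ((main t).mono fun n hn ↦ hn.1) (hlim t)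
    have h2 := (Real.tendsto_one_add_div_pow_exp (-(v ^ 2 * t ^ 2))).comp ha
    have h3 := h1.add h2
    simp only [Function.comp_def, sub_add_cancel, zero_add] at h3
    convert h3 using 3
    ring
  · exact squeeze_zero_norm' ((main t).mono fun n hn ↦ hn.2) (hlim t)

end CLT

/-! ### Identification of the limiting variance. -/

section Variance

set_option linter.unusedSectionVars false

variable {S Ω : Type*} [MeasurableSpace S] [mΩ : MeasurableSpace Ω] {K : Kernel S S}
  {π : Measure S} {P : Measure Ω} {X : ℕ → Ω → S} {κ : ℝ} {f g h : S → ℝ}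
  [IsMarkovKernel K] [IsProbabilityMeasure π] [IsProbabilityMeasure P]

lemma autocov_eq (hX : IsMarkovChain K π P X) (hinv : Kernel.Invariant K π) (hf : Measurable f)
    (hf2 : MemLp f 2 π) (hh : h = fun x ↦ f x - ∫ y, f y ∂π) (i : ℕ) :
    autocov P X f i = ∫ x, h x * (kernelOp K)^[i] h x ∂π := by
  have hhm : Measurable h := by rw [hh]; exact hf.sub_const _
  have hh2 : MemLp h 2 π := by rw [hh]; exact hf2.sub (memLp_const _)
  have hmean (n : ℕ) : ∫ ω, f (X n ω) ∂P = ∫ y, f y ∂π := by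
    rw [← (hasLaw_of_invariant hX hinv n).map_eq,
      integral_map (hX.measurable n).aemeasurable hf.aestronglyMeasurable]
  have h1 : autocov P X f i = ∫ ω, h (X 0 ω) * h (X (0 + i) ω) ∂P := by
    simp only [autocov, covariance, hmean, hh, zero_add]
  rw [h1, integral_mul_comp_add hX hinv (A := fun ω ↦ h (X 0 ω))
    (hhm.comp (measurable_past le_rfl)) (memLp_comp hX hinv hh2 0) hhm hh2,
    ← (hasLaw_of_invariant hX hinv 0).map_eq]
  exact (integral_map (hX.measurable 0).aemeasurable
    (hhm.mul (measurable_kernelOp_iterate hhm i)).aestronglyMeasurable).symm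

lemma abs_integral_mul_iterate_le (hinv : Kernel.Invariant K π) (hdec : GeometricDecay K π 2 1 κ)
    (hh : MemLp h 2 π) (hgm : Measurable g) (hg : MemLp g 2 π)
    (hg0 : ∫ x, g x ∂π = 0) (i : ℕ) :
    |∫ x, h x * (kernelOp K)^[i] g x ∂π| ≤ lpNorm h 2 π * lpNorm g 2 π * κ ^ i := by
  refine (abs_integral_mul_le hh
    (memLp_kernelOp_iterate hinv (by norm_num) (by simp) hgm hg i)).trans ?_
  calc _ ≤ lpNorm h 2 π * (1 * κ ^ i * lpNorm g 2 π) :=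
        mul_le_mul_of_nonneg_left (hdec g hgm hg hg0 i) lpNorm_nonneg
    _ = _ := by ring

lemma summable_integral_mul_iterate (hinv : Kernel.Invariant K π)
    (hdec : GeometricDecay K π 2 1 κ) (hκ : 0 < κ) (hκ1 : κ < 1) (hhm : Measurable h)
    (hh : MemLp h 2 π) (hh0 : ∫ x, h x ∂π = 0) :
    Summable fun i : ℕ ↦ ∫ x, h x * (kernelOp K)^[i + 1] h x ∂π := by
  refine .of_norm_bounded (g := fun i ↦ lpNorm h 2 π * lpNorm h 2 π * κ ^ (i + 1)) ?_
    fun i ↦ abs_integral_mul_iterate_le hinv hdec hh hhm hh hh0 (i + 1)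
  exact ((summable_nat_add_iff 1).2 (summable_geometric_of_lt_one hκ.le hκ1)).mul_left _

/-- The sum of the autocovariances through the solution `g` of the Poisson equation. -/
lemma tsum_integral_mul_iterate (hinv : Kernel.Invariant K π)
    (hdec : GeometricDecay K π 2 1 κ) (hκ : 0 < κ) (hκ1 : κ < 1) (hhm : Measurable h)
    (hh : MemLp h 2 π) (hh0 : ∫ x, h x ∂π = 0) (hgm : Measurable g) (hg : MemLp g 2 π)
    (hg0 : ∫ x, g x ∂π = 0) (hpois : ∀ᵐ x ∂π, g x - kernelOp K g x = h x) :
    ∑' i : ℕ, ∫ x, h x * (kernelOp K)^[i + 1] h x ∂π = ∫ x, h x * kernelOp K g x ∂π := by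
  have hL (i : ℕ) : MemLp ((kernelOp K)^[i] g) 2 π :=
    memLp_kernelOp_iterate hinv (by norm_num) (by simp) hgm hg i
  -- Substituting h = g - Tg in the second factor makes the series telescope; the remainder ⟨h,
  -- T^{n+1} g⟩ vanishes by geometric decay.
  have hterm (i : ℕ) : ∫ x, h x * (kernelOp K)^[i] h x ∂π
      = ∫ x, h x * (kernelOp K)^[i] g x ∂π - ∫ x, h x * (kernelOp K)^[i + 1] g x ∂π := by
    have h1 : (kernelOp K)^[i] h =ᵐ[π]
        fun x ↦ (kernelOp K)^[i] g x - (kernelOp K)^[i + 1] g x := by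
      have h2 : h =ᵐ[π] fun x ↦ g x - kernelOp K g x := hpois.mono fun x hx ↦ hx.symm
      exact (kernelOp_iterate_congr_ae hinv h2 i).trans
        (kernelOp_iterate_sub hinv hgm (measurable_kernelOp hgm) (hg.integrable (by norm_num))
          ((hL 1).integrable (by norm_num)) i)
    rw [← integral_sub (integrable_mul_of_memLp_two hh (hL i))
      (integrable_mul_of_memLp_two hh (hL (i + 1)))]
    refine integral_congr_ae ?_
    filter_upwards [h1] with x hx
    rw [hx]; ring
  have hsum := summable_integral_mul_iterate hinv hdec hκ hκ1 hhm hh hh0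
  refine tendsto_nhds_unique hsum.hasSum.tendsto_sum_nat ?_
  have hpart (n : ℕ) : ∑ i ∈ Finset.range n, ∫ x, h x * (kernelOp K)^[i + 1] h x ∂π
      = ∫ x, h x * kernelOp K g x ∂π - ∫ x, h x * (kernelOp K)^[n + 1] g x ∂π := by
    simp_rw [hterm]
    exact Finset.sum_range_sub' (fun i ↦ ∫ x, h x * (kernelOp K)^[i + 1] g x ∂π) n
  simp_rw [hpart]
  have h0 : Tendsto (fun n : ℕ ↦ ∫ x, h x * (kernelOp K)^[n + 1] g x ∂π) atTop (𝓝 0) := by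
    refine squeeze_zero_norm
      (fun n ↦ abs_integral_mul_iterate_le hinv hdec hh hgm hg hg0 (n + 1)) ?_
    simpa using ((tendsto_add_atTop_iff_nat 1).2
      (tendsto_pow_atTop_nhds_zero_of_lt_one hκ.le hκ1)).const_mul (lpNorm h 2 π * lpNorm g 2 π)
  simpa using h0.const_sub (∫ x, h x * kernelOp K g x ∂π)

/-- By invariance the mean of the conditional variance is ∫ g² - (Tg)², which factors as ∫ (g -
Tg)(g + Tg) = ∫ h (h + 2Tg). -/
lemma martVar_eq (hinv : Kernel.Invariant K π) (hgm : Measurable g) (hg : MemLp g 2 π)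
    (hh : MemLp h 2 π) (hpois : ∀ᵐ x ∂π, g x - kernelOp K g x = h x) :
    martVar K π g = ∫ x, h x * h x ∂π + 2 * ∫ x, h x * kernelOp K g x ∂π := by
  have hT : MemLp (kernelOp K g) 2 π := memLp_kernelOp hinv (by norm_num) (by simp) hgm hg
  have hg2 : Integrable (fun x ↦ g x ^ 2) π := hg.integrable_sq
  have hT2 : Integrable (fun x ↦ kernelOp K g x ^ 2) π := hT.integrable_sq
  have hTg2 : Integrable (kernelOp K fun x ↦ g x ^ 2) π :=
    integrable_kernelOp_iterate hinv (hgm.pow_const 2) hg2 1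
  have hhh := integrable_mul_of_memLp_two hh hh
  have hhT := integrable_mul_of_memLp_two hh hT
  simp only [martVar, condVar]
  rw [integral_sub hTg2 hT2, integral_kernelOp hinv hg2, ← integral_sub hg2 hT2,
    ← integral_const_mul, ← integral_add hhh (hhT.const_mul 2)]
  refine integral_congr_ae ?_
  filter_upwards [hpois] with x hx
  rw [← hx]; ring

end Variance

/-! ### Algebra of the batch means estimator. -/

section Estimator

variable {S Ω : Type*}

lemma sum_blockSum (h : S → ℝ) (X : ℕ → Ω → S) (a b : ℕ) (ω : Ω) :
    ∑ k ∈ Finset.range a, blockSum h X (k * b) b ω = blockSum h X 0 (a * b) ω := by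
  induction a with
  | zero => simp [blockSum]
  | succ a ih =>
    rw [Finset.sum_range_succ, ih, Nat.succ_mul]
    simp [blockSum, Finset.sum_range_add]

lemma batchMean_eq (f : S → ℝ) (X : ℕ → Ω → S) (m : ℝ) {b : ℕ} (hb : 1 ≤ b) (k : ℕ) (ω : Ω) :
    batchMean (fun i ↦ f (X i ω)) b k
      = blockSum (fun x ↦ f x - m) X (k * b) b ω / b + m := by
  have hb0 : (b : ℝ) ≠ 0 := by positivity
  simp only [batchMean, blockSum, Finset.sum_sub_distrib, Finset.sum_const, Finset.card_range,
    nsmul_eq_mul]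
  field_simp
  ring

lemma overallMean_eq (f : S → ℝ) (X : ℕ → Ω → S) (m : ℝ) {a b : ℕ} (ha : 1 ≤ a) (hb : 1 ≤ b)
    (ω : Ω) :
    overallMean (fun i ↦ f (X i ω)) a b
      = blockSum (fun x ↦ f x - m) X 0 (a * b) ω / (a * b) + m := by
  have ha0 : (a : ℝ) ≠ 0 := by positivity
  have hb0 : (b : ℝ) ≠ 0 := by positivity
  simp only [overallMean, batchMean_eq f X m hb, Finset.sum_add_distrib, ← Finset.sum_div,
    sum_blockSum, Finset.sum_const, Finset.card_range, nsmul_eq_mul]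
  field_simp

/-- The estimator through squared block sums of the centered function. -/
lemma bmEstimator_eq (f : S → ℝ) (X : ℕ → Ω → S) (m : ℝ) {a b : ℕ} (ha : 2 ≤ a) (hb : 1 ≤ b)
    (ω : Ω) :
    bmEstimator (fun i ↦ f (X i ω)) a b
      = (∑ k ∈ Finset.range a, blockSum (fun x ↦ f x - m) X (k * b) b ω ^ 2 / b
        - blockSum (fun x ↦ f x - m) X 0 (a * b) ω ^ 2 / (a * b)) / (a - 1) := by
  have ha0 : (a : ℝ) ≠ 0 := by positivity
  have hb0 : (b : ℝ) ≠ 0 := by positivity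
  have ha1 : (a : ℝ) - 1 ≠ 0 := by
    have : (2 : ℝ) ≤ a := by exact_mod_cast ha
    linarith
  simp only [bmEstimator, batchMean_eq f X m hb, overallMean_eq f X m (one_le_two.trans ha) hb]
  have hs := sum_blockSum (fun x ↦ f x - m) X a b ω
  generalize blockSum (fun x ↦ f x - m) X 0 (a * b) ω = W at *
  have h1 (k : ℕ) : (blockSum (fun x ↦ f x - m) X (k * b) b ω / b + m - (W / (a * b) + m)) ^ 2
      = blockSum (fun x ↦ f x - m) X (k * b) b ω ^ 2 / b / b
        - 2 * W / (a * b * b) * blockSum (fun x ↦ f x - m) X (k * b) b ω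
        + (W / (a * b)) ^ 2 := by
    field_simp; ring
  simp_rw [h1]
  rw [Finset.sum_add_distrib, Finset.sum_sub_distrib, ← Finset.mul_sum, hs, Finset.sum_const,
    Finset.card_range, nsmul_eq_mul, ← Finset.sum_div]
  field_simp
  ring

/-- Two corrections are gathered here: the normalization a - 1 instead of a, and the overall mean.
The latter is the deviation of the whole run, seen as a single block of length a b, so the same
block estimates control it. -/
lemma sqrt_mul_bmEstimator_sub (f : S → ℝ) (X : ℕ → Ω → S) (m v : ℝ) {a b : ℕ} (ha : 2 ≤ a)
    (hb : 1 ≤ b) (ω : Ω) :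
    √(a : ℝ) * (bmEstimator (fun i ↦ f (X i ω)) a b - v) - devSum (fun x ↦ f x - m) X v a b ω
      = ((a : ℝ) - 1)⁻¹ * (devSum (fun x ↦ f x - m) X v a b ω
        - √(a : ℝ) * blockDev (fun x ↦ f x - m) X v 0 (a * b) ω) := by
  have hsq : √(a : ℝ) ^ 2 = a := Real.sq_sqrt (by positivity)
  have hr : √(a : ℝ) ≠ 0 := by positivity
  have ha1 : √(a : ℝ) ^ 2 - 1 ≠ 0 := by
    have : (2 : ℝ) ≤ a := by exact_mod_cast ha
    rw [hsq]; linarith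
  rw [bmEstimator_eq f X m ha hb]
  simp only [devSum, blockDev, Finset.sum_sub_distrib, Finset.sum_const, Finset.card_range,
    nsmul_eq_mul]
  generalize ∑ k ∈ Finset.range a, blockSum (fun x ↦ f x - m) X (k * b) b ω ^ 2 / b = Q
  push_cast
  generalize blockSum (fun x ↦ f x - m) X 0 (a * b) ω ^ 2 / (a * b) = W
  generalize √(a : ℝ) = r at *
  rw [← hsq]
  field_simp
  ring

lemma measurable_bmEstimator [MeasurableSpace S] [MeasurableSpace Ω] {f : S → ℝ}
    (hf : Measurable f) {X : ℕ → Ω → S} (hX : ∀ n, Measurable (X n)) (a b : ℕ) :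
    Measurable fun ω ↦ bmEstimator (fun i ↦ f (X i ω)) a b := by
  unfold bmEstimator overallMean batchMean
  fun_prop

end Estimator

/-! ### Negligibility of the correction terms. -/

section Remainder

variable {S Ω : Type*} [MeasurableSpace S] [mΩ : MeasurableSpace Ω] {K : Kernel S S}
  {π : Measure S} {P : Measure Ω} {X : ℕ → Ω → S} {κ : ℝ} {f g : S → ℝ}
  [IsMarkovKernel K] [IsProbabilityMeasure π] [IsProbabilityMeasure P]

/-- Replacing the estimator by the normalized sum of squared block sums is negligible. -/
theorem GapChain.tendstoInMeasure_sub_devSum (H : GapChain K π P X κ g) (hf : Measurable f) (m : ℝ)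
    (hpois : ∀ᵐ x ∂π, g x - kernelOp K g x = f x - m) {a b : ℕ → ℕ} (ha : Tendsto a atTop atTop)
    (hb : Tendsto b atTop atTop) :
    TendstoInMeasure P
      ((fun n ω ↦ √(a n : ℝ) * (bmEstimator (fun i ↦ f (X i ω)) (a n) (b n) - martVar K π g))
        - fun n ↦ devSum (fun x ↦ f x - m) X (martVar K π g) (a n) (b n)) atTop 0 := by
  obtain ⟨C, hC, hbd⟩ := H.exists_blockDev_bounds hpois
  obtain ⟨v, hv⟩ : ∃ v, v = martVar K π g := ⟨_, rfl⟩
  rw [← hv] at hbd ⊢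
  have hfm : Measurable fun x ↦ f x - m := hf.sub_const m
  have hdm (n : ℕ) := measurable_devSum (K := K) (π := π) (P := P) H.chain hfm v (a n) (b n)
  have ha' : Tendsto (fun n ↦ √(a n : ℝ)) atTop atTop :=
    Real.tendsto_sqrt_atTop.comp (tendsto_natCast_atTop_atTop.comp ha)
  have hlim : Tendsto (fun n ↦ ENNReal.ofReal (4 * C * (√(a n : ℝ))⁻¹)) atTop (𝓝 0) := by
    have := ENNReal.tendsto_ofReal (ha'.inv_tendsto_atTop.const_mul (4 * C))
    simpa using this
  refine tendstoInMeasure_of_tendsto_eLpNorm (p := 4) (by norm_num) (fun n ↦ ?_)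
    aestronglyMeasurable_const (tendsto_of_tendsto_of_tendsto_of_le_of_le' tendsto_const_nhds hlim
      (Eventually.of_forall fun n ↦ zero_le) ?_)
  · exact ((((measurable_bmEstimator hf H.chain.measurable (a n) (b n)).sub_const v).const_mul
      _).sub (hdm n)).aestronglyMeasurable
  filter_upwards [ha.eventually_ge_atTop 2, hb.eventually_ge_atTop 1] with n han hbn
  obtain ⟨r, hr⟩ : ∃ r, r = √(a n : ℝ) := ⟨_, rfl⟩
  have ha2 : (2 : ℝ) ≤ a n := by exact_mod_cast han
  have hrn : (a n : ℝ) = r ^ 2 := by rw [hr, Real.sq_sqrt (by positivity)]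
  have hr0 : 0 < r := by rw [hr]; positivity
  -- The triangle inequality, ignoring cancellation, is enough: the prefactor 1/(a - 1) beats the
  -- resulting √a.
  have hsum : MemLp (fun ω ↦ ∑ k ∈ Finset.range (a n),
        blockDev (fun x ↦ f x - m) X v (k * b n) (b n) ω) 4 P ∧
      lpNorm (fun ω ↦ ∑ k ∈ Finset.range (a n),
        blockDev (fun x ↦ f x - m) X v (k * b n) (b n) ω) 4 P ≤ a n * C := by
    generalize a n = N
    induction N with
    | zero => simp
    | succ N ih =>
      have h1 := hbd (N * b n) (b n) hbn
      simp_rw [Finset.sum_range_succ]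
      refine ⟨ih.1.add h1.1, (lpNorm_add_le ih.1 (by norm_num)).trans ?_⟩
      push_cast
      linarith [ih.2, h1.2.1]
  have hdev : MemLp (devSum (fun x ↦ f x - m) X v (a n) (b n)) 4 P := hsum.1.const_mul _
  have hdevn : lpNorm (devSum (fun x ↦ f x - m) X v (a n) (b n)) 4 P ≤ r * C := by
    have h1 : devSum (fun x ↦ f x - m) X v (a n) (b n) = fun ω ↦ r⁻¹ *
        ∑ k ∈ Finset.range (a n), blockDev (fun x ↦ f x - m) X v (k * b n) (b n) ω := by
      ext ω; rw [devSum, hr]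
    rw [h1, lpNorm_const_mul, abs_of_nonneg (by positivity)]
    calc _ ≤ r⁻¹ * (a n * C) := by gcongr; exact hsum.2
      _ = r * C := by rw [hrn]; field_simp
  have hab1 : 1 ≤ a n * b n := Nat.mul_pos (by lia) hbn
  obtain ⟨hD, hDn, -⟩ := hbd 0 (a n * b n) hab1
  have hEq : ((fun n ω ↦ √(a n : ℝ) * (bmEstimator (fun i ↦ f (X i ω)) (a n) (b n) - v))
        - fun n ↦ devSum (fun x ↦ f x - m) X v (a n) (b n)) n - (0 : ℕ → Ω → ℝ) n
      = fun ω ↦ ((a n : ℝ) - 1)⁻¹ * (devSum (fun x ↦ f x - m) X v (a n) (b n) ω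
        - r * blockDev (fun x ↦ f x - m) X v 0 (a n * b n) ω) := by
    ext ω
    rw [hr, ← sqrt_mul_bmEstimator_sub f X m v han hbn]
    simp
  have hmem : MemLp (fun ω ↦ devSum (fun x ↦ f x - m) X v (a n) (b n) ω
        - r * blockDev (fun x ↦ f x - m) X v 0 (a n * b n) ω) 4 P := hdev.sub (hD.const_mul r)
  have hnorm : lpNorm (fun ω ↦ devSum (fun x ↦ f x - m) X v (a n) (b n) ω
        - r * blockDev (fun x ↦ f x - m) X v 0 (a n * b n) ω) 4 P ≤ 2 * (r * C) := by
    refine (lpNorm_sub_le hdev (by norm_num)).trans ?_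
    rw [lpNorm_const_mul, abs_of_pos hr0]
    have := mul_le_mul_of_nonneg_left hDn hr0.le
    linarith
  change eLpNorm (((fun n ω ↦ √(a n : ℝ) * (bmEstimator (fun i ↦ f (X i ω)) (a n) (b n) - v))
        - fun n ↦ devSum (fun x ↦ f x - m) X v (a n) (b n)) n - (0 : ℕ → Ω → ℝ) n) 4 P ≤ _
  rw [hEq, ← ofReal_lpNorm (hmem.const_mul _)]
  refine ENNReal.ofReal_le_ofReal ?_
  rw [lpNorm_const_mul, abs_of_nonneg (inv_nonneg.2 (by linarith)), ← hr]
  have ha1 : 0 < (a n : ℝ) - 1 := by linarith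
  calc _ ≤ ((a n : ℝ) - 1)⁻¹ * (2 * (r * C)) := by gcongr
    _ ≤ 4 * C * r⁻¹ := by
      rw [hrn] at ha1 ha2 ⊢
      -- The constant 4 uses a ≤ 2 (a - 1), valid since a ≥ 2.
      rw [inv_mul_le_iff₀ ha1]
      calc 2 * (r * C) = r ^ 2 * (2 * C * r⁻¹) := by field_simp
        _ ≤ 2 * (r ^ 2 - 1) * (2 * C * r⁻¹) := by gcongr; linarith
        _ = _ := by ring

end Remainder

end BatchMeans

end

/-! ### Assembly of the theorem. -/

theorem theorem1 {S Ω : Type*} [MeasurableSpace S] [MeasurableSpace Ω]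
    (K : Kernel S S) [IsMarkovKernel K] (π : Measure S) [IsProbabilityMeasure π]
    (P : Measure Ω) [IsProbabilityMeasure P] (X : ℕ → Ω → S)
    (hX : BatchMeans.IsMarkovChain K π P X)
    (hinv : Kernel.Invariant K π)
    (hrev : Kernel.IsReversible K π)
    (hgeo : BatchMeans.GeometricallyErgodic K π)
    (f : S → ℝ) (hf : Measurable f) (hf8 : Integrable (fun x ↦ f x ^ 8) π)
    (a b : ℕ → ℕ) (ha : Tendsto a atTop atTop) (hb : Tendsto b atTop atTop)
    (hab : Tendsto (fun n ↦ √(a n : ℝ) / (b n : ℝ)) atTop (𝓝 0)) :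
    Summable (fun i : ℕ ↦ BatchMeans.autocov P X f (i + 1)) ∧
    TendstoInDistribution
      (fun (n : ℕ) (ω : Ω) ↦ √(a n : ℝ) *
        (BatchMeans.bmEstimator (fun i ↦ f (X i ω)) (a n) (b n) - BatchMeans.mcmcVariance P X f))
      atTop id (fun _ ↦ P)
      (gaussianReal 0 (Real.toNNReal (2 * BatchMeans.mcmcVariance P X f ^ 2))) := by
  have hfL8 : MemLp f 8 π := by
    refine (integrable_norm_rpow_iff hf.aestronglyMeasurable (by norm_num) (by norm_num)).1
      (hf8.congr (ae_of_all _ fun x ↦ ?_))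
    norm_num
    exact (Even.pow_abs (by decide) _).symm
  obtain ⟨h, hh⟩ : ∃ h : S → ℝ, h = fun x ↦ f x - ∫ y, f y ∂π := ⟨_, rfl⟩
  have hhm : Measurable h := by rw [hh]; exact hf.sub_const _
  have hh8 : MemLp h 8 π := by rw [hh]; exact hfL8.sub (memLp_const _)
  have hh2 : MemLp h 2 π := hh8.mono_exponent (by norm_num)
  have hf2 : MemLp f 2 π := hfL8.mono_exponent (by norm_num)
  have hh0 : ∫ x, h x ∂π = 0 := by
    rw [hh, integral_sub (hf2.integrable (by norm_num)) (integrable_const _)]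
    simp
  obtain ⟨κ, hκ, hκ1, hdec, hsolve⟩ := BatchMeans.exists_decay_and_poisson hinv hrev hgeo
  obtain ⟨g, hgm, hg8, hg0, hpois⟩ := hsolve h hhm hh8 hh0
  have hg2 : MemLp g 2 π := hg8.mono_exponent (by norm_num)
  have H : BatchMeans.GapChain K π P X κ g := ⟨hX, hinv, hκ, hκ1, hdec, hgm, hg8, hg0⟩
  have hcov := BatchMeans.autocov_eq hX hinv hf hf2 hh
  -- Both sides equal ∫ h² + 2 ∫ h Tg: the left by summing the autocovariances, the right by
  -- `martVar_eq`.
  have hvar : BatchMeans.mcmcVariance P X f = BatchMeans.martVar K π g := by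
    rw [BatchMeans.mcmcVariance, ← covariance_self (X := fun ω ↦ f (X 0 ω))
        (hf.comp (hX.measurable 0)).aemeasurable,
      ← BatchMeans.autocov]
    simp_rw [hcov]
    rw [BatchMeans.tsum_integral_mul_iterate hinv hdec hκ hκ1 hhm hh2 hh0 hgm hg2 hg0 hpois,
      BatchMeans.martVar_eq hinv hgm hg2 hh2 hpois]
    rfl
  refine ⟨?_, ?_⟩
  · simp_rw [hcov]
    exact BatchMeans.summable_integral_mul_iterate hinv hdec hκ hκ1 hhm hh2 hh0
  · rw [hvar]
    -- Slutsky's lemma: the limit law of the normalized sum passes to the estimator because their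
    -- difference tends to zero in probability.
    refine tendstoInDistribution_of_tendstoInMeasure_sub _ _
      (H.tendstoInDistribution_devSum hhm hpois ha hb hab) ?_ fun n ↦ ?_
    · rw [hh] at hpois ⊢
      exact H.tendstoInMeasure_sub_devSum hf _ hpois ha hb
    · exact ((BatchMeans.measurable_bmEstimator hf hX.measurable (a n) (b n)).sub_const
        _).const_mul _ |>.aemeasurable
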